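/- Let $\Omega\subset\mathbb R^2$ be a bounded open set with smooth boundary, let $S_1$ be a non-empty open set with smooth boundary such that $\overline{S_1}\subset\Omega$, and put $S_2=\Omega\setminus\overline{S_1}$. Let $a>0$, $a\neq1$, and let $p=1$ in $S_1$, $p=a$ in $S_2$ (with $p=\min(1,a)$ on $\partial S_1$, so that $p$ is lower semicontinuous). For a finite signed Borel measure $\mu\in\mathcal M(\Omega)\cap H^{-1}(\Omega)$ let $h_\mu$ be the weak solution, with $h_\mu-1\in H^1_0(\Omega)$, of $$-\operatorname{div}\Big(\frac1p\nabla h_\mu\Big)+h_\mu=\mu\ \text{ in }\Omega,\qquad h_\mu=1\ \text{ on }\partial\Omega ,$$ and for $\lambda>0$ put $$E_\lambda(\mu)=\frac1\lambda\int_\Omega p\,d|\mu|+\int_\Omega\Big(\frac1p|\nabla h_\mu|^2+|h_\mu-1|^2\Big)\,dx .$$ For each $\lambda>0$ let $\mu_*=\mu_{*,\lambda}$ be the minimizer of $E_\lambda$ over $\mathcal M(\Omega)\cap H^{-1}(\Omega)$ and $h_*=h_{*,\lambda}=h_{\mu_*}$; let $h_0$ be the solution $h_\mu$ for $\mu=0$.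 The value of $h_*$ or $h_0$ at a point $x\in\overline\Omega$ is understood as the essential lower limit of the function at $x$, $\operatorname{ess\,lim\,inf}_{y\to x,\,y\in\Omega}$ (the value of the continuous representative whenever there is one). Define $$w_\lambda^1=\Big\{x\in\overline{S_1}: 1-h_*(x)=\frac1{2\lambda}\Big\},\quad w_\lambda^2=\Big\{x\in\overline{S_2}: \frac{1-h_*(x)}{a}=\frac1{2\lambda}\Big\},\quad w_\lambda=w_\lambda^1\cup w_\lambda^2,$$ $$\lambda_1(a)=\frac1{2\max_{\overline{S_1}}(1-h_0)},\qquad \lambda_2(a)=\frac1{2\max_{\overline{S_2}}\frac{1-h_0}{a}},\qquad \lambda_0(a)=\min(\lambda_1(a),\lambda_2(a)),$$ and $w_0=w_{\lambda_0(a)}$. Then, for $\lambda>0$: 1. $w_\lambda\subset w_{\lambda'}$ whenever $\lambda\le\lambda'$, and $\bigcup_{\lambda>0}w_\lambda=\Omega$; 2. $w_\lambda^1$ and $w_\lambda^2$ are disjoint; 3. if $\lambda<\lambda_0(a)$, then $h_*=h_0$ (almost everywhere in $\Omega$), $\mu_*=0$ and $w_\lambda=\emptyset$; 4. if $\lambda=\lambda_0(a)$,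 then $h_*=h_0$ (almost everywhere in $\Omega$), $\mu_*=0$ and $w_\lambda=w_0$; 5. if $\lambda>\lambda_0(a)$, then $\mu_*\neq0$; 6. if $\lambda<\lambda_i(a)$ for some $i\in\{1,2\}$, then $w_\lambda^i=\emptyset$. -/

import Mathlib

open MeasureTheory Filter Topology Set
open scoped ContDiff

noncomputable section

namespace VortexObstacle

/-- The plane with its Euclidean norm. -/
abbrev Plane : Type := EuclideanSpace ℝ (Fin 2)

/-- The boundary of `U` is smooth: near each boundary point, `U` is the positivity set of a
smooth function whose derivative does not vanish at that point. -/
def HasSmoothBoundary (U : Set Plane) : Prop :=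
  ∀ x ∈ frontier U, ∃ ρ : Plane → ℝ, ContDiff ℝ ∞ ρ ∧ fderiv ℝ ρ x ≠ 0 ∧
    ∀ᶠ y in 𝓝 x, (y ∈ U ↔ 0 < ρ y)

/-- The outer region `S₂ = Ω \ closure S₁`. -/
def outerRegion (Ω S₁ : Set Plane) : Set Plane := Ω \ closure S₁

open scoped Classical in
/-- The step function `p`, equal to `1` in `S₁` and to `a` in `Ω \ closure S₁`. On the interface
`∂S₁` it takes the smaller of the two values, which makes it lower semicontinuous. -/
def pinning (S₁ : Set Plane) (a : ℝ) (x : Plane) : ℝ :=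
  if x ∈ S₁ then 1 else if x ∈ closure S₁ then min 1 a else a

/-- Test functions: `C_c^∞(Ω)`. -/
def IsTest (Ω : Set Plane) (φ : Plane → ℝ) : Prop :=
  ContDiff ℝ ∞ φ ∧ HasCompactSupport φ ∧ tsupport φ ⊆ Ω

/-- `f ∈ H¹₀(Ω)` with (weak) gradient `G`: the pair `(f, G)` is the limit in `L²(Ω)` of
`(φ n, ∇ φ n)` for test functions `φ n`, i.e. `f` lies in the closure of `C_c^∞(Ω)` in `H¹(Ω)`. -/
structure MemH10 (Ω : Set Plane) (f : Plane → ℝ) (G : Plane → Plane) : Prop where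
  memLp : MemLp f 2 (volume.restrict Ω)
  grad_memLp : MemLp G 2 (volume.restrict Ω)
  approx : ∃ φ : ℕ → Plane → ℝ, (∀ n, IsTest Ω (φ n)) ∧
    Tendsto (fun n => eLpNorm (fun x => f x - φ n x) 2 (volume.restrict Ω)) atTop (𝓝 0) ∧
    Tendsto (fun n => eLpNorm (fun x => G x - gradient (φ n) x) 2 (volume.restrict Ω))
      atTop (𝓝 0)

/-- The integral of `φ` against a finite signed measure. -/
def signedIntegral (μ : SignedMeasure Plane) (φ : Plane → ℝ) : ℝ :=
  ∫ x, φ x ∂μ.toJordanDecomposition.posPart - ∫ x, φ x ∂μ.toJordanDecomposition.negPart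

/-- `μ ∈ M(Ω) ∩ H⁻¹(Ω)`: a finite signed measure carried by `Ω` which is bounded on test
functions with respect to the `H¹` norm. -/
def MemMeasureDual (Ω : Set Plane) (μ : SignedMeasure Plane) : Prop :=
  μ.totalVariation Ωᶜ = 0 ∧
    ∃ C : ℝ, ∀ φ : Plane → ℝ, IsTest Ω φ →
      |signedIntegral μ φ| ≤ C * Real.sqrt (∫ x in Ω, (‖gradient φ x‖ ^ 2 + φ x ^ 2))

/-- `h` (with weak gradient `G`) is the weak solution `h_μ` of
`-div (p⁻¹ ∇h) + h = μ` in `Ω`, `h = 1` on `∂Ω` (that is, `h - 1 ∈ H¹₀(Ω)`). -/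
structure IsPotential (Ω S₁ : Set Plane) (a : ℝ) (μ : SignedMeasure Plane)
    (h : Plane → ℝ) (G : Plane → Plane) : Prop where
  boundary : MemH10 Ω (fun x => h x - 1) G
  weak_eq : ∀ φ : Plane → ℝ, IsTest Ω φ →
    ∫ x in Ω, ((1 / pinning S₁ a x) * inner ℝ (G x) (gradient φ x) + h x * φ x)
      = signedIntegral μ φ

/-- The limiting energy
`E_λ(μ) = λ⁻¹ ∫_Ω p d|μ| + ∫_Ω (p⁻¹ |∇h_μ|² + |h_μ - 1|²)`, as an expression in `μ`, its
potential `h` and the gradient `G` of `h`. -/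
def limitEnergy (Ω S₁ : Set Plane) (a lam : ℝ) (μ : SignedMeasure Plane)
    (h : Plane → ℝ) (G : Plane → Plane) : ℝ :=
  1 / lam * ∫ x in Ω, pinning S₁ a x ∂μ.totalVariation
    + ∫ x in Ω, ((1 / pinning S₁ a x) * ‖G x‖ ^ 2 + |h x - 1| ^ 2)

/-- `μ` minimizes `E_λ` over `M(Ω) ∩ H⁻¹(Ω)`, and `h` is its potential `h_μ`. -/
def IsEnergyMinimizer (Ω S₁ : Set Plane) (a lam : ℝ) (μ : SignedMeasure Plane)
    (h : Plane → ℝ) : Prop :=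
  MemMeasureDual Ω μ ∧ ∃ G : Plane → Plane, IsPotential Ω S₁ a μ h G ∧
    ∀ (ν : SignedMeasure Plane) (k : Plane → ℝ) (K : Plane → Plane),
      MemMeasureDual Ω ν → IsPotential Ω S₁ a ν k K →
        limitEnergy Ω S₁ a lam μ h G ≤ limitEnergy Ω S₁ a lam ν k K

/-- The pointwise value on `closure Ω` of a function that is only defined almost everywhere in
`Ω`: the essential lower limit at `x`. It does not depend on the chosen representative, and it is
the value of the continuous representative when there is one. -/
def value (Ω : Set Plane) (h : Plane → ℝ) (x : Plane) : ℝ :=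
  liminf h (ae (volume.restrict Ω) ⊓ 𝓝 x)

theorem value_eq_of_continuousOn {Ω : Set Plane} (hΩ : IsOpen Ω) {h f : Plane → ℝ}
    (hf : ContinuousOn f (closure Ω)) (hfh : h =ᵐ[volume.restrict Ω] f)
    {x : Plane} (hx : x ∈ closure Ω) : value Ω h x = f x := by
  have hne : (ae (volume.restrict Ω) ⊓ 𝓝 x).NeBot := by
    rw [inf_neBot_iff]
    intro s hs t ht
    obtain ⟨u, hut, huo, hxu⟩ := mem_nhds_iff.1 ht
    by_contra hcon
    have hsub : u ∩ Ω ⊆ sᶜ ∩ Ω := fun y hy => ⟨fun hys => hcon ⟨y, hys, hut hy.1⟩, hy.2⟩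
    have h0 : volume (sᶜ ∩ Ω) = 0 := by
      have := mem_ae_iff.1 hs
      rwa [Measure.restrict_apply' hΩ.measurableSet] at this
    have h1 : volume (u ∩ Ω) = 0 := measure_mono_null hsub h0
    have h2 : (u ∩ Ω).Nonempty := mem_closure_iff.1 hx u huo hxu
    exact ((huo.inter hΩ).measure_pos volume h2).ne' h1
  have hmem : ∀ᵐ y ∂(volume.restrict Ω), y ∈ Ω := ae_restrict_mem hΩ.measurableSet
  have hle : ae (volume.restrict Ω) ⊓ 𝓝 x ≤ 𝓝[closure Ω] x := by
    rw [nhdsWithin, inf_comm]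
    refine inf_le_inf le_rfl (le_principal_iff.2 ?_)
    filter_upwards [hmem] with y hy using subset_closure hy
  have ht : Tendsto h (ae (volume.restrict Ω) ⊓ 𝓝 x) (𝓝 (f x)) :=
    ((hf x hx).mono_left hle).congr' ((hfh.filter_mono inf_le_left).symm)
  exact ht.liminf_eq

/-- The part of the coincidence set in `closure S`, where `S` is one of the two regions and `c`
the value of `p` there: the points of `closure S` with `(1 - h) / c = 1 / (2 λ)`. -/
def contactSet (Ω S : Set Plane) (c lam : ℝ) (h : Plane → ℝ) : Set Plane :=
  {x | x ∈ closure S ∧ (1 - value Ω h x) / c = 1 / (2 * lam)}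

/-- The critical constant `1 / (2 max_{closure S} ((1 - h₀) / c))`, where `S` is one of the two
regions and `c` the value of `p` there. -/
def critical (Ω S : Set Plane) (c : ℝ) (h₀ : Plane → ℝ) : ℝ :=
  1 / (2 * sSup ((fun x => (1 - value Ω h₀ x) / c) '' closure S))

/-- `w_λ¹`. -/
def w1 (Ω S₁ : Set Plane) (lam : ℝ) (h : Plane → ℝ) : Set Plane :=
  contactSet Ω S₁ 1 lam h

/-- `w_λ²`. -/
def w2 (Ω S₁ : Set Plane) (a lam : ℝ) (h : Plane → ℝ) : Set Plane :=
  contactSet Ω (outerRegion Ω S₁) a lam h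

/-- The coincidence set `w_λ = w_λ¹ ∪ w_λ²`. -/
def w (Ω S₁ : Set Plane) (a lam : ℝ) (h : Plane → ℝ) : Set Plane :=
  w1 Ω S₁ lam h ∪ w2 Ω S₁ a lam h

/-- `λ₁(a)`. -/
def lam1 (Ω S₁ : Set Plane) (h₀ : Plane → ℝ) : ℝ := critical Ω S₁ 1 h₀

/-- `λ₂(a)`. -/
def lam2 (Ω S₁ : Set Plane) (a : ℝ) (h₀ : Plane → ℝ) : ℝ :=
  critical Ω (outerRegion Ω S₁) a h₀

/-- `λ₀(a) = min (λ₁(a), λ₂(a))`. -/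
def lam0 (Ω S₁ : Set Plane) (a : ℝ) (h₀ : Plane → ℝ) : ℝ :=
  min (lam1 Ω S₁ h₀) (lam2 Ω S₁ a h₀)

end VortexObstacle

end

/-! Put `u = 1 - h_*`, an element of `H¹₀(Ω)`. Everything follows from one fact: `u` solves the
obstacle problem for `-div (p⁻¹ ∇u) + u = 1` under the constraint `u ≤ p / (2λ)`
(`isObstacleSolution_of_minimizer`). Adding to `μ_*` a small multiple of Lebesgue measure on a set
gives the constraint. Shrinking `μ_*` gives `∫ p/(2λ) d|μ_*| ≤ ⟨μ_*, u⟩`, the pairing being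
expressed through the bilinear form of the equation. Let `v` be the obstacle solution furnished by
projection in a Hilbert space. Once `⟨μ_*, v⟩ ≤ ∫ p/(2λ) d|μ_*|` is known
(`form_le_integral_obstacle`), `⟨μ_*, u - v⟩ ≥ 0`. Combined with the variational inequality for `v`
tested with `u`, this makes the energy of `u - v` nonpositive, so `u = v`.

The pairing bound is the delicate point: `μ_*` may charge Lebesgue-null sets such as the interface,
where an almost everywhere constraint says nothing and `p` jumps. A barrier argument shows that the
essential upper limit of `v` at every point is at most `p/(2λ)` for the lower semicontinuous `p`
(`locally_le`). A partition of unity then inserts a smooth function between `v` and `p/(2λ) + ε`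
(`exists_smooth_between`), and truncation by it yields test functions that `μ_*` can be integrated
against.

The same pointwise bound, together with decay at `∂Ω`, identifies `w_λ` with the points of `Ω` where
`1 - h_* = p/(2λ)` (`mem_w_iff`). By comparison `λ u_λ` is nondecreasing in `λ`, while its ceiling
`p/2` is fixed; this gives monotonicity. For exhaustion, each point of `Ω` carries a compactly
supported subsolution below `p` touching it there (`exists_touching`); at the interface the jump of
its conormal derivative must have the right sign. For a suitable `λ`, a multiple of it lies below
`u_λ` and forces contact.

Finally `u₀ = 1 - h₀` is the unconstrained solution, and `λ ≤ λ₀(a)` says exactly that `u₀` respects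
the obstacle. Then `u = u₀`, and equal potentials force `μ_* = 0`; conversely `μ_* = 0` makes `u₀`
respect the obstacle. The inequality `u ≤ u₀` empties `w_λ^i` below `λ_i(a)`, and disjointness is
just `a ≠ 1`. -/

noncomputable section

namespace VortexObstacle

/-! ### Calculus rules for the gradient. -/

section Gradient

variable {f g : Plane → ℝ} {x : Plane}

theorem gradient_fun_sub (hf : DifferentiableAt ℝ f x) (hg : DifferentiableAt ℝ g x) :
    gradient (fun y => f y - g y) x = gradient f x - gradient g x := by
  simp only [gradient, fderiv_fun_sub hf hg, map_sub]

theorem gradient_fun_add (hf : DifferentiableAt ℝ f x) (hg : DifferentiableAt ℝ g x) :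
    gradient (fun y => f y + g y) x = gradient f x + gradient g x := by
  simp only [gradient, fderiv_fun_add hf hg, map_add]

theorem gradient_fun_const_mul (c : ℝ) (hf : DifferentiableAt ℝ f x) :
    gradient (fun y => c * f y) x = c • gradient f x := by
  simp only [gradient, fderiv_const_mul hf c, map_smul]

theorem gradient_fun_add_const (c : ℝ) :
    gradient (fun y => f y + c) x = gradient f x := by
  simp only [gradient, fderiv_add_const]

theorem gradient_comp_real {θ : ℝ → ℝ} (hθ : DifferentiableAt ℝ θ (f x))
    (hf : DifferentiableAt ℝ f x) :
    gradient (fun y => θ (f y)) x = deriv θ (f x) • gradient f x := by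
  have h := (hθ.hasDerivAt.comp_hasFDerivAt x hf.hasFDerivAt).fderiv
  have h' : fderiv ℝ (fun y => θ (f y)) x = deriv θ (f x) • fderiv ℝ f x := h
  simp only [gradient, h', map_smul]

theorem continuous_gradient (hf : ContDiff ℝ ∞ f) : Continuous (gradient f) :=
  (InnerProductSpace.toDual ℝ Plane).symm.continuous.comp
    (hf.continuous_fderiv (by simp))

theorem gradient_eq_zero_of_notMem_tsupport (hx : x ∉ tsupport f) : gradient f x = 0 := by
  have h : f =ᶠ[𝓝 x] fun _ => 0 := notMem_tsupport_iff_eventuallyEq.1 hx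
  rw [h.gradient_eq, gradient_fun_const]

end Gradient

/-! ### Convergence tools in `L²`. -/

section Dominated

variable {X : Type*} [MeasurableSpace X] {ν : Measure X} {E : Type*} [NormedAddCommGroup E]

/-- Dominated convergence in `L²`. -/
theorem tendsto_eLpNorm_two_of_dominated {f : ℕ → X → E} {g : X → ℝ}
    (hf : ∀ n, AEStronglyMeasurable (f n) ν) (hg : MemLp g 2 ν)
    (hfg : ∀ n, ∀ᵐ x ∂ν, ‖f n x‖ ≤ g x)
    (hlim : ∀ᵐ x ∂ν, Tendsto (fun n => f n x) atTop (𝓝 0)) :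
    Tendsto (fun n => eLpNorm (f n) 2 ν) atTop (𝓝 0) := by
  have h2 : ∀ u : X → E, eLpNorm u 2 ν = (∫⁻ x, ‖u x‖ₑ ^ (2 : ℝ) ∂ν) ^ (1 / (2 : ℝ)) := by
    intro u
    rw [eLpNorm_eq_lintegral_rpow_enorm_toReal (by norm_num) (by norm_num)]
    norm_num
  simp only [h2]
  have key : Tendsto (fun n => ∫⁻ x, ‖f n x‖ₑ ^ (2 : ℝ) ∂ν) atTop (𝓝 (∫⁻ _, 0 ∂ν)) := by
    refine tendsto_lintegral_of_dominated_convergence' (fun x => ‖g x‖ₑ ^ (2 : ℝ))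
      (fun n => (hf n).enorm.pow_const _) ?_ ?_ ?_
    · intro n
      filter_upwards [hfg n] with x hx
      gcongr
      rw [enorm_le_iff_norm_le]
      exact hx.trans (le_abs_self _)
    · have := hg.2
      rw [eLpNorm_eq_lintegral_rpow_enorm_toReal (by norm_num) (by norm_num)] at this
      simp only [ENNReal.toReal_ofNat] at this
      intro hcon
      rw [hcon] at this
      simp at this
    · filter_upwards [hlim] with x hx
      have h1 : Tendsto (fun n => ‖f n x‖ₑ) atTop (𝓝 0) := by
        have := hx.enorm
        simpa using this
      have h3 := (ENNReal.continuous_rpow_const (y := (2 : ℝ))).tendsto 0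
      have h4 := h3.comp h1
      simpa [Function.comp_def] using h4
  rw [lintegral_zero] at key
  have h3 := (ENNReal.continuous_rpow_const (y := (1 / 2 : ℝ))).tendsto 0
  have h4 := h3.comp key
  simpa [Function.comp_def] using h4

theorem memLp_two_indicator_of_bound [NormedSpace ℝ E] {F : X → E} (hF : MemLp F 2 ν)
    {c : X → ℝ} (hc : AEStronglyMeasurable c ν) {C : ℝ} (hC : ∀ᵐ x ∂ν, |c x| ≤ C) :
    MemLp (fun x => c x • F x) 2 ν := by
  refine MemLp.of_le_mul (c := C) hF (hc.smul hF.1) ?_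
  filter_upwards [hC] with x hx
  rw [norm_smul]
  exact mul_le_mul_of_nonneg_right hx (norm_nonneg _)

/-- An `L²`-convergent sequence has an almost everywhere convergent subsequence. -/
theorem exists_subseq_ae_tendsto {f : ℕ → X → E} {g : X → E}
    (hf : ∀ n, AEStronglyMeasurable (f n) ν) (hg : AEStronglyMeasurable g ν)
    (h : Tendsto (fun n => eLpNorm (fun x => g x - f n x) 2 ν) atTop (𝓝 0)) :
    ∃ s : ℕ → ℕ, StrictMono s ∧ ∀ᵐ x ∂ν, Tendsto (fun n => f (s n) x) atTop (𝓝 (g x)) := by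
  have h' : Tendsto (fun n => eLpNorm (f n - g) 2 ν) atTop (𝓝 0) := by
    refine h.congr fun n => ?_
    rw [← eLpNorm_neg]
    congr 1
    ext x
    simp
  exact (tendstoInMeasure_of_tendsto_eLpNorm (by norm_num) hf hg h').exists_seq_tendsto_ae

end Dominated

/-! ### The bilinear form of the equation. -/

section Form

variable {X : Type*} [MeasurableSpace X]

/-- The bilinear form `∫ (A ⟪F, G⟫ + f g)` on pairs of a function and a vector field. -/
def form (ν : Measure X) (A : X → ℝ) (f : X → ℝ) (F : X → Plane) (g : X → ℝ) (G : X → Plane) : ℝ :=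
  ∫ x, (A x * inner ℝ (F x) (G x) + f x * g x) ∂ν

variable {ν : Measure X} {A : X → ℝ} {C : ℝ} {f g k : X → ℝ} {F G K : X → Plane}

theorem integrable_mul_inner (hA : Measurable A) (hC : ∀ x, |A x| ≤ C) (hF : MemLp F 2 ν)
    (hG : MemLp G 2 ν) : Integrable (fun x => A x * inner ℝ (F x) (G x)) ν := by
  have h : Integrable (fun x => C * (‖F x‖ * ‖G x‖)) ν :=
    (MemLp.integrable_mul hF.norm hG.norm).const_mul C
  refine h.mono' (hA.aestronglyMeasurable.mul (hF.1.inner hG.1)) (Eventually.of_forall fun x => ?_)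
  rw [norm_mul]
  exact mul_le_mul (hC x) (norm_inner_le_norm _ _) (norm_nonneg _) ((abs_nonneg _).trans (hC x))

theorem integrable_form (hA : Measurable A) (hC : ∀ x, |A x| ≤ C) (hf : MemLp f 2 ν)
    (hF : MemLp F 2 ν) (hg : MemLp g 2 ν) (hG : MemLp G 2 ν) :
    Integrable (fun x => A x * inner ℝ (F x) (G x) + f x * g x) ν :=
  (integrable_mul_inner hA hC hF hG).add (MemLp.integrable_mul hf hg)

theorem form_comm : form ν A f F g G = form ν A g G f F := by
  unfold form
  congr 1
  ext x
  rw [real_inner_comm, mul_comm (f x)]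

theorem form_congr {f' g' : X → ℝ} {F' G' : X → Plane} (hf : f =ᵐ[ν] f') (hF : F =ᵐ[ν] F')
    (hg : g =ᵐ[ν] g') (hG : G =ᵐ[ν] G') : form ν A f F g G = form ν A f' F' g' G' := by
  refine integral_congr_ae ?_
  filter_upwards [hf, hF, hg, hG] with x h1 h2 h3 h4
  rw [h1, h2, h3, h4]

theorem form_add_right (hA : Measurable A) (hC : ∀ x, |A x| ≤ C) (hf : MemLp f 2 ν)
    (hF : MemLp F 2 ν) (hg : MemLp g 2 ν) (hG : MemLp G 2 ν) (hk : MemLp k 2 ν)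
    (hK : MemLp K 2 ν) :
    form ν A f F (fun x => g x + k x) (fun x => G x + K x)
      = form ν A f F g G + form ν A f F k K := by
  unfold form
  rw [← integral_add (integrable_form hA hC hf hF hg hG) (integrable_form hA hC hf hF hk hK)]
  congr 1
  ext x
  rw [inner_add_right]
  ring

theorem form_sub_right (hA : Measurable A) (hC : ∀ x, |A x| ≤ C) (hf : MemLp f 2 ν)
    (hF : MemLp F 2 ν) (hg : MemLp g 2 ν) (hG : MemLp G 2 ν) (hk : MemLp k 2 ν)
    (hK : MemLp K 2 ν) :
    form ν A f F (fun x => g x - k x) (fun x => G x - K x)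
      = form ν A f F g G - form ν A f F k K := by
  unfold form
  rw [← integral_sub (integrable_form hA hC hf hF hg hG) (integrable_form hA hC hf hF hk hK)]
  congr 1
  ext x
  rw [inner_sub_right]
  ring

theorem form_smul_right (c : ℝ) :
    form ν A f F (fun x => c * g x) (fun x => c • G x) = c * form ν A f F g G := by
  unfold form
  rw [← integral_const_mul]
  congr 1
  ext x
  rw [inner_smul_right]
  ring

theorem form_smul_left (c : ℝ) :
    form ν A (fun x => c * f x) (fun x => c • F x) g G = c * form ν A f F g G := by
  rw [form_comm, form_smul_right, form_comm]

theorem form_add_left (hA : Measurable A) (hC : ∀ x, |A x| ≤ C) (hf : MemLp f 2 ν)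
    (hF : MemLp F 2 ν) (hg : MemLp g 2 ν) (hG : MemLp G 2 ν) (hk : MemLp k 2 ν)
    (hK : MemLp K 2 ν) :
    form ν A (fun x => f x + g x) (fun x => F x + G x) k K
      = form ν A f F k K + form ν A g G k K := by
  rw [form_comm, form_add_right hA hC hk hK hf hF hg hG, form_comm, form_comm (f := k)]

theorem form_sub_left (hA : Measurable A) (hC : ∀ x, |A x| ≤ C) (hf : MemLp f 2 ν)
    (hF : MemLp F 2 ν) (hg : MemLp g 2 ν) (hG : MemLp G 2 ν) (hk : MemLp k 2 ν)
    (hK : MemLp K 2 ν) :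
    form ν A (fun x => f x - g x) (fun x => F x - G x) k K
      = form ν A f F k K - form ν A g G k K := by
  rw [form_comm, form_sub_right hA hC hk hK hf hF hg hG, form_comm, form_comm (f := k)]

/-- The form is positive definite. -/
theorem ae_eq_zero_of_form_self_le {c : ℝ} (hc : 0 < c) (hA : Measurable A)
    (hC : ∀ x, |A x| ≤ C) (hAc : ∀ x, c ≤ A x)
    (hf : MemLp f 2 ν) (hF : MemLp F 2 ν) (h : form ν A f F f F ≤ 0) :
    f =ᵐ[ν] 0 ∧ F =ᵐ[ν] 0 := by
  have hnn : ∀ x, 0 ≤ A x * inner ℝ (F x) (F x) + f x * f x := fun x =>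
    add_nonneg (mul_nonneg (hc.le.trans (hAc x)) real_inner_self_nonneg) (mul_self_nonneg _)
  have h0 : form ν A f F f F = 0 := le_antisymm h (integral_nonneg hnn)
  have h1 := (integral_eq_zero_iff_of_nonneg hnn (integrable_form hA hC hf hF hf hF)).1 h0
  have h2 : ∀ᵐ x ∂ν, f x = 0 ∧ F x = 0 := by
    filter_upwards [h1] with x hx
    simp only [Pi.zero_apply] at hx
    have a1 := mul_self_nonneg (f x)
    have a2 := mul_nonneg (hc.le.trans (hAc x)) (real_inner_self_nonneg (x := F x))
    have a3 : A x * inner ℝ (F x) (F x) = 0 := by linarith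
    refine ⟨mul_self_eq_zero.1 (by linarith), ?_⟩
    rcases mul_eq_zero.1 a3 with h | h
    · exact absurd h (hc.trans_le (hAc x)).ne'
    · exact inner_self_eq_zero.1 h
  exact ⟨h2.mono fun x hx => hx.1, h2.mono fun x hx => hx.2⟩

/-- The form is continuous with respect to `L²` convergence of pairs. -/
theorem tendsto_form (hA : Measurable A) (hC : ∀ x, |A x| ≤ C) (hf : MemLp f 2 ν)
    (hF : MemLp F 2 ν) (hg : MemLp g 2 ν) (hG : MemLp G 2 ν)
    {u : ℕ → X → ℝ} {U : ℕ → X → Plane} (hu : ∀ n, MemLp (u n) 2 ν) (hU : ∀ n, MemLp (U n) 2 ν)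
    (h1 : Tendsto (fun n => eLpNorm (fun x => g x - u n x) 2 ν) atTop (𝓝 0))
    (h2 : Tendsto (fun n => eLpNorm (fun x => G x - U n x) 2 ν) atTop (𝓝 0)) :
    Tendsto (fun n => form ν A f F (u n) (U n)) atTop (𝓝 (form ν A f F g G)) := by
  have hb : ∀ n, |form ν A f F g G - form ν A f F (u n) (U n)| ≤
      (ENNReal.ofReal |C| * (eLpNorm F 2 ν * eLpNorm (fun x => G x - U n x) 2 ν)
        + eLpNorm f 2 ν * eLpNorm (fun x => g x - u n x) 2 ν).toReal := by
    intro n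
    have hgu := hg.sub (hu n)
    have hGU := hG.sub (hU n)
    have e : ENNReal.ofReal |form ν A f F g G - form ν A f F (u n) (U n)| ≤
        ENNReal.ofReal |C| * (eLpNorm F 2 ν * eLpNorm (fun x => G x - U n x) 2 ν)
        + eLpNorm f 2 ν * eLpNorm (fun x => g x - u n x) 2 ν := by
      rw [← form_sub_right hA hC hf hF hg hG (hu n) (hU n), ← Real.norm_eq_abs, ofReal_norm]
      refine (enorm_integral_le_lintegral_enorm _).trans ?_
      have i1 : ∫⁻ x, ‖F x‖ₑ * ‖G x - U n x‖ₑ ∂ν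
          ≤ eLpNorm F 2 ν * eLpNorm (fun x => G x - U n x) 2 ν := by
        have := ENNReal.lintegral_mul_le_Lp_mul_Lq ν Real.HolderConjugate.two_two
          hF.1.enorm hGU.1.enorm
        rw [eLpNorm_eq_lintegral_rpow_enorm_toReal (by norm_num) (by norm_num),
          eLpNorm_eq_lintegral_rpow_enorm_toReal (by norm_num) (by norm_num)]
        simpa using this
      have i2 : ∫⁻ x, ‖f x‖ₑ * ‖g x - u n x‖ₑ ∂ν
          ≤ eLpNorm f 2 ν * eLpNorm (fun x => g x - u n x) 2 ν := by
        have := ENNReal.lintegral_mul_le_Lp_mul_Lq ν Real.HolderConjugate.two_two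
          hf.1.enorm hgu.1.enorm
        rw [eLpNorm_eq_lintegral_rpow_enorm_toReal (by norm_num) (by norm_num),
          eLpNorm_eq_lintegral_rpow_enorm_toReal (by norm_num) (by norm_num)]
        simpa using this
      calc ∫⁻ x, ‖A x * inner ℝ (F x) (G x - U n x) + f x * (g x - u n x)‖ₑ ∂ν
          ≤ ∫⁻ x, (ENNReal.ofReal |C| * (‖F x‖ₑ * ‖G x - U n x‖ₑ)
              + ‖f x‖ₑ * ‖g x - u n x‖ₑ) ∂ν := by
            refine lintegral_mono fun x => (enorm_add_le _ _).trans ?_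
            refine add_le_add ?_ (by rw [enorm_mul])
            rw [enorm_mul]
            refine mul_le_mul' ?_ ?_
            · rw [← ofReal_norm]
              exact ENNReal.ofReal_le_ofReal ((hC x).trans (le_abs_self _))
            · rw [← ofReal_norm, ← ofReal_norm, ← ofReal_norm,
                ← ENNReal.ofReal_mul (norm_nonneg _)]
              exact ENNReal.ofReal_le_ofReal (norm_inner_le_norm _ _)
        _ = ENNReal.ofReal |C| * ∫⁻ x, ‖F x‖ₑ * ‖G x - U n x‖ₑ ∂ν
              + ∫⁻ x, ‖f x‖ₑ * ‖g x - u n x‖ₑ ∂ν := by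
            rw [lintegral_add_right' (g := fun x => ‖f x‖ₑ * ‖g x - u n x‖ₑ) _
              (hf.1.enorm.mul hgu.1.enorm),
              lintegral_const_mul' _ _ ENNReal.ofReal_ne_top]
        _ ≤ _ := by gcongr
    have hfin : ENNReal.ofReal |C| * (eLpNorm F 2 ν * eLpNorm (fun x => G x - U n x) 2 ν)
        + eLpNorm f 2 ν * eLpNorm (fun x => g x - u n x) 2 ν ≠ ⊤ :=
      ENNReal.add_ne_top.2 ⟨ENNReal.mul_ne_top ENNReal.ofReal_ne_top
        (ENNReal.mul_ne_top hF.2.ne hGU.2.ne), ENNReal.mul_ne_top hf.2.ne hgu.2.ne⟩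
    have := ENNReal.toReal_mono hfin e
    rwa [ENNReal.toReal_ofReal (abs_nonneg _)] at this
  have hlim : Tendsto (fun n => ENNReal.ofReal |C| *
      (eLpNorm F 2 ν * eLpNorm (fun x => G x - U n x) 2 ν)
        + eLpNorm f 2 ν * eLpNorm (fun x => g x - u n x) 2 ν) atTop (𝓝 0) := by
    have t1 := ENNReal.Tendsto.const_mul h2 (Or.inr hF.2.ne)
    have t2 := ENNReal.Tendsto.const_mul t1 (Or.inr (ENNReal.ofReal_ne_top (r := |C|)))
    have t3 := ENNReal.Tendsto.const_mul h1 (Or.inr hf.2.ne)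
    have := t2.add t3
    simpa using this
  have hlim' := (ENNReal.tendsto_toReal ENNReal.zero_ne_top).comp hlim
  rw [ENNReal.toReal_zero] at hlim'
  rw [tendsto_iff_dist_tendsto_zero]
  refine squeeze_zero (fun _ => dist_nonneg) (fun n => ?_) hlim'
  rw [dist_comm]
  exact hb n

end Form

/-! ### Test functions. -/

section TestFunctions

variable {Ω : Set Plane} {φ φ' : Plane → ℝ}

theorem IsTest.continuous (h : IsTest Ω φ) : Continuous φ := h.1.continuous

theorem IsTest.differentiable (h : IsTest Ω φ) : Differentiable ℝ φ :=
  h.1.differentiable (by simp)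

theorem IsTest.hasCompactSupport_gradient (h : IsTest Ω φ) : HasCompactSupport (gradient φ) :=
  HasCompactSupport.intro h.2.1 fun _ hx => gradient_eq_zero_of_notMem_tsupport hx

theorem IsTest.memLp (h : IsTest Ω φ) : MemLp φ 2 (volume.restrict Ω) :=
  (h.continuous.memLp_of_hasCompactSupport h.2.1).restrict Ω

theorem IsTest.memLp_gradient (h : IsTest Ω φ) : MemLp (gradient φ) 2 (volume.restrict Ω) :=
  ((continuous_gradient h.1).memLp_of_hasCompactSupport h.hasCompactSupport_gradient).restrict Ω

theorem IsTest.eq_zero (h : IsTest Ω φ) {x : Plane} (hx : x ∉ Ω) : φ x = 0 :=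
  image_eq_zero_of_notMem_tsupport fun h' => hx (h.2.2 h')

theorem isTest_of_eq_zero (h : IsTest Ω φ) (hφ' : ContDiff ℝ ∞ φ')
    (h0 : ∀ x, φ x = 0 → φ' x = 0) : IsTest Ω φ' := by
  have hs : tsupport φ' ⊆ tsupport φ :=
    closure_mono fun x hx hx' => hx (h0 x hx')
  exact ⟨hφ', h.2.1.of_isClosed_subset (isClosed_tsupport _) hs, hs.trans h.2.2⟩

theorem IsTest.add (h : IsTest Ω φ) (h' : IsTest Ω φ') : IsTest Ω (fun x => φ x + φ' x) := by
  refine ⟨h.1.add h'.1, h.2.1.add h'.2.1, ?_⟩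
  exact (tsupport_add φ φ').trans (union_subset h.2.2 h'.2.2)

theorem IsTest.const_mul (h : IsTest Ω φ) (c : ℝ) : IsTest Ω (fun x => c * φ x) :=
  isTest_of_eq_zero h (contDiff_const.mul h.1) fun x hx => by simp [hx]

theorem IsTest.sub (h : IsTest Ω φ) (h' : IsTest Ω φ') : IsTest Ω (fun x => φ x - φ' x) := by
  have := h.add (h'.const_mul (-1))
  simpa [sub_eq_add_neg] using this

theorem isTest_zero : IsTest Ω (fun _ => 0) :=
  ⟨contDiff_const, HasCompactSupport.zero, by
    simp [tsupport]⟩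

end TestFunctions

/-! ### The space `H¹₀(Ω)`: closure properties, integration by parts, uniqueness of the gradient. -/

section H10

variable {Ω : Set Plane} {f g : Plane → ℝ} {F G : Plane → Plane}

theorem IsTest.memH10 {φ : Plane → ℝ} (h : IsTest Ω φ) : MemH10 Ω φ (gradient φ) :=
  ⟨h.memLp, h.memLp_gradient, fun _ => φ, fun _ => h, by simp, by simp⟩

theorem MemH10.of_forall_approx (hf : MemLp f 2 (volume.restrict Ω))
    (hF : MemLp F 2 (volume.restrict Ω))
    (h : ∀ ε : ENNReal, 0 < ε → ∃ φ, IsTest Ω φ ∧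
      eLpNorm (fun x => f x - φ x) 2 (volume.restrict Ω) < ε ∧
      eLpNorm (fun x => F x - gradient φ x) 2 (volume.restrict Ω) < ε) : MemH10 Ω f F := by
  have hpos : ∀ n : ℕ, (0 : ENNReal) < ((n : ENNReal) + 1)⁻¹ := fun n => by
    rw [ENNReal.inv_pos]
    exact ENNReal.add_ne_top.2 ⟨ENNReal.natCast_ne_top n, ENNReal.one_ne_top⟩
  choose φ h1 h2 h3 using fun n : ℕ => h _ (hpos n)
  have hlim : Tendsto (fun n : ℕ => ((n : ENNReal) + 1)⁻¹) atTop (𝓝 0) := by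
    have := (tendsto_add_atTop_iff_nat 1).2 ENNReal.tendsto_inv_nat_nhds_zero
    simpa using this
  exact ⟨hf, hF, φ, h1,
    tendsto_of_tendsto_of_tendsto_of_le_of_le tendsto_const_nhds hlim (fun _ => zero_le)
      fun n => (h2 n).le,
    tendsto_of_tendsto_of_tendsto_of_le_of_le tendsto_const_nhds hlim (fun _ => zero_le)
      fun n => (h3 n).le⟩

theorem MemH10.exists_approx (h : MemH10 Ω f F) {ε : ENNReal} (hε : 0 < ε) : ∃ φ, IsTest Ω φ ∧
      eLpNorm (fun x => f x - φ x) 2 (volume.restrict Ω) < ε ∧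
      eLpNorm (fun x => F x - gradient φ x) 2 (volume.restrict Ω) < ε := by
  obtain ⟨φ, h1, h2, h3⟩ := h.approx
  obtain ⟨n, hn, hn'⟩ := ((h2.eventually (gt_mem_nhds hε)).and
    (h3.eventually (gt_mem_nhds hε))).exists
  exact ⟨φ n, h1 n, hn, hn'⟩

theorem eLpNorm_sub_triangle {X E : Type*} [MeasurableSpace X] {ν : Measure X}
    [NormedAddCommGroup E] {u v w : X → E}
    (hu : MemLp u 2 ν) (hv : MemLp v 2 ν) (hw : MemLp w 2 ν) :
    eLpNorm (fun x => u x - w x) 2 ν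
      ≤ eLpNorm (fun x => u x - v x) 2 ν + eLpNorm (fun x => v x - w x) 2 ν := by
  have := eLpNorm_add_le (hu.sub hv).1 (hv.sub hw).1 (p := 2) (μ := ν) (by norm_num)
  refine le_trans (le_of_eq ?_) this
  congr 1
  ext x
  simp

/-- `H¹₀(Ω)` is closed under convergence in `H¹`. -/
theorem MemH10.of_tendsto {u : ℕ → Plane → ℝ} {U : ℕ → Plane → Plane}
    (hf : MemLp f 2 (volume.restrict Ω)) (hF : MemLp F 2 (volume.restrict Ω))
    (hu : ∀ n, MemH10 Ω (u n) (U n))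
    (h1 : Tendsto (fun n => eLpNorm (fun x => f x - u n x) 2 (volume.restrict Ω)) atTop (𝓝 0))
    (h2 : Tendsto (fun n => eLpNorm (fun x => F x - U n x) 2 (volume.restrict Ω)) atTop (𝓝 0)) :
    MemH10 Ω f F := by
  refine MemH10.of_forall_approx hf hF fun ε hε => ?_
  have hε2 : 0 < ε / 2 := ENNReal.half_pos hε.ne'
  obtain ⟨n, hn, hn'⟩ := ((h1.eventually (gt_mem_nhds hε2)).and
    (h2.eventually (gt_mem_nhds hε2))).exists
  obtain ⟨φ, hφ, h3, h4⟩ := (hu n).exists_approx hε2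
  refine ⟨φ, hφ, ?_, ?_⟩
  · refine (eLpNorm_sub_triangle hf (hu n).memLp hφ.memLp).trans_lt ?_
    rw [← ENNReal.add_halves ε]
    exact ENNReal.add_lt_add hn h3
  · refine (eLpNorm_sub_triangle hF (hu n).grad_memLp hφ.memLp_gradient).trans_lt ?_
    rw [← ENNReal.add_halves ε]
    exact ENNReal.add_lt_add hn' h4

theorem MemH10.congr (h : MemH10 Ω f F) (hf : f =ᵐ[volume.restrict Ω] g)
    (hF : F =ᵐ[volume.restrict Ω] G) : MemH10 Ω g G := by
  obtain ⟨φ, h1, h2, h3⟩ := h.approx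
  refine ⟨h.memLp.ae_eq hf, h.grad_memLp.ae_eq hF, φ, h1, h2.congr fun n => ?_,
    h3.congr fun n => ?_⟩
  · exact eLpNorm_congr_ae (by filter_upwards [hf] with x hx; rw [hx])
  · exact eLpNorm_congr_ae (by filter_upwards [hF] with x hx; rw [hx])

theorem MemH10.add (h : MemH10 Ω f F) (h' : MemH10 Ω g G) :
    MemH10 Ω (fun x => f x + g x) (fun x => F x + G x) := by
  refine MemH10.of_forall_approx (h.memLp.add h'.memLp) (h.grad_memLp.add h'.grad_memLp)
    fun ε hε => ?_
  have hε2 : 0 < ε / 2 := ENNReal.half_pos hε.ne'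
  obtain ⟨φ, hφ, h1, h2⟩ := h.exists_approx hε2
  obtain ⟨φ', hφ', h3, h4⟩ := h'.exists_approx hε2
  refine ⟨_, hφ.add hφ', ?_, ?_⟩
  · have := eLpNorm_add_le (h.memLp.sub hφ.memLp).1 (h'.memLp.sub hφ'.memLp).1 (p := 2)
      (by norm_num)
    refine lt_of_le_of_lt ?_ ((ENNReal.add_lt_add h1 h3).trans_le (ENNReal.add_halves ε).le)
    refine le_trans (le_of_eq ?_) this
    congr 1
    ext x
    simp only [Pi.add_apply, Pi.sub_apply]
    ring
  · have := eLpNorm_add_le (h.grad_memLp.sub hφ.memLp_gradient).1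
      (h'.grad_memLp.sub hφ'.memLp_gradient).1 (p := 2) (by norm_num)
    refine lt_of_le_of_lt ?_ ((ENNReal.add_lt_add h2 h4).trans_le (ENNReal.add_halves ε).le)
    refine le_trans (le_of_eq ?_) this
    congr 1
    ext1 x
    simp only [Pi.add_apply, Pi.sub_apply]
    rw [gradient_fun_add hφ.differentiable.differentiableAt hφ'.differentiable.differentiableAt]
    abel

theorem MemH10.const_mul (h : MemH10 Ω f F) (c : ℝ) :
    MemH10 Ω (fun x => c * f x) (fun x => c • F x) := by
  obtain ⟨φ, h1, h2, h3⟩ := h.approx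
  refine ⟨h.memLp.const_mul c, h.grad_memLp.const_smul c, _, fun n => (h1 n).const_mul c, ?_, ?_⟩
  · have := ENNReal.Tendsto.const_mul h2 (Or.inr (enorm_ne_top (x := c)))
    rw [mul_zero] at this
    refine this.congr fun n => ?_
    rw [← eLpNorm_const_smul]
    congr 1
    ext x
    simp only [Pi.smul_apply, smul_eq_mul]
    ring
  · have := ENNReal.Tendsto.const_mul h3 (Or.inr (enorm_ne_top (x := c)))
    rw [mul_zero] at this
    refine this.congr fun n => ?_
    rw [← eLpNorm_const_smul]
    congr 1
    ext1 x
    simp only [Pi.smul_apply]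
    rw [gradient_fun_const_mul c (h1 n).differentiable.differentiableAt, smul_sub]

theorem MemH10.sub (h : MemH10 Ω f F) (h' : MemH10 Ω g G) :
    MemH10 Ω (fun x => f x - g x) (fun x => F x - G x) := by
  have := h.add (h'.const_mul (-1))
  simpa [sub_eq_add_neg] using this

theorem MemH10.neg (h : MemH10 Ω f F) : MemH10 Ω (fun x => - f x) (fun x => - F x) := by
  simpa using h.const_mul (-1)

theorem memH10_zero : MemH10 Ω (fun _ => 0) (fun _ => 0) := by
  have := (isTest_zero (Ω := Ω)).memH10
  refine this.congr (ae_of_all _ fun _ => rfl) (ae_of_all _ fun x => ?_)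
  exact gradient_fun_const x 0

/-- A continuous linear identity for test functions extends to `H¹₀(Ω)`. -/
theorem MemH10.form_eq_of_forall_test {A : Plane → ℝ} {C : ℝ} (hA : Measurable A)
    (hC : ∀ x, |A x| ≤ C) {k l : Plane → ℝ} {K L : Plane → Plane}
    (hk : MemLp k 2 (volume.restrict Ω)) (hK : MemLp K 2 (volume.restrict Ω))
    (hl : MemLp l 2 (volume.restrict Ω)) (hL : MemLp L 2 (volume.restrict Ω))
    (heq : ∀ φ, IsTest Ω φ → form (volume.restrict Ω) A k K φ (gradient φ)
      = form (volume.restrict Ω) A l L φ (gradient φ)) (h : MemH10 Ω f F) :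
    form (volume.restrict Ω) A k K f F = form (volume.restrict Ω) A l L f F := by
  obtain ⟨φ, h1, h2, h3⟩ := h.approx
  have t1 := tendsto_form hA hC hk hK h.memLp h.grad_memLp (fun n => (h1 n).memLp)
    (fun n => (h1 n).memLp_gradient) h2 h3
  have t2 := tendsto_form hA hC hl hL h.memLp h.grad_memLp (fun n => (h1 n).memLp)
    (fun n => (h1 n).memLp_gradient) h2 h3
  refine tendsto_nhds_unique t1 (t2.congr fun n => (heq _ (h1 n)).symm)

theorem memLp_restrict_of_continuous {E : Type*} [NormedAddCommGroup E]
    (hΩ : Bornology.IsBounded Ω) {g : Plane → E} (hg : Continuous g) :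
    MemLp g 2 (volume.restrict Ω) := by
  have hc : IsCompact (closure Ω) := hΩ.isCompact_closure
  have hfin : IsFiniteMeasure (volume.restrict Ω) :=
    ⟨by rw [Measure.restrict_apply_univ]; exact hΩ.measure_lt_top⟩
  obtain ⟨C, hC⟩ := hc.exists_bound_of_continuousOn hg.continuousOn
  have hae : ∀ᵐ x ∂(volume.restrict Ω), x ∈ closure Ω :=
    ae_mono (Measure.restrict_mono subset_closure le_rfl) (ae_restrict_mem isClosed_closure.measurableSet)
  exact MemLp.of_bound hg.aestronglyMeasurable C (hae.mono hC)

/-- Integration by parts in direction `v` against a smooth function. -/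
theorem MemH10.integral_by_parts (hΩ : Bornology.IsBounded Ω) (h : MemH10 Ω f F)
    {g : Plane → ℝ} (hg : ContDiff ℝ ∞ g) (v : Plane) :
    form (volume.restrict Ω) (fun _ => 1) (fun x => fderiv ℝ g x v) (fun x => g x • v) f F = 0 := by
  have hg1 : Continuous fun x => fderiv ℝ g x v :=
    (hg.continuous_fderiv (by simp)).clm_apply continuous_const
  have m1 := memLp_restrict_of_continuous hΩ hg1
  have m2 : MemLp (fun x => g x • v) 2 (volume.restrict Ω) :=
    memLp_restrict_of_continuous hΩ (hg.continuous.smul continuous_const)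
  have z1 : MemLp (fun _ : Plane => (0 : ℝ)) 2 (volume.restrict Ω) := MemLp.zero
  have z2 : MemLp (fun _ : Plane => (0 : Plane)) 2 (volume.restrict Ω) := MemLp.zero
  have := h.form_eq_of_forall_test (A := fun _ => 1) (C := 1) measurable_const (by simp)
    m1 m2 z1 z2 (fun φ hφ => ?_)
  · rw [this]
    simp [form]
  · have h0 : form (volume.restrict Ω) (fun _ => 1) (fun _ => 0) (fun _ => (0 : Plane)) φ
      (gradient φ) = 0 := by simp [form]
    rw [h0]
    have hφc := hφ.continuous
    have hφg : Continuous fun x => fderiv ℝ φ x v :=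
      (hφ.1.continuous_fderiv (by simp)).clm_apply continuous_const
    have hcs : HasCompactSupport fun x => fderiv ℝ φ x v := hφ.2.1.fderiv_apply ℝ v
    have i1 : Integrable (fun x => fderiv ℝ g x v * φ x) volume :=
      (hg1.mul hφc).integrable_of_hasCompactSupport hφ.2.1.mul_left
    have i2 : Integrable (fun x => g x * fderiv ℝ φ x v) volume :=
      (hg.continuous.mul hφg).integrable_of_hasCompactSupport hcs.mul_left
    have i3 : Integrable (fun x => g x * φ x) volume :=
      (hg.continuous.mul hφc).integrable_of_hasCompactSupport hφ.2.1.mul_left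
    have key := integral_mul_fderiv_eq_neg_fderiv_mul_of_integrable i1 i2 i3
      (fun x _ => hg.differentiable (by simp) x) (fun x _ => hφ.differentiable x)
    have e : ∀ x, (1 : ℝ) * inner ℝ (g x • v) (gradient φ x) + fderiv ℝ g x v * φ x
        = g x * fderiv ℝ φ x v + fderiv ℝ g x v * φ x := by
      intro x
      rw [inner_smul_left, real_inner_comm, inner_gradient_left]
      simp
    unfold form
    simp only [e]
    -- The support of `φ` lies in `Ω`, so the integral extends to the plane and no boundary term
    -- appears, although `g` itself need not vanish at `∂Ω`.
    rw [setIntegral_eq_integral_of_forall_compl_eq_zero, integral_add i2 i1, key]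
    · ring
    · intro x hx
      have hx' : x ∉ tsupport φ := fun h' => hx (hφ.2.2 h')
      have h1 : φ x = 0 := hφ.eq_zero hx
      have h2 : fderiv ℝ φ x v = 0 := by
        rw [← inner_gradient_left, gradient_eq_zero_of_notMem_tsupport hx', inner_zero_left]
      rw [h1, h2]
      ring

/-- The weak gradient is unique. -/
theorem MemH10.grad_ae_eq (hΩo : IsOpen Ω) (hΩ : Bornology.IsBounded Ω) (h : MemH10 Ω f F)
    (h' : MemH10 Ω g G) (hfg : f =ᵐ[volume.restrict Ω] g) : F =ᵐ[volume.restrict Ω] G := by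
  have hfin : IsFiniteMeasure (volume.restrict Ω) :=
    ⟨by rw [Measure.restrict_apply_univ]; exact hΩ.measure_lt_top⟩
  have hd := h.sub h'
  have hcoord : ∀ v : Plane, ∀ᵐ x ∂(volume : Measure Plane), x ∈ Ω → inner ℝ v (F x - G x) = 0 := by
    intro v
    have hL : MemLp (fun x => inner ℝ v (F x - G x)) 2 (volume.restrict Ω) :=
      hd.grad_memLp.const_inner v
    refine hΩo.ae_eq_zero_of_integral_contDiff_smul_eq_zero ?_ ?_
    · exact IntegrableOn.locallyIntegrableOn (hL.integrable (by norm_num))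
    · intro η hη hηc hηs
      have key := hd.integral_by_parts hΩ hη v
      unfold form at key
      rw [← setIntegral_eq_integral_of_forall_compl_eq_zero (s := Ω), ← key]
      · refine integral_congr_ae ?_
        filter_upwards [hfg] with x hx
        rw [hx, inner_smul_left]
        simp
      · intro x hx
        rw [image_eq_zero_of_notMem_tsupport fun h'' => hx (hηs h''), zero_smul]
  have hb := fun i : Fin 2 => hcoord (EuclideanSpace.single i 1)
  rw [Filter.EventuallyEq, ae_restrict_iff' hΩo.measurableSet]
  filter_upwards [hb 0, hb 1] with x h0 h1 hx
  have e0 := h0 hx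
  have e1 := h1 hx
  rw [EuclideanSpace.inner_single_left] at e0 e1
  simp only [map_one, one_mul] at e0 e1
  ext i
  fin_cases i
  · simpa [sub_eq_zero] using e0
  · simpa [sub_eq_zero] using e1

end H10

/-! ### A smooth positive part. -/

section Ramp

/-- A smooth approximation of the positive part at scale `δ`. -/
def ramp (δ t : ℝ) : ℝ := t * Real.smoothTransition (t / δ)

variable {δ : ℝ}

theorem ramp_contDiff (δ : ℝ) : ContDiff ℝ ∞ (ramp δ) :=
  contDiff_id.mul (Real.smoothTransition.contDiff.comp (contDiff_id.div_const δ))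

theorem ramp_of_nonpos (hδ : 0 < δ) {t : ℝ} (ht : t ≤ 0) : ramp δ t = 0 := by
  rw [ramp, Real.smoothTransition.zero_of_nonpos (div_nonpos_of_nonpos_of_nonneg ht hδ.le),
    mul_zero]

theorem ramp_of_le (hδ : 0 < δ) {t : ℝ} (ht : δ ≤ t) : ramp δ t = t := by
  rw [ramp, Real.smoothTransition.one_of_one_le ((one_le_div hδ).2 ht), mul_one]

theorem ramp_nonneg (hδ : 0 < δ) (t : ℝ) : 0 ≤ ramp δ t := by
  rcases le_total t 0 with h | h
  · rw [ramp_of_nonpos hδ h]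
  · exact mul_nonneg h (Real.smoothTransition.nonneg _)

theorem ramp_le (hδ : 0 < δ) (t : ℝ) : ramp δ t ≤ max t 0 := by
  rcases le_total t 0 with h | h
  · rw [ramp_of_nonpos hδ h]; exact le_max_right _ _
  · exact (mul_le_of_le_one_right h (Real.smoothTransition.le_one _)).trans (le_max_left _ _)

/-- The strict inequality is what counts: `ramp δ b + δ` approaches `b⁺` strictly from above, so the
limit of the truncations at it is correct also where `f = b⁺`. -/
theorem lt_ramp_add (hδ : 0 < δ) (t : ℝ) : max t 0 < ramp δ t + δ := by
  rcases le_total δ t with h | h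
  · rw [ramp_of_le hδ h, max_eq_left (hδ.le.trans h)]; linarith
  · have := ramp_nonneg hδ t
    rcases lt_or_ge t δ with h' | h'
    · exact max_lt (by linarith) (by linarith)
    · rw [ramp_of_le hδ h', max_eq_left (hδ.le.trans h')]; linarith

theorem deriv_ramp_of_nonpos (hδ : 0 < δ) {t : ℝ} (ht : t ≤ 0) : deriv (ramp δ) t = 0 := by
  rcases ht.lt_or_eq with h | h
  · have : ramp δ =ᶠ[𝓝 t] fun _ => 0 := by
      filter_upwards [Iio_mem_nhds h] with s hs using ramp_of_nonpos hδ (le_of_lt hs)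
    rw [this.deriv_eq, deriv_const]
  · subst h
    have h1 : HasDerivAt (fun t : ℝ => Real.smoothTransition (t / δ))
        (deriv (fun t : ℝ => Real.smoothTransition (t / δ)) 0) 0 :=
      (((Real.smoothTransition.contDiff (n := 1)).comp
        (contDiff_id.div_const δ)).differentiable (by simp) 0).hasDerivAt
    have := ((hasDerivAt_id (0 : ℝ)).mul h1).deriv
    have e : (id * fun t : ℝ => Real.smoothTransition (t / δ)) = ramp δ := by
      ext t; simp [ramp]
    rw [e] at this
    simpa using this

theorem deriv_ramp_of_lt (hδ : 0 < δ) {t : ℝ} (ht : δ < t) : deriv (ramp δ) t = 1 := by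
  have : ramp δ =ᶠ[𝓝 t] id := by
    filter_upwards [Ioi_mem_nhds ht] with s hs using ramp_of_le hδ (le_of_lt hs)
  rw [this.deriv_eq, deriv_id]

theorem continuous_deriv_ramp (δ : ℝ) : Continuous (deriv (ramp δ)) :=
  (ramp_contDiff δ).continuous_deriv (by simp)

/-- The bound is uniform in `δ` by scaling: `ramp δ t = δ * ramp 1 (t / δ)`, so the derivatives at
all scales take the same values. -/
theorem exists_abs_deriv_ramp_le : ∃ C : ℝ, 1 ≤ C ∧ ∀ δ, 0 < δ → ∀ t, |deriv (ramp δ) t| ≤ C := by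
  obtain ⟨C, hC⟩ := (isCompact_Icc (a := (0 : ℝ)) (b := 1)).exists_bound_of_continuousOn
    (continuous_deriv_ramp 1).continuousOn
  have h1 : ∀ t, |deriv (ramp 1) t| ≤ max C 1 := by
    intro t
    rcases le_or_gt t 0 with h | h
    · rw [deriv_ramp_of_nonpos one_pos h, abs_zero]
      exact zero_le_one.trans (le_max_right _ _)
    · rcases le_or_gt t 1 with h' | h'
      · exact (hC t ⟨h.le, h'⟩).trans (le_max_left _ _)
      · rw [deriv_ramp_of_lt one_pos h', abs_one]
        exact le_max_right _ _
  refine ⟨max C 1, le_max_right _ _, fun δ hδ t => ?_⟩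
  have e : ramp δ = fun t => δ * ramp 1 (t / δ) := by
    ext t
    simp only [ramp, div_one]
    field_simp
  have hd : HasDerivAt (ramp δ) (deriv (ramp 1) (t / δ)) t := by
    have h2 : HasDerivAt (ramp 1) (deriv (ramp 1) (t / δ)) (t / δ) :=
      ((ramp_contDiff 1).differentiable (by simp) _).hasDerivAt
    have h3 := (h2.comp t ((hasDerivAt_id t).div_const δ)).const_mul δ
    rw [e]
    convert! h3 using 1
    field_simp
  rw [hd.deriv]
  exact h1 _

theorem abs_ramp_sub_le {C : ℝ} (hC : ∀ t, |deriv (ramp δ) t| ≤ C) (s t : ℝ) :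
    |ramp δ s - ramp δ t| ≤ C * |s - t| :=
  convex_univ.norm_image_sub_le_of_norm_deriv_le
    (fun x _ => (ramp_contDiff δ).differentiable (by simp) x) (fun x _ => hC x)
    (mem_univ t) (mem_univ s)

theorem tendsto_ramp {d : ℕ → ℝ} (hd : ∀ n, 0 < d n) (hlim : Tendsto d atTop (𝓝 0)) (t : ℝ) :
    Tendsto (fun n => ramp (d n) t) atTop (𝓝 (max t 0)) := by
  have h1 : Tendsto (fun n => max t 0 - d n) atTop (𝓝 (max t 0)) := by
    simpa using tendsto_const_nhds.sub hlim
  exact tendsto_of_tendsto_of_tendsto_of_le_of_le h1 tendsto_const_nhds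
    (fun n => by have := lt_ramp_add (hd n) t; linarith) (fun n => ramp_le (hd n) t)

/-- The limit at `t = 0` is `0`, because every ramp has vanishing derivative there; hence truncated
gradients carry the indicator of the strict superlevel set. -/
theorem tendsto_deriv_ramp {d : ℕ → ℝ} (hd : ∀ n, 0 < d n) (hlim : Tendsto d atTop (𝓝 0))
    (t : ℝ) : Tendsto (fun n => deriv (ramp (d n)) t) atTop (𝓝 (if 0 < t then 1 else 0)) := by
  split_ifs with h
  · refine tendsto_const_nhds.congr' ?_
    filter_upwards [hlim.eventually (gt_mem_nhds h)] with n hn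
    rw [deriv_ramp_of_lt (hd n) hn]
  · refine tendsto_const_nhds.congr fun n => ?_
    rw [deriv_ramp_of_nonpos (hd n) (not_lt.1 h)]

end Ramp

/-! ### Truncation in `H¹₀(Ω)`. -/

section Truncation

variable {Ω : Set Plane} {f : Plane → ℝ} {F : Plane → Plane}

theorem memLp_gradient_restrict (hΩ : Bornology.IsBounded Ω) {β : Plane → ℝ}
    (hβ : ContDiff ℝ ∞ β) : MemLp (gradient β) 2 (volume.restrict Ω) :=
  memLp_restrict_of_continuous hΩ (continuous_gradient hβ)

/-- `H¹₀(Ω)` is closed under dominated almost everywhere convergence of functions and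
gradients. -/
theorem MemH10.of_ae_tendsto {u : ℕ → Plane → ℝ} {U : ℕ → Plane → Plane} {g G : Plane → ℝ}
    (hu : ∀ n, MemH10 Ω (u n) (U n)) (hg : MemLp g 2 (volume.restrict Ω))
    (hG : MemLp G 2 (volume.restrict Ω))
    (h1 : ∀ n, ∀ᵐ x ∂(volume.restrict Ω), |u n x| ≤ g x)
    (h2 : ∀ n, ∀ᵐ x ∂(volume.restrict Ω), ‖U n x‖ ≤ G x)
    (h3 : ∀ᵐ x ∂(volume.restrict Ω), Tendsto (fun n => u n x) atTop (𝓝 (f x)))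
    (h4 : ∀ᵐ x ∂(volume.restrict Ω), Tendsto (fun n => U n x) atTop (𝓝 (F x))) :
    MemH10 Ω f F := by
  have key : ∀ {E : Type} [NormedAddCommGroup E] {w : ℕ → Plane → E} {W : Plane → E}
      {k : Plane → ℝ}, (∀ n, MemLp (w n) 2 (volume.restrict Ω)) → MemLp k 2 (volume.restrict Ω) →
      (∀ n, ∀ᵐ x ∂(volume.restrict Ω), ‖w n x‖ ≤ k x) →
      (∀ᵐ x ∂(volume.restrict Ω), Tendsto (fun n => w n x) atTop (𝓝 (W x))) →
      MemLp W 2 (volume.restrict Ω) ∧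
        Tendsto (fun n => eLpNorm (fun x => W x - w n x) 2 (volume.restrict Ω)) atTop (𝓝 0) := by
    intro E _ w W k hw hk hb hl
    have hall : ∀ᵐ x ∂(volume.restrict Ω), ∀ n, ‖w n x‖ ≤ k x := ae_all_iff.2 hb
    have hWm := aestronglyMeasurable_of_tendsto_ae atTop (fun n => (hw n).1) hl
    have hWb : ∀ᵐ x ∂(volume.restrict Ω), ‖W x‖ ≤ k x := by
      filter_upwards [hall, hl] with x hx hx'
      exact le_of_tendsto hx'.norm (Eventually.of_forall hx)
    have hW : MemLp W 2 (volume.restrict Ω) :=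
      hk.of_le hWm (hWb.mono fun x hx => hx.trans (le_abs_self _))
    refine ⟨hW, tendsto_eLpNorm_two_of_dominated (g := fun x => k x + k x)
      (fun n => (hW.sub (hw n)).1) (hk.add hk) (fun n => ?_) ?_⟩
    · filter_upwards [hWb, hb n] with x hx hx'
      exact (norm_sub_le _ _).trans (add_le_add hx hx')
    · filter_upwards [hl] with x hx
      simpa using (tendsto_const_nhds (x := W x)).sub hx
  obtain ⟨a1, a2⟩ := key (fun n => (hu n).memLp) hg h1 h3
  obtain ⟨b1, b2⟩ := key (fun n => (hu n).grad_memLp) hG h2 h4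
  exact MemH10.of_tendsto a1 b1 hu a2 b2

theorem IsTest.ramp_sub {φ β : Plane → ℝ} {δ : ℝ} (hδ : 0 < δ) (hφ : IsTest Ω φ)
    (hβ : ContDiff ℝ ∞ β) (hβ0 : ∀ x, 0 ≤ β x) : IsTest Ω (fun x => ramp δ (φ x - β x)) := by
  refine isTest_of_eq_zero hφ ((ramp_contDiff δ).comp (hφ.1.sub hβ)) fun x hx => ?_
  rw [hx]
  exact ramp_of_nonpos hδ (by linarith [hβ0 x])

theorem gradient_ramp_sub {φ β : Plane → ℝ} {δ : ℝ} (hφ : ContDiff ℝ ∞ φ)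
    (hβ : ContDiff ℝ ∞ β) (x : Plane) :
    gradient (fun y => ramp δ (φ y - β y)) x
      = deriv (ramp δ) (φ x - β x) • (gradient φ x - gradient β x) := by
  have h1 := hφ.differentiable (by simp) x
  have h2 := hβ.differentiable (by simp) x
  rw [gradient_comp_real (θ := ramp δ) (f := fun y => φ y - β y)
    ((ramp_contDiff δ).differentiable (by simp) _) (h1.sub h2), gradient_fun_sub h1 h2]

/-- Smooth truncation is continuous along almost everywhere convergent approximations by test
functions. -/
theorem tendsto_ramp_sub (hΩ : Bornology.IsBounded Ω) (hf : MemH10 Ω f F) {φ : ℕ → Plane → ℝ}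
    (hφ : ∀ n, IsTest Ω (φ n))
    (h1 : Tendsto (fun n => eLpNorm (fun x => f x - φ n x) 2 (volume.restrict Ω)) atTop (𝓝 0))
    (h2 : Tendsto (fun n => eLpNorm (fun x => F x - gradient (φ n) x) 2 (volume.restrict Ω))
      atTop (𝓝 0))
    (h3 : ∀ᵐ x ∂(volume.restrict Ω), Tendsto (fun n => φ n x) atTop (𝓝 (f x)))
    {β : Plane → ℝ} (hβ : ContDiff ℝ ∞ β) {δ : ℝ} (hδ : 0 < δ) :
    MemLp (fun x => ramp δ (f x - β x)) 2 (volume.restrict Ω) ∧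
    MemLp (fun x => deriv (ramp δ) (f x - β x) • (F x - gradient β x)) 2 (volume.restrict Ω) ∧
    Tendsto (fun n => eLpNorm (fun x => ramp δ (f x - β x) - ramp δ (φ n x - β x)) 2
      (volume.restrict Ω)) atTop (𝓝 0) ∧
    Tendsto (fun n => eLpNorm (fun x => deriv (ramp δ) (f x - β x) • (F x - gradient β x)
      - gradient (fun y => ramp δ (φ n y - β y)) x) 2 (volume.restrict Ω)) atTop (𝓝 0) := by
  obtain ⟨C, hC1, hC⟩ := exists_abs_deriv_ramp_le
  have hC := hC δ hδ
  have hβL : MemLp β 2 (volume.restrict Ω) := memLp_restrict_of_continuous hΩ hβ.continuous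
  have hβG := memLp_gradient_restrict hΩ hβ
  have hfβ := hf.memLp.sub hβL
  have hFβ := hf.grad_memLp.sub hβG
  have hdm : ∀ {u : Plane → ℝ}, MemLp u 2 (volume.restrict Ω) →
      AEStronglyMeasurable (fun x => deriv (ramp δ) (u x - β x)) (volume.restrict Ω) :=
    fun hu => (continuous_deriv_ramp δ).comp_aestronglyMeasurable (hu.1.sub hβL.1)
  have m1 : MemLp (fun x => ramp δ (f x - β x)) 2 (volume.restrict Ω) := by
    refine hfβ.of_le ((ramp_contDiff δ).continuous.comp_aestronglyMeasurable hfβ.1)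
      (ae_of_all _ fun x => ?_)
    rw [Real.norm_of_nonneg (ramp_nonneg hδ _)]
    exact (ramp_le hδ _).trans (max_le (le_abs_self _) (abs_nonneg _))
  have m2 := memLp_two_indicator_of_bound hFβ (hdm hf.memLp) (ae_of_all _ fun x => hC _)
  refine ⟨m1, m2, ?_, ?_⟩
  · have hub : Tendsto (fun n => ENNReal.ofReal C *
        eLpNorm (fun x => f x - φ n x) 2 (volume.restrict Ω)) atTop (𝓝 0) := by
      have := ENNReal.Tendsto.const_mul h1 (Or.inr (ENNReal.ofReal_ne_top (r := C)))
      rwa [mul_zero] at this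
    refine tendsto_of_tendsto_of_tendsto_of_le_of_le tendsto_const_nhds hub (fun _ => zero_le)
      fun n => ?_
    refine eLpNorm_le_mul_eLpNorm_of_ae_le_mul (ae_of_all _ fun x => ?_) 2
    have := abs_ramp_sub_le hC (f x - β x) (φ n x - β x)
    rw [Real.norm_eq_abs, Real.norm_eq_abs]
    refine this.trans (le_of_eq ?_)
    congr 2
    ring
  -- The gradient error splits in two. In `t1` the bounded factor `deriv (ramp δ)` multiplies an
  -- `L²`-small vector; in `t2` the difference of these factors tends to zero almost everywhere and
  -- multiplies a fixed `L²` field, so dominated convergence applies.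
  · have t1 : Tendsto (fun n => eLpNorm (fun x => deriv (ramp δ) (φ n x - β x) •
        (F x - gradient (φ n) x)) 2 (volume.restrict Ω)) atTop (𝓝 0) := by
      have hub : Tendsto (fun n => ENNReal.ofReal C *
          eLpNorm (fun x => F x - gradient (φ n) x) 2 (volume.restrict Ω)) atTop (𝓝 0) := by
        have := ENNReal.Tendsto.const_mul h2 (Or.inr (ENNReal.ofReal_ne_top (r := C)))
        rwa [mul_zero] at this
      refine tendsto_of_tendsto_of_tendsto_of_le_of_le tendsto_const_nhds hub
        (fun _ => zero_le) fun n => ?_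
      refine eLpNorm_le_mul_eLpNorm_of_ae_le_mul (ae_of_all _ fun x => ?_) 2
      rw [norm_smul]
      exact mul_le_mul_of_nonneg_right (hC _) (norm_nonneg _)
    have m3 : ∀ n, AEStronglyMeasurable (fun x => (deriv (ramp δ) (f x - β x)
        - deriv (ramp δ) (φ n x - β x)) • (F x - gradient β x)) (volume.restrict Ω) := fun n =>
      ((hdm hf.memLp).sub (hdm (hφ n).memLp)).smul hFβ.1
    have t2 : Tendsto (fun n => eLpNorm (fun x => (deriv (ramp δ) (f x - β x)
        - deriv (ramp δ) (φ n x - β x)) • (F x - gradient β x)) 2 (volume.restrict Ω))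
        atTop (𝓝 0) := by
      refine tendsto_eLpNorm_two_of_dominated (g := fun x => (C + C) * ‖F x - gradient β x‖)
        m3 (hFβ.norm.const_mul _) (fun n => ae_of_all _ fun x => ?_) ?_
      · rw [norm_smul]
        exact mul_le_mul_of_nonneg_right ((norm_sub_le _ _).trans (add_le_add (hC _) (hC _)))
          (norm_nonneg _)
      · filter_upwards [h3] with x hx
        have c1 : Tendsto (fun n => deriv (ramp δ) (φ n x - β x)) atTop
            (𝓝 (deriv (ramp δ) (f x - β x))) :=
          ((continuous_deriv_ramp δ).tendsto _).comp (hx.sub tendsto_const_nhds)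
        have c2 := (tendsto_const_nhds (x := deriv (ramp δ) (f x - β x))).sub c1
        rw [sub_self] at c2
        simpa using c2.smul_const (F x - gradient β x)
    have hub := t1.add t2
    rw [add_zero] at hub
    refine tendsto_of_tendsto_of_tendsto_of_le_of_le tendsto_const_nhds hub (fun _ => zero_le)
      fun n => ?_
    have m4 := memLp_two_indicator_of_bound (hf.grad_memLp.sub (hφ n).memLp_gradient)
      (hdm (hφ n).memLp) (ae_of_all _ fun x => hC _)
    refine le_trans (le_of_eq ?_) (eLpNorm_add_le m4.1 (m3 n) (by norm_num))
    congr 1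
    ext1 x
    simp only [Pi.add_apply]
    rw [gradient_ramp_sub (hφ n).1 hβ]
    module

theorem MemH10.exists_approx_ae (hf : MemH10 Ω f F) : ∃ φ : ℕ → Plane → ℝ,
    (∀ n, IsTest Ω (φ n)) ∧
    Tendsto (fun n => eLpNorm (fun x => f x - φ n x) 2 (volume.restrict Ω)) atTop (𝓝 0) ∧
    Tendsto (fun n => eLpNorm (fun x => F x - gradient (φ n) x) 2 (volume.restrict Ω))
      atTop (𝓝 0) ∧
    ∀ᵐ x ∂(volume.restrict Ω), Tendsto (fun n => φ n x) atTop (𝓝 (f x)) := by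
  obtain ⟨φ, h1, h2, h3⟩ := hf.approx
  obtain ⟨s, hs, hs'⟩ := exists_subseq_ae_tendsto (fun n => (h1 n).memLp.1) hf.memLp.1 h2
  exact ⟨fun n => φ (s n), fun n => h1 _, h2.comp hs.tendsto_atTop, h3.comp hs.tendsto_atTop, hs'⟩

theorem MemH10.ramp_sub (hΩ : Bornology.IsBounded Ω) (hf : MemH10 Ω f F)
    {β : Plane → ℝ} (hβ : ContDiff ℝ ∞ β) (hβ0 : ∀ x, 0 ≤ β x) {δ : ℝ} (hδ : 0 < δ) :
    MemH10 Ω (fun x => ramp δ (f x - β x))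
      (fun x => deriv (ramp δ) (f x - β x) • (F x - gradient β x)) := by
  obtain ⟨φ, h1, h2, h3, h4⟩ := hf.exists_approx_ae
  obtain ⟨a1, a2, a3, a4⟩ := tendsto_ramp_sub hΩ hf h1 h2 h3 h4 hβ hδ
  exact ⟨a1, a2, _, fun n => (h1 n).ramp_sub hδ hβ hβ0, a3, a4⟩

theorem tendsto_inv_succ : Tendsto (fun n : ℕ => 1 / ((n : ℝ) + 1)) atTop (𝓝 0) :=
  tendsto_one_div_add_atTop_nhds_zero_nat

/-- Truncation from below at a nonnegative smooth function. -/
theorem MemH10.posPart_sub_smooth (hΩ : Bornology.IsBounded Ω) (hf : MemH10 Ω f F)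
    {β : Plane → ℝ} (hβ : ContDiff ℝ ∞ β) (hβ0 : ∀ x, 0 ≤ β x) :
    MemH10 Ω (fun x => max (f x - β x) 0)
      (fun x => if β x < f x then F x - gradient β x else 0) := by
  obtain ⟨C, hC1, hC⟩ := exists_abs_deriv_ramp_le
  have hβL : MemLp β 2 (volume.restrict Ω) := memLp_restrict_of_continuous hΩ hβ.continuous
  have hβG := memLp_gradient_restrict hΩ hβ
  have hpos : ∀ n : ℕ, 0 < 1 / ((n : ℝ) + 1) := fun n => Nat.one_div_pos_of_nat
  refine MemH10.of_ae_tendsto (fun n => hf.ramp_sub hΩ hβ hβ0 (hpos n))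
    (hf.memLp.sub hβL).norm ((hf.grad_memLp.sub hβG).norm.const_mul C)
    (fun n => ae_of_all _ fun x => ?_) (fun n => ae_of_all _ fun x => ?_)
    (ae_of_all _ fun x => tendsto_ramp hpos tendsto_inv_succ _) (ae_of_all _ fun x => ?_)
  · rw [abs_of_nonneg (ramp_nonneg (hpos n) _)]
    exact (ramp_le (hpos n) _).trans (max_le (le_abs_self _) (abs_nonneg _))
  · rw [norm_smul]
    exact mul_le_mul_of_nonneg_right (hC _ (hpos n) _) (norm_nonneg _)
  · have := (tendsto_deriv_ramp hpos tendsto_inv_succ (f x - β x)).smul_const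
      (F x - gradient β x)
    convert this using 2
    by_cases h : β x < f x
    · simp [h]
    · simp [h]

/-- Truncation from below at the positive part of a smooth function. -/
theorem MemH10.posPart_sub_posPart (hΩ : Bornology.IsBounded Ω) (hf : MemH10 Ω f F)
    {b : Plane → ℝ} (hb : ContDiff ℝ ∞ b) :
    MemH10 Ω (fun x => max (f x - max (b x) 0) 0)
      (fun x => if max (b x) 0 < f x then F x - (if 0 < b x then gradient b x else 0) else 0) := by
  obtain ⟨C, hC1, hC⟩ := exists_abs_deriv_ramp_le
  have hbL : MemLp b 2 (volume.restrict Ω) := memLp_restrict_of_continuous hΩ hb.continuous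
  have hbG := memLp_gradient_restrict hΩ hb
  set d : ℕ → ℝ := fun n => 1 / ((n : ℝ) + 1) with hd
  have hpos : ∀ n : ℕ, 0 < d n := fun n => Nat.one_div_pos_of_nat
  have hlim : Tendsto d atTop (𝓝 0) := tendsto_inv_succ
  -- The positive part of `b` is approximated strictly from above by smooth functions. Where `f ≤
  -- b⁺` all truncations then have zero gradient, and where `b⁺ < f` the truncation is eventually
  -- active.
  have hβ : ∀ n, ContDiff ℝ ∞ fun x => ramp (d n) (b x) + d n := fun n =>
    ((ramp_contDiff (d n)).comp hb).add contDiff_const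
  have hβ0 : ∀ n x, max (b x) 0 < ramp (d n) (b x) + d n := fun n x => lt_ramp_add (hpos n) _
  have hg : ∀ n x, gradient (fun x => ramp (d n) (b x) + d n) x
      = deriv (ramp (d n)) (b x) • gradient b x := fun n x => by
    rw [gradient_fun_add_const, gradient_comp_real ((ramp_contDiff _).differentiable (by simp) _)
      (hb.differentiable (by simp) _)]
  have hβlim : ∀ x, Tendsto (fun n => ramp (d n) (b x) + d n) atTop (𝓝 (max (b x) 0)) :=
    fun x => by simpa using (tendsto_ramp hpos hlim (b x)).add hlim
  refine MemH10.of_ae_tendsto (g := fun x => ‖f x‖) (G := fun x => ‖F x‖ + C * ‖gradient b x‖)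
    (fun n => hf.posPart_sub_smooth hΩ (hβ n)
      fun x => (le_max_right _ _).trans (hβ0 n x).le)
    hf.memLp.norm (hf.grad_memLp.norm.add (hbG.norm.const_mul C))
    (fun n => ae_of_all _ fun x => ?_) (fun n => ae_of_all _ fun x => ?_)
    (ae_of_all _ fun x => ?_) (ae_of_all _ fun x => ?_)
  · rw [abs_of_nonneg (le_max_right _ _)]
    refine max_le ?_ (norm_nonneg _)
    have := (le_max_right (b x) 0).trans (hβ0 n x).le
    have h' := le_abs_self (f x)
    rw [Real.norm_eq_abs]
    linarith
  · simp only [hg]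
    split_ifs
    · refine (norm_sub_le _ _).trans (add_le_add le_rfl ?_)
      rw [norm_smul]
      exact mul_le_mul_of_nonneg_right (hC _ (hpos n) _) (norm_nonneg _)
    · rw [norm_zero]
      have : 0 ≤ C := zero_le_one.trans hC1
      positivity
  · exact ((tendsto_const_nhds.sub (hβlim x)).max tendsto_const_nhds)
  · simp only [hg]
    by_cases h : max (b x) 0 < f x
    · have t : Tendsto (fun n => F x - deriv (ramp (d n)) (b x) • gradient b x) atTop
          (𝓝 (F x - (if 0 < b x then gradient b x else 0))) := by
        have := (tendsto_deriv_ramp hpos hlim (b x)).smul_const (gradient b x)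
        have := (tendsto_const_nhds (x := F x)).sub this
        convert this using 3
        by_cases h0 : 0 < b x <;> simp [h0]
      rw [if_pos h]
      refine t.congr' ?_
      filter_upwards [(hβlim x).eventually (gt_mem_nhds h)] with n hn
      rw [if_pos hn]
    · rw [if_neg h]
      refine tendsto_const_nhds.congr fun n => ?_
      rw [if_neg]
      exact fun hn => h ((hβ0 n x).trans hn)

theorem MemH10.posPart_sub_const (hΩ : Bornology.IsBounded Ω) (hf : MemH10 Ω f F)
    {m : ℝ} (hm : 0 ≤ m) :
    MemH10 Ω (fun x => max (f x - m) 0) (fun x => if m < f x then F x else 0) := by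
  have := hf.posPart_sub_smooth hΩ (β := fun _ => m) contDiff_const fun _ => hm
  simpa only [gradient_fun_const, sub_zero] using this

theorem MemH10.posPart (hΩ : Bornology.IsBounded Ω) (hf : MemH10 Ω f F) :
    MemH10 Ω (fun x => max (f x) 0) (fun x => if 0 < f x then F x else 0) := by
  simpa using hf.posPart_sub_const hΩ le_rfl

/-- The gradient vanishes almost everywhere on the zero set. -/
theorem MemH10.grad_eq_zero_of_eq_zero (hΩo : IsOpen Ω) (hΩ : Bornology.IsBounded Ω)
    (hf : MemH10 Ω f F) : ∀ᵐ x ∂(volume.restrict Ω), f x = 0 → F x = 0 := by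
  -- Write `f = f⁺ - f⁻`. Both truncated gradients vanish on `{f = 0}`, and uniqueness of the weak
  -- gradient transfers this to `F`.
  have h1 := (hf.posPart hΩ).sub (hf.neg.posPart hΩ)
  have h2 := hf.grad_ae_eq hΩo hΩ h1 (ae_of_all _ fun x => by
    rcases le_total (f x) 0 with h | h
    · simp [h]
    · simp [h])
  filter_upwards [h2] with x hx h0
  rw [hx]
  simp [h0]

end Truncation

/-! ### Variational inequalities by Hilbert space projection. -/

section Projection

/-- The Hilbert space of square integrable pairs of a function and a vector field. -/
abbrev PairSpace (ν : Measure Plane) : Type := WithLp 2 (Lp ℝ 2 ν × Lp Plane 2 ν)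

variable {ν : Measure Plane} {A : Plane → ℝ} {f g : Plane → ℝ} {F G : Plane → Plane}

/-- The element `x` of the Hilbert space represents the pair `(f, √A F)`. -/
def Represents (ν : Measure Plane) (A : Plane → ℝ) (x : PairSpace ν) (f : Plane → ℝ)
    (F : Plane → Plane) : Prop :=
  (x.fst : Plane → ℝ) =ᵐ[ν] f ∧ (x.snd : Plane → Plane) =ᵐ[ν] fun y => Real.sqrt (A y) • F y

theorem memLp_sqrt_smul {C : ℝ} (hA : Measurable A) (hC : ∀ x, |A x| ≤ C) (hF : MemLp F 2 ν) :
    MemLp (fun y => Real.sqrt (A y) • F y) 2 ν := by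
  refine memLp_two_indicator_of_bound (C := Real.sqrt C) hF hA.sqrt.aestronglyMeasurable
    (ae_of_all _ fun x => ?_)
  rw [abs_of_nonneg (Real.sqrt_nonneg _)]
  exact Real.sqrt_le_sqrt ((le_abs_self _).trans (hC x))

theorem exists_represents {C : ℝ} (hA : Measurable A) (hC : ∀ x, |A x| ≤ C) (hf : MemLp f 2 ν)
    (hF : MemLp F 2 ν) : ∃ x, Represents ν A x f F :=
  ⟨WithLp.toLp 2 (hf.toLp f, (memLp_sqrt_smul hA hC hF).toLp _), hf.coeFn_toLp,
    (memLp_sqrt_smul hA hC hF).coeFn_toLp⟩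

variable {x y : PairSpace ν}

theorem Represents.sub (hx : Represents ν A x f F) (hy : Represents ν A y g G) :
    Represents ν A (x - y) (fun z => f z - g z) (fun z => F z - G z) := by
  refine ⟨(Lp.coeFn_sub x.fst y.fst).trans ?_, (Lp.coeFn_sub x.snd y.snd).trans ?_⟩
  · filter_upwards [hx.1, hy.1] with z h1 h2
    simp [h1, h2]
  · filter_upwards [hx.2, hy.2] with z h1 h2
    simp [h1, h2, smul_sub]

theorem Represents.add (hx : Represents ν A x f F) (hy : Represents ν A y g G) :
    Represents ν A (x + y) (fun z => f z + g z) (fun z => F z + G z) := by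
  refine ⟨(Lp.coeFn_add x.fst y.fst).trans ?_, (Lp.coeFn_add x.snd y.snd).trans ?_⟩
  · filter_upwards [hx.1, hy.1] with z h1 h2
    simp [h1, h2]
  · filter_upwards [hx.2, hy.2] with z h1 h2
    simp [h1, h2]

theorem Represents.smul (c : ℝ) (hx : Represents ν A x f F) :
    Represents ν A (c • x) (fun z => c * f z) (fun z => c • F z) := by
  refine ⟨(Lp.coeFn_smul c x.fst).trans ?_, (Lp.coeFn_smul c x.snd).trans ?_⟩
  · filter_upwards [hx.1] with z h1
    simp [h1]
  · filter_upwards [hx.2] with z h1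
    simp [h1, smul_comm c]

theorem Represents.inner_eq (hA : ∀ z, 0 ≤ A z) (hx : Represents ν A x f F)
    (hy : Represents ν A y g G) : inner ℝ x y = form ν A f F g G := by
  rw [WithLp.prod_inner_apply]
  change inner ℝ x.fst y.fst + inner ℝ x.snd y.snd = _
  rw [L2.inner_def, L2.inner_def, ← integral_add (L2.integrable_inner _ _)
    (L2.integrable_inner _ _)]
  refine integral_congr_ae ?_
  filter_upwards [hx.1, hx.2, hy.1, hy.2] with z h1 h2 h3 h4
  rw [h1, h2, h3, h4, inner_smul_left, inner_smul_right, ← mul_assoc]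
  simp only [conj_trivial, Real.mul_self_sqrt (hA z)]
  rw [add_comm]
  congr 1
  exact mul_comm _ _

variable {Ω : Set Plane}

/-- The elements of the Hilbert space that represent functions of `H¹₀(Ω)` with values in `J`. -/
def constraintSet (Ω : Set Plane) (A : Plane → ℝ) (J : Plane → Set ℝ) :
    Set (PairSpace (volume.restrict Ω)) :=
  {x | ∃ f F, MemH10 Ω f F ∧ (∀ᵐ z ∂(volume.restrict Ω), f z ∈ J z) ∧
    Represents (volume.restrict Ω) A x f F}

theorem convex_constraintSet {J : Plane → Set ℝ} (hJ : ∀ z, Convex ℝ (J z)) :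
    Convex ℝ (constraintSet Ω A J) := by
  rintro x ⟨f, F, h1, h2, h3⟩ y ⟨g, G, h4, h5, h6⟩ a b ha hb hab
  refine ⟨_, _, (h1.const_mul a).add (h4.const_mul b), ?_, (h3.smul a).add (h6.smul b)⟩
  filter_upwards [h2, h5] with z hz hz'
  exact hJ z hz hz' ha hb hab

/-- The lower bound on `A` allows division by `√A`, so convergence of `√A F` gives convergence of
`F`. The pointwise constraint passes to the limit along an almost everywhere convergent subsequence.
-/
theorem isClosed_constraintSet {c : ℝ} (hc : 0 < c) (hA : Measurable A)
    (hAc : ∀ x, c ≤ A x) {J : Plane → Set ℝ} (hJ : ∀ z, IsClosed (J z)) :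
    IsClosed (constraintSet Ω A J) := by
  refine IsSeqClosed.isClosed fun u x hu hx => ?_
  choose f F h1 h2 h3 using hu
  have hs : ∀ z, 0 < Real.sqrt (A z) := fun z => Real.sqrt_pos.2 (hc.trans_le (hAc z))
  have hinv : ∀ z, |(Real.sqrt (A z))⁻¹| ≤ (Real.sqrt c)⁻¹ := fun z => by
    rw [abs_of_pos (inv_pos.2 (hs z))]
    exact inv_anti₀ (Real.sqrt_pos.2 hc) (Real.sqrt_le_sqrt (hAc z))
  have m1 : MemLp (x.fst : Plane → ℝ) 2 (volume.restrict Ω) := Lp.memLp _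
  have m2 : MemLp (fun z => (Real.sqrt (A z))⁻¹ • (x.snd : Plane → Plane) z) 2
      (volume.restrict Ω) :=
    memLp_two_indicator_of_bound (Lp.memLp _) hA.sqrt.inv.aestronglyMeasurable (ae_of_all _ hinv)
  have t1 : Tendsto (fun n => (u n).fst) atTop (𝓝 x.fst) :=
    ((WithLp.continuous_fst 2 _ _).tendsto x).comp hx
  have t2 : Tendsto (fun n => (u n).snd) atTop (𝓝 x.snd) :=
    ((WithLp.continuous_snd 2 _ _).tendsto x).comp hx
  rw [Lp.tendsto_Lp_iff_tendsto_eLpNorm'] at t1 t2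
  have t1' : Tendsto (fun n => eLpNorm (fun z => (x.fst : Plane → ℝ) z - f n z) 2
      (volume.restrict Ω)) atTop (𝓝 0) := by
    refine t1.congr fun n => ?_
    rw [← eLpNorm_neg]
    refine eLpNorm_congr_ae ?_
    filter_upwards [(h3 n).1] with z hz
    simp [hz]
  have t2' : Tendsto (fun n => eLpNorm (fun z => (Real.sqrt (A z))⁻¹ • (x.snd : Plane → Plane) z
      - F n z) 2 (volume.restrict Ω)) atTop (𝓝 0) := by
    have hub := ENNReal.Tendsto.const_mul t2
      (Or.inr (ENNReal.ofReal_ne_top (r := (Real.sqrt c)⁻¹)))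
    rw [mul_zero] at hub
    refine tendsto_of_tendsto_of_tendsto_of_le_of_le tendsto_const_nhds hub (fun _ => zero_le)
      fun n => ?_
    refine eLpNorm_le_mul_eLpNorm_of_ae_le_mul ?_ 2
    filter_upwards [(h3 n).2] with z hz
    rw [Pi.sub_apply, hz, norm_sub_rev]
    have : F n z - (Real.sqrt (A z))⁻¹ • (x.snd : Plane → Plane) z
        = (Real.sqrt (A z))⁻¹ • (Real.sqrt (A z) • F n z - (x.snd : Plane → Plane) z) := by
      rw [smul_sub, inv_smul_smul₀ (hs z).ne']
    rw [this, norm_smul]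
    exact mul_le_mul_of_nonneg_right (hinv z) (norm_nonneg _)
  refine ⟨_, _, MemH10.of_tendsto m1 m2 h1 t1' t2', ?_, ae_eq_rfl, ae_of_all _ fun z => ?_⟩
  · obtain ⟨s, -, hs'⟩ := exists_subseq_ae_tendsto (fun n => (h1 n).memLp.1) m1.1 t1'
    filter_upwards [hs', ae_all_iff.2 h2] with z hz hz'
    exact (hJ z).mem_of_tendsto hz (Eventually.of_forall fun n => hz' _)
  · exact (smul_inv_smul₀ (hs z).ne' _).symm

/-- Existence of solutions of variational inequalities with right-hand side `k ∈ L²(Ω)` over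
closed convex pointwise constraints. -/
theorem exists_variational_solution {c C : ℝ} (hc : 0 < c) (hA : Measurable A)
    (hC : ∀ x, |A x| ≤ C) (hAc : ∀ x, c ≤ A x) {J : Plane → Set ℝ} (hJ : ∀ z, IsClosed (J z))
    (hJc : ∀ z, Convex ℝ (J z)) (hJ0 : ∀ z, 0 ∈ J z) {k : Plane → ℝ}
    (hk : MemLp k 2 (volume.restrict Ω)) :
    ∃ u U, MemH10 Ω u U ∧ (∀ᵐ z ∂(volume.restrict Ω), u z ∈ J z) ∧
      ∀ y Y, MemH10 Ω y Y → (∀ᵐ z ∂(volume.restrict Ω), y z ∈ J z) →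
        form (volume.restrict Ω) A (fun z => k z - u z) (fun z => 0 - U z) (fun z => y z - u z)
          (fun z => Y z - U z) ≤ 0 := by
  have hnn : ∀ z, 0 ≤ A z := fun z => hc.le.trans (hAc z)
  obtain ⟨p, hp⟩ := exists_represents hA hC hk (F := fun _ => 0) MemLp.zero
  have hne : (constraintSet Ω A J).Nonempty := by
    obtain ⟨o, ho⟩ := exists_represents (ν := volume.restrict Ω) hA hC (f := fun _ => 0)
      (F := fun _ => 0) MemLp.zero MemLp.zero
    exact ⟨o, _, _, memH10_zero, ae_of_all _ hJ0, ho⟩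
  have hconv := convex_constraintSet (Ω := Ω) (A := A) hJc
  -- The solution is the nearest point of the constraint set to the pair `(k, 0)`. Since the weight
  -- `√A` turns the inner product into the form, the obtuse-angle property of the projection is the
  -- variational inequality.
  obtain ⟨v, hv, hmin⟩ := exists_norm_eq_iInf_of_complete_convex hne
    (isClosed_constraintSet hc hA hAc hJ).isComplete hconv p
  rw [norm_eq_iInf_iff_real_inner_le_zero hconv hv] at hmin
  obtain ⟨u, U, h1, h2, h3⟩ := hv
  refine ⟨u, U, h1, h2, fun y Y hy hyJ => ?_⟩
  obtain ⟨q, hq⟩ := exists_represents hA hC hy.memLp hy.grad_memLp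
  rw [← (hp.sub h3).inner_eq hnn (hq.sub h3)]
  exact hmin q ⟨y, Y, hy, hyJ, hq⟩

/-- Existence of weak solutions with right-hand side `k ∈ L²(Ω)`. -/
theorem exists_weak_solution {c C : ℝ} (hc : 0 < c) (hA : Measurable A)
    (hC : ∀ x, |A x| ≤ C) (hAc : ∀ x, c ≤ A x) {k : Plane → ℝ}
    (hk : MemLp k 2 (volume.restrict Ω)) :
    ∃ u U, MemH10 Ω u U ∧ ∀ y Y, MemH10 Ω y Y →
      form (volume.restrict Ω) A u U y Y = form (volume.restrict Ω) A k (fun _ => 0) y Y := by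
  obtain ⟨u, U, h1, -, h2⟩ := exists_variational_solution hc hA hC hAc (J := fun _ => univ)
    (fun _ => isClosed_univ) (fun _ => convex_univ) (fun _ => mem_univ _) hk
  have z : MemLp (fun _ : Plane => (0 : Plane)) 2 (volume.restrict Ω) := MemLp.zero
  have key : ∀ y Y, MemH10 Ω y Y → form (volume.restrict Ω) A k (fun _ => 0) y Y
      ≤ form (volume.restrict Ω) A u U y Y := by
    intro y Y hy
    have := h2 _ _ (hy.add h1) (ae_of_all _ fun _ => mem_univ _)
    simp only [add_sub_cancel_right] at this
    rw [form_sub_left hA hC hk z h1.memLp h1.grad_memLp hy.memLp hy.grad_memLp] at this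
    linarith
  refine ⟨u, U, h1, fun y Y hy => le_antisymm ?_ (key y Y hy)⟩
  -- Without constraint both `y` and `-y` are admissible variations, so the inequality is an
  -- equality.
  have := key _ _ (hy.const_mul (-1))
  rw [form_smul_right, form_smul_right] at this
  linarith

end Projection

/-! ### Minimality of the Jordan decomposition. -/

section SignedMeasures

variable {s : SignedMeasure Plane} {α β : Measure Plane} [IsFiniteMeasure α] [IsFiniteMeasure β]

theorem posPart_add_eq (hs : s = α.toSignedMeasure - β.toSignedMeasure) :
    s.toJordanDecomposition.posPart + β = α + s.toJordanDecomposition.negPart := by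
  have h1 := s.toSignedMeasure_toJordanDecomposition
  rw [JordanDecomposition.toSignedMeasure] at h1
  have h2 := hs.symm.trans h1.symm
  rw [← Measure.toSignedMeasure_eq_toSignedMeasure_iff, Measure.toSignedMeasure_add,
    Measure.toSignedMeasure_add]
  rw [sub_eq_sub_iff_add_eq_add] at h2
  rw [← h2]

/-- Write `P`, `N` for the Jordan parts. On the half of the Hahn partition where `N` vanishes, `P +
β = α + N` gives `P ≤ α`, and `P` has no mass on the other half; symmetrically for `N`. Energy
competitors can thus be written as `α - β` without knowing their Jordan decomposition. -/
theorem posPart_le_and_negPart_le (hs : s = α.toSignedMeasure - β.toSignedMeasure) :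
    s.toJordanDecomposition.posPart ≤ α ∧ s.toJordanDecomposition.negPart ≤ β := by
  have key := posPart_add_eq hs
  obtain ⟨S, hS, h1, h2⟩ := s.toJordanDecomposition.mutuallySingular
  constructor
  · refine Measure.le_iff.2 fun E hE => ?_
    have e := congrArg (fun m : Measure Plane => m (E ∩ Sᶜ)) key
    simp only [Measure.add_apply] at e
    rw [measure_mono_null inter_subset_right h2, add_zero] at e
    calc s.toJordanDecomposition.posPart E
        ≤ s.toJordanDecomposition.posPart (E ∩ Sᶜ) + s.toJordanDecomposition.posPart S := by
          refine (measure_mono ?_).trans (measure_union_le _ _)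
          intro x hx
          by_cases h : x ∈ S
          · exact Or.inr h
          · exact Or.inl ⟨hx, h⟩
      _ ≤ α (E ∩ Sᶜ) := by rw [h1, add_zero, ← e]; exact le_self_add
      _ ≤ α E := measure_mono inter_subset_left
  · refine Measure.le_iff.2 fun E hE => ?_
    have e := congrArg (fun m : Measure Plane => m (E ∩ S)) key
    simp only [Measure.add_apply] at e
    rw [measure_mono_null inter_subset_right h1, zero_add] at e
    calc s.toJordanDecomposition.negPart E
        ≤ s.toJordanDecomposition.negPart (E ∩ S) + s.toJordanDecomposition.negPart Sᶜ := by
          refine (measure_mono ?_).trans (measure_union_le _ _)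
          intro x hx
          by_cases h : x ∈ S
          · exact Or.inl ⟨hx, h⟩
          · exact Or.inr h
      _ ≤ β (E ∩ S) := by rw [h2, add_zero, e]; exact le_add_self
      _ ≤ β E := measure_mono inter_subset_left

theorem totalVariation_le (hs : s = α.toSignedMeasure - β.toSignedMeasure) :
    s.totalVariation ≤ α + β := by
  obtain ⟨h1, h2⟩ := posPart_le_and_negPart_le hs
  exact add_le_add h1 h2

theorem signedIntegral_eq_sub (hs : s = α.toSignedMeasure - β.toSignedMeasure) {φ : Plane → ℝ}
    (hφ : Continuous φ) (hφc : HasCompactSupport φ) :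
    signedIntegral s φ = ∫ x, φ x ∂α - ∫ x, φ x ∂β := by
  have hi : ∀ m : Measure Plane, IsFiniteMeasure m → Integrable φ m := fun m _ =>
    hφ.integrable_of_hasCompactSupport hφc
  have key := congrArg (fun m : Measure Plane => ∫ x, φ x ∂m) (posPart_add_eq hs)
  rw [integral_add_measure (hi _ inferInstance) (hi _ inferInstance),
    integral_add_measure (hi _ inferInstance) (hi _ inferInstance)] at key
  rw [signedIntegral]
  linarith

end SignedMeasures

/-- The standing assumptions on the domain `Ω`, the subregion `S₁` and the constant `a`. -/
structure Geometry (Ω S₁ : Set Plane) (a : ℝ) : Prop where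
  isOpen : IsOpen Ω
  bounded : Bornology.IsBounded Ω
  smooth : HasSmoothBoundary Ω
  isOpen_sub : IsOpen S₁
  nonempty_sub : S₁.Nonempty
  smooth_sub : HasSmoothBoundary S₁
  closure_sub : closure S₁ ⊆ Ω
  pos : 0 < a

/-- The coefficient `1 / p`. -/
def coef (S₁ : Set Plane) (a : ℝ) (x : Plane) : ℝ := 1 / pinning S₁ a x

/-! ### Bounds for `p` and `1 / p`. -/

section Coefficient

variable {Ω S₁ : Set Plane} {a : ℝ}

theorem Geometry.isFiniteMeasure (hD : Geometry Ω S₁ a) :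
    IsFiniteMeasure (volume.restrict Ω : Measure Plane) :=
  ⟨by rw [Measure.restrict_apply_univ]; exact hD.bounded.measure_lt_top⟩

theorem measurable_pinning (hS : IsOpen S₁) : Measurable (pinning S₁ a) := by
  unfold pinning
  exact Measurable.ite hS.measurableSet measurable_const
    (Measurable.ite isClosed_closure.measurableSet measurable_const measurable_const)

theorem min_le_pinning (x : Plane) : min 1 a ≤ pinning S₁ a x := by
  unfold pinning
  split_ifs
  · exact min_le_left _ _
  · exact le_rfl
  · exact min_le_right _ _

theorem pinning_le_max (x : Plane) : pinning S₁ a x ≤ max 1 a := by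
  unfold pinning
  split_ifs
  · exact le_max_left _ _
  · exact min_le_max
  · exact le_max_right _ _

theorem pinning_pos (ha : 0 < a) (x : Plane) : 0 < pinning S₁ a x :=
  (lt_min one_pos ha).trans_le (min_le_pinning x)

theorem measurable_coef (hS : IsOpen S₁) : Measurable (coef S₁ a) :=
  measurable_const.div (measurable_pinning hS)

theorem coef_pos (ha : 0 < a) (x : Plane) : 0 < coef S₁ a x := one_div_pos.2 (pinning_pos ha x)

theorem le_coef (ha : 0 < a) (x : Plane) : 1 / max 1 a ≤ coef S₁ a x :=
  one_div_le_one_div_of_le (pinning_pos ha x) (pinning_le_max x)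

theorem abs_coef_le (ha : 0 < a) (x : Plane) : |coef S₁ a x| ≤ 1 / min 1 a := by
  rw [abs_of_pos (coef_pos ha x)]
  exact one_div_le_one_div_of_le (lt_min one_pos ha) (min_le_pinning x)

theorem one_div_max_pos (a : ℝ) : 0 < 1 / max 1 a :=
  one_div_pos.2 (lt_max_of_lt_left one_pos)

theorem integrable_pinning (hS : IsOpen S₁) (ha : 0 < a) (m : Measure Plane) [IsFiniteMeasure m] :
    Integrable (pinning S₁ a) m := by
  refine Integrable.of_bound (measurable_pinning hS).aestronglyMeasurable (max 1 a)
    (ae_of_all _ fun x => ?_)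
  rw [Real.norm_of_nonneg (pinning_pos ha x).le]
  exact pinning_le_max x

end Coefficient

/-! ### First variations of the energy. -/

section Variations

variable {Ω S₁ : Set Plane} {a : ℝ}

/-- Cauchy–Schwarz in the pair space, with `A` absorbed into `K`. It makes a finite measure with a
potential in `H¹` bounded in the `H¹` norm on test functions, so competitors belong to `H⁻¹(Ω)`
automatically. -/
theorem abs_form_le_norm {ν : Measure Plane} {A : Plane → ℝ} {C : ℝ} (hA : Measurable A)
    (hC : ∀ x, |A x| ≤ C) {k : Plane → ℝ} {K : Plane → Plane} (hk : MemLp k 2 ν)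
    (hK : MemLp K 2 ν) : ∃ M : ℝ, ∀ (f : Plane → ℝ) (F : Plane → Plane), MemLp f 2 ν →
      MemLp F 2 ν → |form ν A k K f F| ≤ M * Real.sqrt (∫ x, (‖F x‖ ^ 2 + f x ^ 2) ∂ν) := by
  have h1 : ∀ x : Plane, |(1 : ℝ)| ≤ 1 := fun _ => by simp
  obtain ⟨p, hp⟩ := exists_represents (A := fun _ => 1) measurable_const h1 hk
    (memLp_two_indicator_of_bound hK hA.aestronglyMeasurable (ae_of_all _ hC))
  refine ⟨‖p‖, fun f F hf hF => ?_⟩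
  obtain ⟨q, hq⟩ := exists_represents (A := fun _ => 1) measurable_const h1 hf hF
  have e1 : form ν A k K f F = inner ℝ p q := by
    rw [hp.inner_eq (fun _ => zero_le_one) hq]
    unfold form
    congr 1
    ext x
    rw [inner_smul_left]
    simp
  have e2 : ‖q‖ = Real.sqrt (∫ x, (‖F x‖ ^ 2 + f x ^ 2) ∂ν) := by
    rw [norm_eq_sqrt_real_inner, hq.inner_eq (fun _ => zero_le_one) hq]
    unfold form
    congr 2
    ext x
    rw [real_inner_self_eq_norm_sq]
    ring
  rw [e1, ← e2]
  exact abs_real_inner_le_norm _ _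

theorem IsPotential.memLp (hD : Geometry Ω S₁ a) {μ : SignedMeasure Plane} {h : Plane → ℝ}
    {G : Plane → Plane} (hp : IsPotential Ω S₁ a μ h G) : MemLp h 2 (volume.restrict Ω) := by
  have := hD.isFiniteMeasure
  have h1 := hp.boundary.memLp.add (memLp_const (1 : ℝ))
  refine h1.ae_eq (ae_of_all _ fun x => ?_)
  simp

theorem IsPotential.form_eq {μ : SignedMeasure Plane} {h : Plane → ℝ}
    {G : Plane → Plane} (hp : IsPotential Ω S₁ a μ h G) {φ : Plane → ℝ} (hφ : IsTest Ω φ) :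
    form (volume.restrict Ω) (coef S₁ a) h G φ (gradient φ) = signedIntegral μ φ :=
  hp.weak_eq φ hφ

theorem limitEnergy_eq {lam : ℝ} {μ : SignedMeasure Plane} {h : Plane → ℝ} {G : Plane → Plane} :
    limitEnergy Ω S₁ a lam μ h G = 1 / lam * ∫ x in Ω, pinning S₁ a x ∂μ.totalVariation
      + form (volume.restrict Ω) (coef S₁ a) (fun x => h x - 1) G (fun x => h x - 1) G := by
  unfold limitEnergy form coef
  congr 2
  ext x
  rw [real_inner_self_eq_norm_sq, sq_abs]
  ring

/-- Comparison of the energy of a minimizer with a competitor `α - β`. -/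
theorem energy_le_of_potential (hD : Geometry Ω S₁ a) {lam : ℝ} (hlam : 0 < lam)
    {μ : SignedMeasure Plane} {h : Plane → ℝ} {G : Plane → Plane}
    (hmin : ∀ (ν : SignedMeasure Plane) (k : Plane → ℝ) (K : Plane → Plane),
      MemMeasureDual Ω ν → IsPotential Ω S₁ a ν k K →
        limitEnergy Ω S₁ a lam μ h G ≤ limitEnergy Ω S₁ a lam ν k K)
    (α β : Measure Plane) [IsFiniteMeasure α] [IsFiniteMeasure β] (hα : α Ωᶜ = 0) (hβ : β Ωᶜ = 0)
    {k : Plane → ℝ} {K : Plane → Plane} (hkK : MemH10 Ω (fun x => k x - 1) K)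
    (hk : MemLp k 2 (volume.restrict Ω))
    (heq : ∀ φ, IsTest Ω φ → form (volume.restrict Ω) (coef S₁ a) k K φ (gradient φ)
      = ∫ x, φ x ∂α - ∫ x, φ x ∂β) :
    1 / lam * ∫ x in Ω, pinning S₁ a x ∂μ.totalVariation
      + form (volume.restrict Ω) (coef S₁ a) (fun x => h x - 1) G (fun x => h x - 1) G
    ≤ 1 / lam * (∫ x in Ω, pinning S₁ a x ∂α + ∫ x in Ω, pinning S₁ a x ∂β)
      + form (volume.restrict Ω) (coef S₁ a) (fun x => k x - 1) K (fun x => k x - 1) K := by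
  set ν : SignedMeasure Plane := α.toSignedMeasure - β.toSignedMeasure with hν
  have hsig : ∀ φ, IsTest Ω φ → signedIntegral ν φ
      = form (volume.restrict Ω) (coef S₁ a) k K φ (gradient φ) := fun φ hφ => by
    rw [heq φ hφ, signedIntegral_eq_sub hν hφ.continuous hφ.2.1]
  have hpot : IsPotential Ω S₁ a ν k K := ⟨hkK, fun φ hφ => (hsig φ hφ).symm⟩
  obtain ⟨M, hM⟩ := abs_form_le_norm (ν := volume.restrict Ω)
    (measurable_coef (a := a) hD.isOpen_sub) (abs_coef_le hD.pos) hk hkK.grad_memLp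
  have hdual : MemMeasureDual Ω ν := by
    refine ⟨le_antisymm ((totalVariation_le hν _).trans ?_) zero_le, M, fun φ hφ => ?_⟩
    · rw [Measure.add_apply, hα, hβ, add_zero]
    · rw [hsig φ hφ]
      exact hM φ _ hφ.memLp hφ.memLp_gradient
  have key := hmin ν k K hdual hpot
  rw [limitEnergy_eq, limitEnergy_eq] at key
  -- Since `p ≥ 0`, replacing `|α - β|` by `α + β` can only enlarge the right-hand side.
  refine key.trans (add_le_add ?_ le_rfl)
  refine mul_le_mul_of_nonneg_left ?_ (one_div_pos.2 hlam).le
  rw [← integral_add_measure (integrable_pinning hD.isOpen_sub hD.pos _)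
    (integrable_pinning hD.isOpen_sub hD.pos _), ← Measure.restrict_add]
  exact integral_mono_measure (Measure.restrict_mono le_rfl (totalVariation_le hν))
    (ae_of_all _ fun x => (pinning_pos hD.pos x).le) (integrable_pinning hD.isOpen_sub hD.pos _)

/-- The linear term dominates for small `t`. The range stops at `t < 1` because the variation
towards zero uses the measure `(1 - t) μ`, whose factor has to stay nonnegative. -/
theorem nonneg_of_forall_small {b c : ℝ} (h : ∀ t, 0 < t → t < 1 → 0 ≤ t * b + t ^ 2 * c) :
    0 ≤ b := by
  by_contra hb
  push Not at hb
  -- With this `t`, `t * |c|` is at most `-b / 2 - t`, so `b + t * c < 0` when `b < 0`.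
  set t := min (1 / 2) (-b / (2 * (|c| + 1))) with ht
  have hc : 0 < 2 * (|c| + 1) := by positivity
  have h0 : 0 < t := lt_min (by norm_num) (div_pos (by linarith) hc)
  have h1 : t < 1 := (min_le_left _ _).trans_lt (by norm_num)
  have h2 : t * (2 * (|c| + 1)) ≤ -b := (le_div_iff₀ hc).1 (min_le_right _ _)
  have h3 := h t h0 h1
  have h4 : 0 ≤ b + t * c := by
    have : t * b + t ^ 2 * c = t * (b + t * c) := by ring
    rw [this] at h3
    exact nonneg_of_mul_nonneg_right h3 h0
  have h5 : t * c ≤ t * |c| := mul_le_mul_of_nonneg_left (le_abs_self c) h0.le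
  nlinarith

theorem integrable_test (m : Measure Plane) [IsFiniteMeasure m] {φ : Plane → ℝ}
    (hφ : IsTest Ω φ) : Integrable φ m :=
  hφ.continuous.integrable_of_hasCompactSupport hφ.2.1

theorem form_add_smul_self {ν : Measure Plane} {A : Plane → ℝ} {C : ℝ} (hA : Measurable A)
    (hC : ∀ x, |A x| ≤ C) {f v : Plane → ℝ} {F V : Plane → Plane} (hf : MemLp f 2 ν)
    (hF : MemLp F 2 ν) (hv : MemLp v 2 ν) (hV : MemLp V 2 ν) (t : ℝ) :
    form ν A (fun x => f x + t * v x) (fun x => F x + t • V x) (fun x => f x + t * v x)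
      (fun x => F x + t • V x)
      = form ν A f F f F + 2 * t * form ν A v V f F + t ^ 2 * form ν A v V v V := by
  have htv := hv.const_mul t
  have htV : MemLp (fun x => t • V x) 2 ν := hV.const_smul t
  have hs : MemLp (fun x => f x + t * v x) 2 ν := hf.add htv
  have hS : MemLp (fun x => F x + t • V x) 2 ν := hF.add htV
  rw [form_add_right hA hC hs hS hf hF htv htV,
    form_add_left hA hC hf hF htv htV hf hF, form_add_left hA hC hf hF htv htV htv htV,
    form_smul_left, form_smul_left, form_smul_right, form_smul_right,
    form_comm (f := f) (g := v)]
  ring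

/-- First variation in the direction of Lebesgue measure on a measurable set. -/
theorem setIntegral_le_of_minimizer (hD : Geometry Ω S₁ a) {lam : ℝ} (hlam : 0 < lam)
    {μ : SignedMeasure Plane} {h : Plane → ℝ} {G : Plane → Plane}
    (hμ : MemMeasureDual Ω μ) (hp : IsPotential Ω S₁ a μ h G)
    (hmin : ∀ (ν : SignedMeasure Plane) (k : Plane → ℝ) (K : Plane → Plane),
      MemMeasureDual Ω ν → IsPotential Ω S₁ a ν k K →
        limitEnergy Ω S₁ a lam μ h G ≤ limitEnergy Ω S₁ a lam ν k K)
    {B : Set Plane} (hB : MeasurableSet B) (hBΩ : B ⊆ Ω) :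
    ∫ x in B, (1 - h x) ≤ ∫ x in B, pinning S₁ a x / (2 * lam) := by
  have hfin := hD.isFiniteMeasure
  have hfinB : IsFiniteMeasure (volume.restrict B : Measure Plane) :=
    isFiniteMeasure_of_le _ (Measure.restrict_mono hBΩ le_rfl)
  have hA := measurable_coef (a := a) hD.isOpen_sub
  have hC := abs_coef_le (S₁ := S₁) hD.pos
  have hkL : MemLp (B.indicator fun _ => (1 : ℝ)) 2 (volume.restrict Ω) :=
    (memLp_const (1 : ℝ)).indicator hB
  -- `v` is the response to the source `1_B` with zero boundary values, so `h + t v` is the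
  -- potential of `μ + t 1_B dx`.
  obtain ⟨v, V, hv, hveq⟩ := exists_weak_solution (one_div_max_pos a) hA hC (le_coef hD.pos) hkL
  have hform : ∀ y : Plane → ℝ, ∀ Y : Plane → Plane, form (volume.restrict Ω) (coef S₁ a)
      (B.indicator fun _ => (1 : ℝ)) (fun _ => 0) y Y = ∫ x in B, y x := by
    intro y Y
    unfold form
    rw [← integral_indicator hB, ← integral_indicator hD.isOpen.measurableSet]
    congr 1
    ext x
    by_cases hx : x ∈ B
    · simp [hx, hBΩ hx]
    · by_cases hx' : x ∈ Ω <;> simp [hx, hx']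
  have hb := hp.boundary
  have hμ0 : μ.toJordanDecomposition.posPart Ωᶜ = 0 ∧ μ.toJordanDecomposition.negPart Ωᶜ = 0 := by
    have := hμ.1
    rwa [SignedMeasure.totalVariation, Measure.add_apply, add_eq_zero] at this
  -- This is the derivative of the energy at `t = 0`: its quadratic part contributes twice the form
  -- of `v` against `h - 1`, which is `∫_B (h - 1)` by the equation for `v`.
  have key : 0 ≤ 1 / lam * (∫ x in B, pinning S₁ a x) + 2 * ∫ x in B, (h x - 1) := by
    refine nonneg_of_forall_small (c := form (volume.restrict Ω) (coef S₁ a) v V v V)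
      fun t ht ht1 => ?_
    set σ : Measure Plane := (Real.toNNReal t) • volume.restrict B with hσ
    have hσint : ∀ φ : Plane → ℝ, ∫ x, φ x ∂σ = t * ∫ x in B, φ x := fun φ => by
      rw [hσ, integral_smul_nnreal_measure, NNReal.smul_def, Real.coe_toNNReal t ht.le, smul_eq_mul]
    have hσ0 : σ Ωᶜ = 0 := by
      rw [hσ, Measure.smul_apply, Measure.restrict_apply hD.isOpen.measurableSet.compl]
      have : Ωᶜ ∩ B = ∅ := by
        ext x; simp only [mem_inter_iff, mem_compl_iff, mem_empty_iff_false, iff_false, not_and]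
        exact fun h1 h2 => h1 (hBΩ h2)
      simp [this]
    have := energy_le_of_potential hD hlam hmin (μ.toJordanDecomposition.posPart + σ)
      μ.toJordanDecomposition.negPart (by rw [Measure.add_apply, hμ0.1, hσ0, add_zero]) hμ0.2
      (k := fun x => h x + t * v x) (K := fun x => G x + t • V x)
      ((hb.add (hv.const_mul t)).congr (ae_of_all _ fun x => by simp only; ring) ae_eq_rfl)
      ((hp.memLp hD).add (hv.memLp.const_mul t)) (fun φ hφ => ?_)
    · have e1 : (fun x => h x + t * v x - 1) = fun x => (h x - 1) + t * v x := by
        ext x; ring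
      rw [e1, form_add_smul_self hA hC hb.memLp hb.grad_memLp hv.memLp hv.grad_memLp,
        hveq _ _ hb, hform] at this
      have e2 : ∫ x in Ω, pinning S₁ a x ∂μ.totalVariation
          = ∫ x in Ω, pinning S₁ a x ∂μ.toJordanDecomposition.posPart
            + ∫ x in Ω, pinning S₁ a x ∂μ.toJordanDecomposition.negPart := by
        rw [SignedMeasure.totalVariation, Measure.restrict_add, integral_add_measure
          (integrable_pinning hD.isOpen_sub hD.pos _) (integrable_pinning hD.isOpen_sub hD.pos _)]
      have e3 : ∫ x in Ω, pinning S₁ a x ∂(μ.toJordanDecomposition.posPart + σ)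
          = ∫ x in Ω, pinning S₁ a x ∂μ.toJordanDecomposition.posPart
            + t * ∫ x in B, pinning S₁ a x := by
        rw [Measure.restrict_add, integral_add_measure
          (integrable_pinning hD.isOpen_sub hD.pos _) (integrable_pinning hD.isOpen_sub hD.pos _),
          ← hσint]
        congr 2
        exact Measure.restrict_eq_self_of_ae_mem (mem_ae_iff.2 hσ0)
      rw [e2, e3] at this
      have e4 : ∀ q1 q2 q3 q4 q5 q6 : ℝ, 1 / lam * (q1 + q2) + q3 ≤
          1 / lam * (q1 + t * q4 + q2) + (q3 + 2 * t * q5 + q6) →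
          0 ≤ t * (1 / lam * q4 + 2 * q5) + q6 := by
        intro q1 q2 q3 q4 q5 q6 hq
        have e5 : 1 / lam * (q1 + t * q4 + q2) = 1 / lam * (q1 + q2) + t * (1 / lam * q4) := by
          ring
        rw [e5] at hq
        linarith
      exact e4 _ _ _ _ _ _ this
    · rw [form_add_left hA hC (hp.memLp hD) hb.grad_memLp (hv.memLp.const_mul t)
        (hv.const_mul t).grad_memLp hφ.memLp hφ.memLp_gradient, form_smul_left, hp.form_eq hφ,
        hveq _ _ hφ.memH10, hform, integral_add_measure (integrable_test _ hφ)
        (integrable_test _ hφ), hσint, signedIntegral]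
      ring
  have i1 : Integrable (fun x => h x - 1) (volume.restrict B) :=
    (hb.memLp.integrable (by norm_num)).mono_measure (Measure.restrict_mono hBΩ le_rfl)
  have e1 : ∫ x in B, (1 - h x) = - ∫ x in B, (h x - 1) := by
    rw [← integral_neg]
    congr 1
    ext x
    ring
  rw [e1, integral_div]
  have e2 : ∀ q1 q2 : ℝ, 0 ≤ 1 / lam * q1 + 2 * q2 → -q2 ≤ q1 / (2 * lam) := by
    intro q1 q2 hq
    have : q1 / (2 * lam) = (1 / lam * q1) / 2 := by field_simp
    rw [this]
    linarith
  exact e2 _ _ key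

/-- A minimizer satisfies the obstacle constraint. -/
theorem le_obstacle_of_minimizer (hD : Geometry Ω S₁ a) {lam : ℝ} (hlam : 0 < lam)
    {μ : SignedMeasure Plane} {h : Plane → ℝ} {G : Plane → Plane}
    (hμ : MemMeasureDual Ω μ) (hp : IsPotential Ω S₁ a μ h G)
    (hmin : ∀ (ν : SignedMeasure Plane) (k : Plane → ℝ) (K : Plane → Plane),
      MemMeasureDual Ω ν → IsPotential Ω S₁ a ν k K →
        limitEnergy Ω S₁ a lam μ h G ≤ limitEnergy Ω S₁ a lam ν k K) :
    ∀ᵐ x ∂(volume.restrict Ω), 1 - h x ≤ pinning S₁ a x / (2 * lam) := by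
  have hfin := hD.isFiniteMeasure
  refine ae_le_of_forall_setIntegral_le ((integrable_const _).sub ((hp.memLp hD).integrable
    (by norm_num))) ((integrable_pinning hD.isOpen_sub hD.pos _).div_const _) fun B hB _ => ?_
  rw [Measure.restrict_restrict hB]
  exact setIntegral_le_of_minimizer hD hlam hμ hp hmin (hB.inter hD.isOpen.measurableSet)
    inter_subset_right

/-- First variation in the direction `-μ`. -/
theorem obstacle_integral_le_of_minimizer (hD : Geometry Ω S₁ a) {lam : ℝ} (hlam : 0 < lam)
    {μ : SignedMeasure Plane} {h h₀ : Plane → ℝ} {G G₀ : Plane → Plane}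
    (hμ : MemMeasureDual Ω μ) (hp : IsPotential Ω S₁ a μ h G) (hp₀ : IsPotential Ω S₁ a 0 h₀ G₀)
    (hmin : ∀ (ν : SignedMeasure Plane) (k : Plane → ℝ) (K : Plane → Plane),
      MemMeasureDual Ω ν → IsPotential Ω S₁ a ν k K →
        limitEnergy Ω S₁ a lam μ h G ≤ limitEnergy Ω S₁ a lam ν k K) :
    ∫ x in Ω, pinning S₁ a x / (2 * lam) ∂μ.totalVariation
      ≤ - form (volume.restrict Ω) (coef S₁ a) h G (fun x => h x - 1) G := by
  have hA := measurable_coef (a := a) hD.isOpen_sub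
  have hC := abs_coef_le (S₁ := S₁) hD.pos
  have hb := hp.boundary
  have hμ0 : μ.toJordanDecomposition.posPart Ωᶜ = 0 ∧ μ.toJordanDecomposition.negPart Ωᶜ = 0 := by
    have := hμ.1
    rwa [SignedMeasure.totalVariation, Measure.add_apply, add_eq_zero] at this
  have hz : ∀ φ, IsTest Ω φ →
      form (volume.restrict Ω) (coef S₁ a) h₀ G₀ φ (gradient φ) = 0 := fun φ hφ => by
    rw [hp₀.form_eq hφ, signedIntegral, SignedMeasure.toJordanDecomposition_zero]
    simp
  have hv : MemH10 Ω (fun x => h x - h₀ x) (fun x => G x - G₀ x) :=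
    (hb.sub hp₀.boundary).congr (ae_of_all _ fun x => by simp only; ring) ae_eq_rfl
  have hz' : form (volume.restrict Ω) (coef S₁ a) h₀ G₀ (fun x => h x - 1) G = 0 := by
    rw [hb.form_eq_of_forall_test hA hC (hp₀.memLp hD) hp₀.boundary.grad_memLp
      (l := fun _ => 0) (L := fun _ => 0) MemLp.zero MemLp.zero fun φ hφ => by
        rw [hz φ hφ]; simp [form]]
    simp [form]
  -- The competitor is `(1 - t) μ`, with potential `h - t (h - h₀)`. The mass term is linear in `t`,
  -- and the `h₀` part of the cross term vanishes by the equation for `h₀` tested with `h - 1`.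
  have key : 0 ≤ -(1 / lam * ∫ x in Ω, pinning S₁ a x ∂μ.totalVariation)
      + -2 * form (volume.restrict Ω) (coef S₁ a) h G (fun x => h x - 1) G := by
    refine nonneg_of_forall_small (c := form (volume.restrict Ω) (coef S₁ a)
      (fun x => h x - h₀ x) (fun x => G x - G₀ x) (fun x => h x - h₀ x) (fun x => G x - G₀ x))
      fun t ht ht1 => ?_
    have ht' : 0 ≤ 1 - t := by linarith
    have hint : ∀ (m : Measure Plane) (φ : Plane → ℝ),
        ∫ x, φ x ∂(Real.toNNReal (1 - t) • m) = (1 - t) * ∫ x, φ x ∂m := fun m φ => by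
      rw [integral_smul_nnreal_measure, NNReal.smul_def, Real.coe_toNNReal _ ht', smul_eq_mul]
    have := energy_le_of_potential hD hlam hmin
      (Real.toNNReal (1 - t) • μ.toJordanDecomposition.posPart)
      (Real.toNNReal (1 - t) • μ.toJordanDecomposition.negPart)
      (by rw [Measure.smul_apply, hμ0.1, smul_zero]) (by rw [Measure.smul_apply, hμ0.2, smul_zero])
      (k := fun x => h x + (-t) * (h x - h₀ x)) (K := fun x => G x + (-t) • (G x - G₀ x))
      ((hb.add (hv.const_mul (-t))).congr (ae_of_all _ fun x => by simp only; ring) ae_eq_rfl)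
      ((hp.memLp hD).add (hv.memLp.const_mul (-t))) (fun φ hφ => ?_)
    · have e1 : (fun x => h x + (-t) * (h x - h₀ x) - 1)
          = fun x => (h x - 1) + (-t) * (h x - h₀ x) := by
        ext x; ring
      rw [e1, form_add_smul_self hA hC hb.memLp hb.grad_memLp hv.memLp hv.grad_memLp,
        form_sub_left hA hC (hp.memLp hD) hb.grad_memLp (hp₀.memLp hD) hp₀.boundary.grad_memLp
          hb.memLp hb.grad_memLp, hz', Measure.restrict_smul, Measure.restrict_smul, hint, hint]
        at this
      have e2 : ∫ x in Ω, pinning S₁ a x ∂μ.totalVariation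
          = ∫ x in Ω, pinning S₁ a x ∂μ.toJordanDecomposition.posPart
            + ∫ x in Ω, pinning S₁ a x ∂μ.toJordanDecomposition.negPart := by
        rw [SignedMeasure.totalVariation, Measure.restrict_add, integral_add_measure
          (integrable_pinning hD.isOpen_sub hD.pos _) (integrable_pinning hD.isOpen_sub hD.pos _)]
      rw [e2] at this ⊢
      have e4 : ∀ q1 q2 q3 q5 q6 : ℝ, 1 / lam * (q1 + q2) + q3 ≤
          1 / lam * ((1 - t) * q1 + (1 - t) * q2) + (q3 + 2 * (-t) * (q5 - 0) + (-t) ^ 2 * q6) →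
          0 ≤ t * (-(1 / lam * (q1 + q2)) + -2 * q5) + t ^ 2 * q6 := by
        intro q1 q2 q3 q5 q6 hq
        have e5 : 1 / lam * ((1 - t) * q1 + (1 - t) * q2)
            = 1 / lam * (q1 + q2) - t * (1 / lam * (q1 + q2)) := by
          ring
        rw [e5] at hq
        nlinarith
      exact e4 _ _ _ _ _ this
    · rw [form_add_left hA hC (hp.memLp hD) hb.grad_memLp (hv.memLp.const_mul (-t))
        (hv.const_mul (-t)).grad_memLp hφ.memLp hφ.memLp_gradient, form_smul_left,
        form_sub_left hA hC (hp.memLp hD) hb.grad_memLp (hp₀.memLp hD) hp₀.boundary.grad_memLp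
          hφ.memLp hφ.memLp_gradient, hz φ hφ, hp.form_eq hφ, hint, hint, signedIntegral]
      ring
  rw [integral_div]
  have e2 : ∀ q1 q2 : ℝ, 0 ≤ -(1 / lam * q1) + -2 * q2 → q1 / (2 * lam) ≤ -q2 := by
    intro q1 q2 hq
    have : q1 / (2 * lam) = (1 / lam * q1) / 2 := by field_simp
    rw [this]
    linarith
  exact e2 _ _ key

end Variations

/-! ### Partial derivatives and the Laplacian. -/

section Calculus

/-- The standard basis vector. -/
def stdVec (i : Fin 2) : Plane := EuclideanSpace.single i 1

/-- The partial derivative. -/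
def pd (i : Fin 2) (g : Plane → ℝ) (x : Plane) : ℝ := fderiv ℝ g x (stdVec i)

/-- The Laplacian. -/
def lap (g : Plane → ℝ) (x : Plane) : ℝ := ∑ i, pd i (pd i g) x

variable {f g : Plane → ℝ} {x : Plane} {i : Fin 2}

theorem contDiff_pd (hg : ContDiff ℝ ∞ g) : ContDiff ℝ ∞ (pd i g) :=
  (hg.fderiv_right (m := ∞) (by simp)).clm_apply contDiff_const

theorem contDiff_lap (hg : ContDiff ℝ ∞ g) : ContDiff ℝ ∞ (lap g) :=
  ContDiff.sum fun _ _ => contDiff_pd (contDiff_pd hg)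

theorem pd_eq_inner : pd i g x = inner ℝ (gradient g x) (stdVec i) := by
  rw [inner_gradient_left, pd]

theorem gradient_apply : gradient g x i = pd i g x := by
  rw [pd_eq_inner, stdVec, EuclideanSpace.inner_single_right]
  simp

theorem sum_pd_smul : ∑ i, pd i g x • stdVec i = gradient g x := by
  ext j
  rw [gradient_apply]
  fin_cases j <;> simp [stdVec]

theorem inner_gradient_eq_sum :
    inner ℝ (gradient f x) (gradient g x) = ∑ i, pd i f x * pd i g x := by
  rw [PiLp.inner_apply]
  refine Finset.sum_congr rfl fun i _ => ?_
  rw [gradient_apply, gradient_apply]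
  exact mul_comm _ _

theorem pd_add (hf : ContDiff ℝ ∞ f) (hg : ContDiff ℝ ∞ g) :
    pd i (fun y => f y + g y) = fun y => pd i f y + pd i g y := by
  ext y
  simp only [pd, fderiv_fun_add (hf.differentiable (by simp) y) (hg.differentiable (by simp) y),
    add_apply]

theorem pd_mul (hf : ContDiff ℝ ∞ f) (hg : ContDiff ℝ ∞ g) :
    pd i (fun y => f y * g y) = fun y => f y * pd i g y + g y * pd i f y := by
  ext y
  simp only [pd, fderiv_fun_mul (hf.differentiable (by simp) y) (hg.differentiable (by simp) y),
    add_apply, smul_apply, smul_eq_mul]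

theorem pd_const (c : ℝ) : pd i (fun _ => c) = fun _ => 0 := by
  ext y
  simp [pd]

theorem lap_add (hf : ContDiff ℝ ∞ f) (hg : ContDiff ℝ ∞ g) :
    lap (fun y => f y + g y) x = lap f x + lap g x := by
  simp only [lap, pd_add hf hg, pd_add (contDiff_pd hf) (contDiff_pd hg), Finset.sum_add_distrib]

theorem lap_mul (hf : ContDiff ℝ ∞ f) (hg : ContDiff ℝ ∞ g) :
    lap (fun y => f y * g y) x
      = f x * lap g x + 2 * inner ℝ (gradient f x) (gradient g x) + g x * lap f x := by
  simp only [lap, pd_mul hf hg, pd_add (hf.mul (contDiff_pd hg)) (hg.mul (contDiff_pd hf)),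
    pd_mul hf (contDiff_pd hg), pd_mul hg (contDiff_pd hf), inner_gradient_eq_sum]
  simp only [Fin.sum_univ_two]
  ring

theorem lap_const (c : ℝ) : lap (fun _ => c) x = 0 := by
  simp [lap, pd_const]

theorem lap_const_mul (c : ℝ) (hf : ContDiff ℝ ∞ f) :
    lap (fun y => c * f y) x = c * lap f x := by
  rw [lap_mul contDiff_const hf, lap_const, gradient_fun_const]
  simp

theorem Filter.EventuallyEq.lap_eq (h : f =ᶠ[𝓝 x] g) : lap f x = lap g x := by
  have h1 : ∀ i, pd i f =ᶠ[𝓝 x] pd i g := fun i => by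
    filter_upwards [h.fderiv (𝕜 := ℝ)] with y hy
    rw [pd, pd, hy]
  unfold lap
  refine Finset.sum_congr rfl fun i _ => ?_
  rw [pd, pd, (h1 i).fderiv_eq]

theorem contDiff_normSq (x₀ : Plane) : ContDiff ℝ ∞ fun y : Plane => ‖y - x₀‖ ^ 2 :=
  (contDiff_id.sub contDiff_const).norm_sq ℝ

theorem gradient_normSq (x₀ : Plane) : gradient (fun y : Plane => ‖y - x₀‖ ^ 2) x
    = (2 : ℝ) • (x - x₀) := by
  refine HasGradientAt.gradient ?_
  rw [hasGradientAt_iff_hasFDerivAt]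
  have h := ((hasFDerivAt_id x).sub_const x₀).norm_sq
  have e : InnerProductSpace.toDual ℝ Plane ((2 : ℝ) • (x - x₀))
      = 2 • (innerSL ℝ (id x - x₀)).comp (ContinuousLinearMap.id ℝ Plane) := by
    ext v
    simp [two_smul]
  rw [e]
  exact h

theorem pd_normSq (x₀ : Plane) (i : Fin 2) :
    pd i (fun y : Plane => ‖y - x₀‖ ^ 2) = fun y => 2 * (y i - x₀ i) := by
  ext y
  rw [← gradient_apply, gradient_normSq]
  simp

theorem lap_normSq (x₀ : Plane) : lap (fun y : Plane => ‖y - x₀‖ ^ 2) x = 4 := by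
  have h : ∀ i : Fin 2, pd i (fun y : Plane => 2 * (y i - x₀ i)) x = 2 := by
    intro i
    have hd : HasFDerivAt (fun y : Plane => 2 * (y i - x₀ i))
        ((2 : ℝ) • (EuclideanSpace.proj i : Plane →L[ℝ] ℝ)) x :=
      (((EuclideanSpace.proj i : Plane →L[ℝ] ℝ).hasFDerivAt).sub_const (x₀ i)).const_mul 2
    rw [pd, hd.fderiv]
    simp [stdVec]
  simp only [lap, pd_normSq, h]
  norm_num

end Calculus

/-! ### Integration by parts against smooth vector fields. -/

section Divergence

variable {Ω : Set Plane} {f : Plane → ℝ} {F : Plane → Plane}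

/-- Integration by parts against a smooth vector field. -/
theorem MemH10.integral_by_parts_div (hΩ : Bornology.IsBounded Ω) (h : MemH10 Ω f F)
    {g : Fin 2 → Plane → ℝ} (hg : ∀ i, ContDiff ℝ ∞ (g i)) :
    form (volume.restrict Ω) (fun _ => 1) (fun x => ∑ i, pd i (g i) x)
      (fun x => ∑ i, g i x • stdVec i) f F = 0 := by
  have m1 : ∀ i, MemLp (pd i (g i)) 2 (volume.restrict Ω) := fun i =>
    memLp_restrict_of_continuous hΩ (contDiff_pd (hg i)).continuous
  have m2 : ∀ i, MemLp (fun x => g i x • stdVec i) 2 (volume.restrict Ω) := fun i =>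
    memLp_restrict_of_continuous hΩ ((hg i).continuous.smul continuous_const)
  have key := fun i => h.integral_by_parts hΩ (hg i) (stdVec i)
  simp only [Fin.sum_univ_two]
  rw [form_add_left (C := 1) measurable_const (by simp) (m1 0) (m2 0) (m1 1) (m2 1) h.memLp
    h.grad_memLp]
  have k0 := key 0
  have k1 := key 1
  unfold pd
  rw [k0, k1, add_zero]

theorem MemH10.integral_by_parts_gradient (hΩ : Bornology.IsBounded Ω) (h : MemH10 Ω f F)
    {b : Plane → ℝ} (hb : ContDiff ℝ ∞ b) :
    form (volume.restrict Ω) (fun _ => 1) (lap b) (gradient b) f F = 0 := by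
  have := h.integral_by_parts_div hΩ (g := fun i => pd i b) fun i => contDiff_pd hb
  simp only [sum_pd_smul] at this
  exact this

/-- The field is `θ ∇b`. With `θ` a smoothed indicator of one side of a hypersurface, the term `∇θ ·
∇b` carries the flux through it. -/
theorem MemH10.integral_by_parts_weighted (hΩ : Bornology.IsBounded Ω) (h : MemH10 Ω f F)
    {b θ : Plane → ℝ} (hb : ContDiff ℝ ∞ b) (hθ : ContDiff ℝ ∞ θ) :
    form (volume.restrict Ω) (fun _ => 1)
      (fun x => θ x * lap b x + inner ℝ (gradient θ x) (gradient b x))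
      (fun x => θ x • gradient b x) f F = 0 := by
  have := h.integral_by_parts_div hΩ (g := fun i x => θ x * pd i b x) fun i =>
    hθ.mul (contDiff_pd hb)
  convert this using 2
  · ext x
    simp only [pd_mul hθ (contDiff_pd hb), Finset.sum_add_distrib, lap, Finset.mul_sum,
      inner_gradient_eq_sum]
    congr 1
    exact Finset.sum_congr rfl fun i _ => mul_comm _ _
  · ext1 x
    rw [← sum_pd_smul, Finset.smul_sum]
    exact Finset.sum_congr rfl fun i _ => smul_smul _ _ _

end Divergence

/-! ### Upper barriers at a smooth hypersurface. -/

section UpperBarrier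

variable {Ω : Set Plane} {A : Plane → ℝ} {f : Plane → ℝ} {F : Plane → Plane}

/-- A smooth supersolution near a point of the hypersurface `σ = 0`. -/
theorem exists_barrier {σ : Plane → ℝ} (hσ : ContDiff ℝ ∞ σ) {x₀ : Plane} (h0 : σ x₀ = 0)
    (hd : fderiv ℝ σ x₀ ≠ 0) {M L : ℝ} (hM : 0 ≤ M) (hL : 0 < L) {R : ℝ} (hR : 0 < R) :
    ∃ b : Plane → ℝ, ∃ r, 0 < r ∧ r ≤ R ∧ ContDiff ℝ ∞ b ∧ b x₀ = 0 ∧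
      (∀ y ∈ Metric.ball x₀ r, 0 < σ y → 0 < b y ∧ lap b y ≤ -L) ∧
      (∀ y ∈ Metric.ball x₀ R, y ∉ Metric.ball x₀ r → 0 < σ y → M ≤ b y) ∧
      ∀ y, y ∉ Metric.ball x₀ R → M ≤ b y := by
  have hg0 : gradient σ x₀ ≠ 0 := by
    intro h
    apply hd
    rw [← toDual_gradient, h, map_zero]
  set g2 : ℝ := ‖gradient σ x₀‖ ^ 2 / 2 with hg2
  have hg2pos : 0 < g2 := by
    have := norm_pos_iff.2 hg0
    positivity
  set Dl : ℝ := |lap σ x₀| + 1 with hDl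
  have hDlpos : 0 < Dl := by positivity
  -- `N` makes `σ - N σ²` strictly superharmonic on the positive side near `x₀`: its Laplacian is
  -- `(1 - 2Nσ) Δσ - 2N |∇σ|² ≤ Dl - (2 Dl + 1) ≤ -1`. The restriction `|σ| < 1/(2N)` keeps the
  -- function positive where `σ > 0` and the factor `1 - 2Nσ` nonnegative.
  set N : ℝ := (2 * Dl + 1) / (2 * g2) with hN
  have hNpos : 0 < N := by positivity
  have hNg : 2 * N * g2 = 2 * Dl + 1 := by
    rw [hN]; field_simp
  have c1 : ∀ᶠ y in 𝓝 x₀, g2 < ‖gradient σ y‖ ^ 2 := by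
    have : Continuous fun y => ‖gradient σ y‖ ^ 2 := (continuous_gradient hσ).norm.pow 2
    refine this.continuousAt.eventually (lt_mem_nhds ?_)
    rw [hg2]
    have : 0 < ‖gradient σ x₀‖ ^ 2 := by linarith
    linarith
  have c2 : ∀ᶠ y in 𝓝 x₀, |lap σ y| < Dl := by
    refine (contDiff_lap hσ).continuous.abs.continuousAt.eventually (gt_mem_nhds ?_)
    rw [hDl]; linarith
  have c3 : ∀ᶠ y in 𝓝 x₀, |σ y| < 1 / (2 * N) := by
    refine hσ.continuous.abs.continuousAt.eventually (gt_mem_nhds ?_)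
    simp only [h0, abs_zero]; positivity
  obtain ⟨r₁, hr₁, hball⟩ := Metric.eventually_nhds_iff_ball.1 (c1.and (c2.and c3))
  set r₀ := min r₁ R with hr₀
  have hr₀pos : 0 < r₀ := lt_min hr₁ hR
  -- `T` lifts `q` above `M` at distance at least `r₀ / 2` on the positive side; `K` pays for the
  -- Laplacian `4T` of this quadratic term and leaves `-L`.
  set T : ℝ := M / (r₀ / 2) ^ 2 with hT
  have hTpos : 0 ≤ T := by positivity
  set K : ℝ := 4 * T + L with hK
  have hKpos : 0 < K := by positivity
  set q : Plane → ℝ := fun y => K * (σ y + (-N) * (σ y * σ y)) + T * ‖y - x₀‖ ^ 2 with hq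
  have hσσ : ContDiff ℝ ∞ fun y => σ y * σ y := hσ.mul hσ
  have hin : ContDiff ℝ ∞ fun y => σ y + (-N) * (σ y * σ y) := hσ.add (contDiff_const.mul hσσ)
  have hqs : ContDiff ℝ ∞ q :=
    (contDiff_const.mul hin).add (contDiff_const.mul (contDiff_normSq x₀))
  have hlapq : ∀ y, lap q y = K * ((1 - 2 * N * σ y) * lap σ y - 2 * N * ‖gradient σ y‖ ^ 2)
      + 4 * T := by
    intro y
    rw [hq, lap_add (contDiff_const.mul hin) (contDiff_const.mul (contDiff_normSq x₀)),
      lap_const_mul _ hin, lap_const_mul _ (contDiff_normSq x₀), lap_normSq,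
      lap_add hσ (contDiff_const.mul hσσ), lap_const_mul _ hσσ, lap_mul hσ hσ,
      real_inner_self_eq_norm_sq]
    ring
  -- The cutoff turns `q` into the constant `M` far away and leaves it unchanged on the ball of
  -- radius `r₀ / 2`, where the differential inequality is needed.
  let χ : ContDiffBump x₀ := ⟨r₀ / 2, r₀, half_pos hr₀pos, half_lt_self hr₀pos⟩
  set b : Plane → ℝ := fun y => χ y * q y + (1 - χ y) * M with hb
  have hbs : ContDiff ℝ ∞ b :=
    (χ.contDiff.mul hqs).add ((contDiff_const.sub χ.contDiff).mul contDiff_const)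
  have hbq : ∀ y ∈ Metric.ball x₀ (r₀ / 2), b y = q y := by
    intro y hy
    have : χ y = 1 := χ.one_of_mem_closedBall (Metric.ball_subset_closedBall hy)
    simp [hb, this]
  have hqpos : ∀ y ∈ Metric.ball x₀ r₀, 0 < σ y → 0 < σ y + (-N) * (σ y * σ y) := by
    intro y hy hs
    obtain ⟨-, -, a3⟩ := hball y (Metric.ball_subset_ball (min_le_left _ _) hy)
    rw [abs_of_pos hs, lt_div_iff₀ (by positivity)] at a3
    nlinarith
  refine ⟨b, r₀ / 2, half_pos hr₀pos, (half_le_self hr₀pos.le).trans (min_le_right _ _), hbs, ?_,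
    ?_, ?_, ?_⟩
  · rw [hbq x₀ (Metric.mem_ball_self (half_pos hr₀pos))]
    simp [hq, h0]
  · intro y hy hs
    have hy' := Metric.ball_subset_ball (half_le_self hr₀pos.le) hy
    constructor
    · rw [hbq y hy]
      have := mul_pos hKpos (hqpos y hy' hs)
      have : 0 ≤ T * ‖y - x₀‖ ^ 2 := by positivity
      simp only [hq]
      linarith
    · have he : b =ᶠ[𝓝 y] q := by
        filter_upwards [Metric.isOpen_ball.mem_nhds hy] with z hz using hbq z hz
      rw [Filter.EventuallyEq.lap_eq he, hlapq]
      obtain ⟨a1, a2, a3⟩ := hball y (Metric.ball_subset_ball (min_le_left _ _) hy')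
      rw [abs_of_pos hs, lt_div_iff₀ (by positivity)] at a3
      have e1 : (1 - 2 * N * σ y) * lap σ y ≤ Dl := by
        have n1 : 0 ≤ 1 - 2 * N * σ y := by linarith
        have n2 : 1 - 2 * N * σ y ≤ 1 := by
          have := mul_pos hNpos hs
          linarith
        calc (1 - 2 * N * σ y) * lap σ y ≤ (1 - 2 * N * σ y) * |lap σ y| :=
              mul_le_mul_of_nonneg_left (le_abs_self _) n1
          _ ≤ 1 * Dl := mul_le_mul n2 a2.le (abs_nonneg _) zero_le_one
          _ = Dl := one_mul _
      have e2 : 2 * Dl + 1 ≤ 2 * N * ‖gradient σ y‖ ^ 2 := by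
        rw [← hNg]
        exact mul_le_mul_of_nonneg_left a1.le (by positivity)
      have e3 : K * ((1 - 2 * N * σ y) * lap σ y - 2 * N * ‖gradient σ y‖ ^ 2) ≤ K * (-1) :=
        mul_le_mul_of_nonneg_left (by linarith) hKpos.le
      linarith
  · intro y hyR hy hs
    by_cases hy' : y ∈ Metric.ball x₀ r₀
    · have e1 : M ≤ q y := by
        have := mul_pos hKpos (hqpos y hy' hs)
        have h2 : r₀ / 2 ≤ ‖y - x₀‖ := by
          rw [← dist_eq_norm]
          exact not_lt.1 hy
        have h3 : (r₀ / 2) ^ 2 ≤ ‖y - x₀‖ ^ 2 := pow_le_pow_left₀ (by positivity) h2 2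
        have h4 : T * (r₀ / 2) ^ 2 = M := by
          rw [hT]; field_simp
        have h5 := mul_le_mul_of_nonneg_left h3 hTpos
        simp only [hq]
        linarith
      have := mul_le_mul_of_nonneg_left e1 (χ.nonneg (x := y))
      simp only [hb]
      linarith
    · have : χ y = 0 := χ.zero_of_le_dist (not_lt.1 hy')
      simp [hb, this]
  · intro y hy
    have : χ y = 0 := χ.zero_of_le_dist ((min_le_right _ _).trans (not_lt.1 hy))
    simp [hb, this]

/-- A bounded subsolution that vanishes on one side of a smooth hypersurface is small near it. -/
theorem eventually_le_of_barrier (hΩ : Bornology.IsBounded Ω) {C : ℝ}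
    (hA : Measurable A) (hC : ∀ x, |A x| ≤ C) (hf : MemH10 Ω f F)
    {M D α : ℝ} (hM : 0 ≤ M) (hD : 0 ≤ D) (hα : 0 < α)
    (hfM : ∀ᵐ x ∂(volume.restrict Ω), f x ≤ M)
    (hsub : ∀ ψ Ψ, MemH10 Ω ψ Ψ → (∀ x, 0 ≤ ψ x) → (∀ x, f x ≤ 0 → Ψ x = 0) →
      (∫ x in Ω, A x * inner ℝ (F x) (Ψ x)) ≤ D * ∫ x in Ω, ψ x)
    {σ : Plane → ℝ} (hσ : ContDiff ℝ ∞ σ) {x₀ : Plane} (h0 : σ x₀ = 0)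
    (hd : fderiv ℝ σ x₀ ≠ 0)
    (hcoef : ∀ᶠ y in 𝓝 x₀, y ∈ Ω → 0 < σ y → A y = α)
    (hzero : ∃ N ∈ 𝓝 x₀, ∀ᵐ y ∂(volume.restrict Ω), y ∈ N → σ y ≤ 0 → f y ≤ 0)
    (hΩo : IsOpen Ω) {ε : ℝ} (hε : 0 < ε) :
    ∃ N ∈ 𝓝 x₀, ∀ᵐ y ∂(volume.restrict Ω), y ∈ N → f y ≤ ε := by
  have hfin : IsFiniteMeasure (volume.restrict Ω) :=
    ⟨by rw [Measure.restrict_apply_univ]; exact hΩ.measure_lt_top⟩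
  obtain ⟨N₀, hN₀, hz⟩ := hzero
  obtain ⟨R, hR, hball⟩ := Metric.eventually_nhds_iff_ball.1 (hcoef.and hN₀)
  -- The constant `(D + 1) / α` gives `α Δb ≤ -(D + 1)`, strictly beating the source `D` of the
  -- subsolution. Testing with `ψ = (f - b⁺)⁺` then yields `(D + 1) ∫ ψ ≤ D ∫ ψ`.
  obtain ⟨b, r, hr, hrR, hb, hb0, hb1, hb2, hb3⟩ := exists_barrier hσ h0 hd hM
    (div_pos (by linarith : 0 < D + 1) hα) hR
  have hψ := hf.posPart_sub_posPart hΩ hb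
  set ψ : Plane → ℝ := fun x => max (f x - max (b x) 0) 0 with hψdef
  set Ψ : Plane → Plane := fun x =>
    if max (b x) 0 < f x then F x - (if 0 < b x then gradient b x else 0) else 0 with hΨdef
  have hψ0 : ∀ x, 0 ≤ ψ x := fun x => le_max_right _ _
  -- Where `ψ > 0` the point lies in the small ball on the side `σ > 0`: elsewhere either `f ≤ M ≤
  -- b`, or `f ≤ 0` by `hz`.
  have hE : ∀ᵐ y ∂(volume.restrict Ω), max (b y) 0 < f y →
      A y = α ∧ 0 < b y ∧ lap b y ≤ -((D + 1) / α) := by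
    filter_upwards [hz, hfM, ae_restrict_mem hΩo.measurableSet] with y hzy hMy hyΩ hlt
    have hfb : b y < f y := (le_max_left _ _).trans_lt hlt
    have hf0 : 0 < f y := (le_max_right _ _).trans_lt hlt
    have hyR : y ∈ Metric.ball x₀ R := by
      by_contra hcon
      linarith [hb3 y hcon]
    have hσy : 0 < σ y := by
      by_contra hcon
      linarith [hzy (hball y hyR).2 (not_lt.1 hcon)]
    have hyr : y ∈ Metric.ball x₀ r := by
      by_contra hcon
      linarith [hb2 y hyR hcon hσy]
    exact ⟨(hball y hyR).1 hyΩ hσy, hb1 y hyr hσy⟩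
  have hs := hsub ψ Ψ hψ hψ0 fun x hx => by
    rw [hΨdef]
    exact if_neg fun h => absurd ((le_max_right _ _).trans_lt h) (not_lt.2 hx)
  have hgL := memLp_gradient_restrict hΩ hb
  have hψi : Integrable ψ (volume.restrict Ω) := hψ.memLp.integrable (by norm_num)
  have hone : ∀ x : Plane, |(1 : ℝ)| ≤ 1 := fun _ => by simp
  have i1 : Integrable (fun x => (1 : ℝ) * inner ℝ (gradient b x) (Ψ x)) (volume.restrict Ω) :=
    integrable_mul_inner measurable_const hone hgL hψ.grad_memLp
  have i2 : Integrable (fun x => lap b x * ψ x) (volume.restrict Ω) :=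
    MemLp.integrable_mul (memLp_restrict_of_continuous hΩ (contDiff_lap hb).continuous) hψ.memLp
  have ibp := hψ.integral_by_parts_gradient hΩ hb
  unfold form at ibp
  rw [integral_add i1 i2] at ibp
  have l1 : ∫ x in Ω, lap b x * ψ x ≤ -((D + 1) / α) * ∫ x in Ω, ψ x := by
    rw [← integral_const_mul]
    refine integral_mono_ae i2 (hψi.const_mul _) ?_
    filter_upwards [hE] with y hy
    by_cases h : max (b y) 0 < f y
    · exact mul_le_mul_of_nonneg_right (hy h).2.2 (hψ0 y)
    · have : ψ y = 0 := by
        simp only [hψdef]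
        exact max_eq_right (by linarith [not_lt.1 h])
      simp [this]
  have l2 : α * ∫ x in Ω, (1 : ℝ) * inner ℝ (gradient b x) (Ψ x)
      ≤ ∫ x in Ω, A x * inner ℝ (F x) (Ψ x) := by
    rw [← integral_const_mul]
    refine integral_mono_ae (i1.const_mul _)
      (integrable_mul_inner hA hC hf.grad_memLp hψ.grad_memLp) ?_
    filter_upwards [hE] with y hy
    by_cases h : max (b y) 0 < f y
    · obtain ⟨a1, a2, -⟩ := hy h
      have e : Ψ y = F y - gradient b y := by
        simp only [hΨdef, if_pos h, if_pos a2]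
      have e2 : F y = Ψ y + gradient b y := by rw [e]; abel
      have e3 : 0 ≤ α * inner ℝ (Ψ y) (Ψ y) := mul_nonneg hα.le real_inner_self_nonneg
      rw [e2, inner_add_left, a1]
      linarith
    · have : Ψ y = 0 := by simp only [hΨdef, if_neg h]
      simp [this]
  have hint0 : ∫ x in Ω, ψ x ≤ 0 := by
    have e1 : α * ∫ x in Ω, (1 : ℝ) * inner ℝ (gradient b x) (Ψ x)
        ≥ (D + 1) * ∫ x in Ω, ψ x := by
      have : ∫ x in Ω, (1 : ℝ) * inner ℝ (gradient b x) (Ψ x)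
          ≥ (D + 1) / α * ∫ x in Ω, ψ x := by linarith
      calc α * ∫ x in Ω, (1 : ℝ) * inner ℝ (gradient b x) (Ψ x)
          ≥ α * ((D + 1) / α * ∫ x in Ω, ψ x) := mul_le_mul_of_nonneg_left this hα.le
        _ = (D + 1) * ∫ x in Ω, ψ x := by field_simp
    linarith
  have hψz : ψ =ᵐ[volume.restrict Ω] 0 :=
    (integral_eq_zero_iff_of_nonneg hψ0 hψi).1 (le_antisymm hint0 (integral_nonneg hψ0))
  refine ⟨{y | b y < ε}, hb.continuous.continuousAt.eventually (gt_mem_nhds (by rwa [hb0])), ?_⟩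
  filter_upwards [hψz] with y hy hyε
  have h1 : f y - max (b y) 0 ≤ 0 := by
    have : ψ y = 0 := hy
    exact (le_max_left _ _).trans_eq this
  have h2 : max (b y) 0 ≤ ε := max_le (le_of_lt hyε) hε.le
  linarith

end UpperBarrier

/-! ### Smooth boundaries and the pointwise values of `p`. -/

section BoundaryGeometry

variable {U : Set Plane} {ρ : Plane → ℝ} {x : Plane}

theorem eq_zero_of_mem_frontier (hU : IsOpen U) (hx : x ∈ frontier U) (hρ : Continuous ρ)
    (h : ∀ᶠ y in 𝓝 x, (y ∈ U ↔ 0 < ρ y)) : ρ x = 0 := by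
  have hxU : x ∉ U := fun h' => hx.2 (hU.interior_eq.symm ▸ h')
  have h1 : ¬ 0 < ρ x := fun h' => hxU (h.self_of_nhds.2 h')
  refine le_antisymm (not_lt.1 h1) (not_lt.1 fun h2 => ?_)
  have h3 : ∀ᶠ y in 𝓝 x, y ∉ U := by
    filter_upwards [h, hρ.continuousAt.eventually (gt_mem_nhds h2)] with y hy hy'
    exact fun hyU => lt_asymm hy' (hy.1 hyU)
  exact (mem_closure_iff_frequently.1 hx.1) h3

/-- A zero at which the derivative does not vanish is not a local maximum. -/
theorem frequently_pos (h0 : ρ x = 0) (hd : fderiv ℝ ρ x ≠ 0) : ∃ᶠ y in 𝓝 x, 0 < ρ y := by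
  intro h
  refine hd (IsLocalMax.fderiv_eq_zero (f := ρ) ?_)
  filter_upwards [h] with y hy
  rw [h0]
  exact not_lt.1 hy

variable {Ω S₁ : Set Plane} {a : ℝ}

theorem pinning_of_mem (hx : x ∈ S₁) : pinning S₁ a x = 1 := if_pos hx

theorem pinning_of_notMem_closure (hx : x ∉ closure S₁) : pinning S₁ a x = a := by
  rw [pinning, if_neg fun h => hx (subset_closure h), if_neg hx]

theorem pinning_of_mem_frontier (hS : IsOpen S₁) (hx : x ∈ frontier S₁) :
    pinning S₁ a x = min 1 a := by
  rw [pinning, if_neg fun h => hx.2 (hS.interior_eq.symm ▸ h), if_pos hx.1]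

theorem mem_or_notMem_or_frontier (hS : IsOpen S₁) (x : Plane) :
    x ∈ S₁ ∨ x ∉ closure S₁ ∨ x ∈ frontier S₁ := by
  by_cases h1 : x ∈ S₁
  · exact Or.inl h1
  · by_cases h2 : x ∈ closure S₁
    · exact Or.inr (Or.inr ⟨h2, by rwa [hS.interior_eq]⟩)
    · exact Or.inr (Or.inl h2)

theorem eventually_pinning_le (hS : IsOpen S₁) (x : Plane) :
    ∀ᶠ y in 𝓝 x, pinning S₁ a x ≤ pinning S₁ a y := by
  rcases mem_or_notMem_or_frontier hS x with h | h | h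
  · filter_upwards [hS.mem_nhds h] with y hy
    rw [pinning_of_mem h, pinning_of_mem hy]
  · filter_upwards [isClosed_closure.isOpen_compl.mem_nhds h] with y hy
    rw [pinning_of_notMem_closure h, pinning_of_notMem_closure hy]
  · refine Eventually.of_forall fun y => ?_
    rw [pinning_of_mem_frontier hS h]
    exact min_le_pinning y

/-- Near the interface, the two values of `p` are separated by a regular level set. -/
theorem exists_interface_function (hS : IsOpen S₁) (hsm : HasSmoothBoundary S₁)
    (hx : x ∈ frontier S₁) : ∃ σ : Plane → ℝ, ContDiff ℝ ∞ σ ∧ σ x = 0 ∧ fderiv ℝ σ x ≠ 0 ∧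
      ∀ᶠ y in 𝓝 x, (0 < σ y → pinning S₁ a y = max 1 a) ∧
        (σ y ≤ 0 → pinning S₁ a y = min 1 a) := by
  obtain ⟨ρ, hρ, hd, hiff⟩ := hsm x hx
  have h0 := eq_zero_of_mem_frontier hS hx hρ.continuous hiff
  -- The larger value of `p` must lie on `σ > 0`: this is the inside of `S₁` when `a ≤ 1` and the
  -- outside when `1 ≤ a`, so the sign of the defining function depends on the case.
  rcases le_total a 1 with ha | ha
  · refine ⟨ρ, hρ, h0, hd, ?_⟩
    filter_upwards [hiff] with y hy
    refine ⟨fun h => ?_, fun h => ?_⟩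
    · rw [pinning_of_mem (hy.2 h), max_eq_left ha]
    · have hyS : y ∉ S₁ := fun h' => absurd (hy.1 h') (not_lt.2 h)
      rcases mem_or_notMem_or_frontier hS y with h' | h' | h'
      · exact absurd h' hyS
      · rw [pinning_of_notMem_closure h', min_eq_right ha]
      · exact pinning_of_mem_frontier hS h'
  · refine ⟨fun y => - ρ y, hρ.neg, by simp [h0], by simpa [fderiv_fun_neg] using hd, ?_⟩
    have hc : ∀ᶠ y in 𝓝 x, fderiv ℝ ρ y ≠ 0 :=
      (hρ.continuous_fderiv (by simp)).continuousAt.eventually_ne hd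
    filter_upwards [hiff.eventually_nhds, hc] with y hy hyd
    refine ⟨fun h => ?_, fun h => ?_⟩
    · have hyS : y ∉ closure S₁ := by
        rw [mem_closure_iff_frequently, not_frequently]
        filter_upwards [hy, hρ.continuous.continuousAt.eventually
          (gt_mem_nhds (neg_pos.1 h))] with z hz hz'
        exact fun hzS => lt_asymm hz' (hz.1 hzS)
      rw [pinning_of_notMem_closure hyS, max_eq_right ha]
    · rcases (neg_nonpos.1 h).lt_or_eq with h' | h'
      · rw [pinning_of_mem (hy.self_of_nhds.2 h'), min_eq_left ha]
      -- Nearby zeros of `ρ` are regular, hence limits of points with `ρ > 0`; so they lie on the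
      -- interface, where `p` takes its minimum.
      · have hyc : y ∈ closure S₁ := by
          rw [mem_closure_iff_frequently]
          exact ((frequently_pos h'.symm hyd).and_eventually hy).mono fun z hz => hz.2.2 hz.1
        have hyS : y ∉ S₁ := fun h'' => by
          have := hy.self_of_nhds.1 h''
          linarith
        exact pinning_of_mem_frontier hS ⟨hyc, by rwa [hS.interior_eq]⟩

end BoundaryGeometry

/-! ### The obstacle problem and the pointwise size of its solution. -/

section ObstacleProblem

variable {Ω S₁ : Set Plane} {a lam : ℝ} {u : Plane → ℝ} {U : Plane → Plane}

/-- `u`, with gradient `U`, solves the obstacle problem for `-div (p⁻¹ ∇u) + u = 1` in `H¹₀(Ω)`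
with upper obstacle `p / (2 λ)`. -/
structure IsObstacleSolution (Ω S₁ : Set Plane) (a lam : ℝ) (u : Plane → ℝ) (U : Plane → Plane) :
    Prop where
  mem : MemH10 Ω u U
  le_obstacle : ∀ᵐ x ∂(volume.restrict Ω), u x ≤ pinning S₁ a x / (2 * lam)
  variational : ∀ y Y, MemH10 Ω y Y →
    (∀ᵐ x ∂(volume.restrict Ω), y x ≤ pinning S₁ a x / (2 * lam)) →
    ∫ x in Ω, (y x - u x) ≤ form (volume.restrict Ω) (coef S₁ a) u U (fun x => y x - u x)
      (fun x => Y x - U x)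

theorem form_one_eq {ν : Measure Plane} {A : Plane → ℝ} (f : Plane → ℝ) (F : Plane → Plane) :
    form ν A (fun _ => 1) (fun _ => 0) f F = ∫ x, f x ∂ν := by
  simp [form]

theorem exists_obstacleSolution (hD : Geometry Ω S₁ a) (hlam : 0 < lam) :
    ∃ u U, IsObstacleSolution Ω S₁ a lam u U := by
  have hfin := hD.isFiniteMeasure
  have hA := measurable_coef (a := a) hD.isOpen_sub
  have hC := abs_coef_le (S₁ := S₁) hD.pos
  obtain ⟨u, U, h1, h2, h3⟩ := exists_variational_solution (Ω := Ω) (one_div_max_pos a) hA hC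
    (le_coef hD.pos) (J := fun x => Iic (pinning S₁ a x / (2 * lam))) (fun _ => isClosed_Iic)
    (fun _ => convex_Iic _)
    (fun x => div_nonneg (pinning_pos hD.pos x).le (by linarith)) (k := fun _ => 1)
    (memLp_const 1)
  refine ⟨u, U, h1, h2, fun y Y hy hyp => ?_⟩
  have h4 := h3 y Y hy hyp
  have hd := hy.sub h1
  have hz : MemLp (fun _ : Plane => (0 : Plane)) 2 (volume.restrict Ω) := MemLp.zero
  rw [form_sub_left hA hC (memLp_const 1) hz h1.memLp h1.grad_memLp hd.memLp
    hd.grad_memLp, form_one_eq] at h4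
  linarith

theorem IsObstacleSolution.congr {u' : Plane → ℝ} {U' : Plane → Plane}
    (h : IsObstacleSolution Ω S₁ a lam u U) (hu : u =ᵐ[volume.restrict Ω] u')
    (hU : U =ᵐ[volume.restrict Ω] U') : IsObstacleSolution Ω S₁ a lam u' U' := by
  refine ⟨h.mem.congr hu hU, ?_, fun y Y hy hyp => ?_⟩
  · filter_upwards [h.le_obstacle, hu] with x h1 h2
    rwa [← h2]
  · have h1 : (fun x => y x - u x) =ᵐ[volume.restrict Ω] fun x => y x - u' x := by
      filter_upwards [hu] with x hx
      rw [hx]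
    have h2 : (fun x => Y x - U x) =ᵐ[volume.restrict Ω] fun x => Y x - U' x := by
      filter_upwards [hU] with x hx
      rw [hx]
    rw [← form_congr hu hU h1 h2, ← integral_congr_ae h1]
    exact h.variational y Y hy hyp

/-- Lowering `u` never violates an upper obstacle, so `u - ψ` is an admissible competitor. -/
theorem IsObstacleSolution.subsolution (h : IsObstacleSolution Ω S₁ a lam u U)
    {ψ : Plane → ℝ} {Ψ : Plane → Plane} (hψ : MemH10 Ω ψ Ψ)
    (h0 : ∀ᵐ x ∂(volume.restrict Ω), 0 ≤ ψ x) :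
    form (volume.restrict Ω) (coef S₁ a) u U ψ Ψ ≤ ∫ x in Ω, ψ x := by
  have h1 := h.variational _ _ (h.mem.sub hψ) (by
    filter_upwards [h.le_obstacle, h0] with x h2 h3
    linarith)
  have e1 : (fun x => u x - ψ x - u x) = fun x => -1 * ψ x := by ext x; ring
  have e2 : (fun x => U x - Ψ x - U x) = fun x => (-1 : ℝ) • Ψ x := by ext1 x; module
  rw [e1, e2, form_smul_right, integral_const_mul] at h1
  linarith

/-- The competitor `u + u⁻ = u⁺` stays below the nonnegative obstacle, and testing with it makes the
energy of `u⁻` nonpositive. -/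
theorem IsObstacleSolution.nonneg (hD : Geometry Ω S₁ a) (hlam : 0 < lam)
    (h : IsObstacleSolution Ω S₁ a lam u U) : ∀ᵐ x ∂(volume.restrict Ω), 0 ≤ u x := by
  have hA := measurable_coef (a := a) hD.isOpen_sub
  have hC := abs_coef_le (S₁ := S₁) hD.pos
  have hn := h.mem.neg.posPart hD.bounded
  have h1 := h.variational _ _ (h.mem.add hn) (by
    filter_upwards [h.le_obstacle] with x hx
    have : 0 ≤ pinning S₁ a x / (2 * lam) := div_nonneg (pinning_pos hD.pos x).le (by linarith)
    rcases le_total (u x) 0 with h' | h'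
    · rw [max_eq_left (by linarith)]; linarith
    · rw [max_eq_right (by linarith)]; linarith)
  simp only [add_sub_cancel_left] at h1
  have h2 : form (volume.restrict Ω) (coef S₁ a) u U (fun x => max (-u x) 0)
      (fun x => if 0 < -u x then -U x else 0)
      = -1 * form (volume.restrict Ω) (coef S₁ a) (fun x => max (-u x) 0)
      (fun x => if 0 < -u x then -U x else 0) (fun x => max (-u x) 0)
      (fun x => if 0 < -u x then -U x else 0) := by
    rw [← form_smul_left]
    unfold form
    congr 1
    ext x
    by_cases h' : 0 < -u x
    · simp [h', h'.le]
    · simp [h', not_lt.1 h']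
  have h3 : 0 ≤ ∫ x in Ω, max (-u x) 0 := integral_nonneg fun x => le_max_right _ _
  obtain ⟨h4, -⟩ := ae_eq_zero_of_form_self_le (one_div_max_pos a) hA hC (le_coef hD.pos)
    hn.memLp hn.grad_memLp (by linarith)
  filter_upwards [h4] with x hx
  have : max (-u x) 0 = 0 := hx
  have := (le_max_left (-u x) 0).trans_eq this
  linarith

/-- The truncation `(u - m)⁺` inherits the subsolution property, in the form that
`eventually_le_of_barrier` asks for with `D = 1`: `Ψ` vanishes where the truncation does, so its
gradient may be exchanged for `U`, and the zeroth-order term is dropped because `u ≥ 0`. -/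
theorem IsObstacleSolution.integral_truncation_le (hD : Geometry Ω S₁ a) (hlam : 0 < lam)
    (h : IsObstacleSolution Ω S₁ a lam u U) {m : ℝ} {ψ : Plane → ℝ} {Ψ : Plane → Plane}
    (hψ : MemH10 Ω ψ Ψ) (h0 : ∀ x, 0 ≤ ψ x) (hm : ∀ x, max (u x - m) 0 ≤ 0 → Ψ x = 0) :
    (∫ x in Ω, coef S₁ a x * inner ℝ (if m < u x then U x else 0) (Ψ x))
      ≤ 1 * ∫ x in Ω, ψ x := by
  have hA := measurable_coef (a := a) hD.isOpen_sub
  have hC := abs_coef_le (S₁ := S₁) hD.pos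
  have h1 := h.subsolution hψ (ae_of_all _ h0)
  have e : ∀ x, coef S₁ a x * inner ℝ (if m < u x then U x else 0) (Ψ x)
      = coef S₁ a x * inner ℝ (U x) (Ψ x) := fun x => by
    by_cases hx : m < u x
    · rw [if_pos hx]
    · rw [hm x (by rw [max_eq_right]; linarith [not_lt.1 hx])]
      simp
  simp only [e]
  have i2 : Integrable (fun x => u x * ψ x) (volume.restrict Ω) :=
    MemLp.integrable_mul h.mem.memLp hψ.memLp
  unfold form at h1
  rw [integral_add (integrable_mul_inner hA hC h.mem.grad_memLp hψ.grad_memLp) i2] at h1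
  have h2 : 0 ≤ ∫ x in Ω, u x * ψ x := by
    refine integral_nonneg_of_ae ?_
    filter_upwards [h.nonneg hD hlam] with x hx
    exact mul_nonneg hx (h0 x)
  linarith

/-- Upper semicontinuity of the solution with respect to the obstacle. -/
theorem IsObstacleSolution.locally_le (hD : Geometry Ω S₁ a) (hlam : 0 < lam)
    (h : IsObstacleSolution Ω S₁ a lam u U) (x : Plane) {ε : ℝ} (hε : 0 < ε) :
    ∃ N ∈ 𝓝 x, ∀ᵐ y ∂(volume.restrict Ω), y ∈ N →
      u y ≤ pinning S₁ a x / (2 * lam) + ε := by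
  rcases mem_or_notMem_or_frontier hD.isOpen_sub x with hx | hx | hx
  · refine ⟨S₁, hD.isOpen_sub.mem_nhds hx, ?_⟩
    filter_upwards [h.le_obstacle] with y hy hyN
    rw [pinning_of_mem hyN] at hy
    rw [pinning_of_mem hx]
    linarith
  · refine ⟨(closure S₁)ᶜ, isClosed_closure.isOpen_compl.mem_nhds hx, ?_⟩
    filter_upwards [h.le_obstacle] with y hy hyN
    rw [pinning_of_notMem_closure hyN] at hy
    rw [pinning_of_notMem_closure hx]
    linarith
  -- At the interface, cut `u` at the lower obstacle value. The excess vanishes on `σ ≤ 0` by the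
  -- constraint, and on `σ > 0` the coefficient is constant, so the barrier forces the excess to be
  -- small near `x`.
  · obtain ⟨σ, hσ, h0, hd, hev⟩ := exists_interface_function (a := a) hD.isOpen_sub hD.smooth_sub hx
    have hmpos : 0 ≤ min 1 a / (2 * lam) :=
      div_nonneg (le_min zero_le_one hD.pos.le) (by linarith)
    have hMpos : 0 ≤ max 1 a / (2 * lam) :=
      div_nonneg (zero_le_one.trans (le_max_left _ _)) (by linarith)
    obtain ⟨N, hN, hN'⟩ := eventually_le_of_barrier hD.bounded
      (measurable_coef (a := a) hD.isOpen_sub) (abs_coef_le (S₁ := S₁) hD.pos)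
      (h.mem.posPart_sub_const hD.bounded hmpos) hMpos zero_le_one (one_div_max_pos a)
      (by
        filter_upwards [h.le_obstacle] with y hy
        refine max_le ?_ hMpos
        have : pinning S₁ a y / (2 * lam) ≤ max 1 a / (2 * lam) :=
          div_le_div_of_nonneg_right (pinning_le_max y) (by linarith)
        linarith)
      (fun ψ Ψ hψ hψ0 hΨ => h.integral_truncation_le hD hlam hψ hψ0 hΨ)
      hσ h0 hd (by
        filter_upwards [hev] with y hy _ hσy
        rw [coef, hy.1 hσy])
      ⟨_, hev, by
        filter_upwards [h.le_obstacle] with y hy hyN hσy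
        have hyN : (0 < σ y → pinning S₁ a y = max 1 a) ∧
          (σ y ≤ 0 → pinning S₁ a y = min 1 a) := hyN
        rw [hyN.2 hσy] at hy
        rw [max_eq_right]
        linarith⟩ hD.isOpen hε
    refine ⟨N, hN, ?_⟩
    filter_upwards [hN'] with y hy hyN
    rw [pinning_of_mem_frontier hD.isOpen_sub hx]
    linarith [(le_max_left _ _).trans (hy hyN)]

/-- The solution tends to zero at the boundary of `Ω`. -/
theorem IsObstacleSolution.locally_le_of_frontier (hD : Geometry Ω S₁ a) (hlam : 0 < lam)
    (h : IsObstacleSolution Ω S₁ a lam u U) {x : Plane} (hx : x ∈ frontier Ω) {ε : ℝ}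
    (hε : 0 < ε) :
    ∃ N ∈ 𝓝 x, ∀ᵐ y ∂(volume.restrict Ω), y ∈ N → u y ≤ ε := by
  obtain ⟨ρ, hρ, hd, hiff⟩ := hD.smooth x hx
  have h0 := eq_zero_of_mem_frontier hD.isOpen hx hρ.continuous hiff
  have hxΩ : x ∉ Ω := fun h' => hx.2 (hD.isOpen.interior_eq.symm ▸ h')
  have hxS : x ∉ closure S₁ := fun h' => hxΩ (hD.closure_sub h')
  have hMpos : 0 ≤ max 1 a / (2 * lam) :=
    div_nonneg (zero_le_one.trans (le_max_left _ _)) (by linarith)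
  obtain ⟨N, hN, hN'⟩ := eventually_le_of_barrier hD.bounded
    (measurable_coef (a := a) hD.isOpen_sub) (abs_coef_le (S₁ := S₁) hD.pos)
    (h.mem.posPart_sub_const hD.bounded le_rfl) hMpos zero_le_one (one_div_pos.2 hD.pos)
    (by
      filter_upwards [h.le_obstacle] with y hy
      refine max_le ?_ hMpos
      have : pinning S₁ a y / (2 * lam) ≤ max 1 a / (2 * lam) :=
        div_le_div_of_nonneg_right (pinning_le_max y) (by linarith)
      linarith)
    (fun ψ Ψ hψ hψ0 hΨ => h.integral_truncation_le hD hlam hψ hψ0 hΨ)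
    hρ h0 hd (by
      filter_upwards [isClosed_closure.isOpen_compl.mem_nhds hxS] with y hy _ _
      rw [coef, pinning_of_notMem_closure hy])
    -- Near `x` no point of `Ω` has `ρ ≤ 0`, so the required vanishing on that side holds vacuously.
    ⟨_, hiff, by
      filter_upwards [ae_restrict_mem hD.isOpen.measurableSet] with y hyΩ hyN hρy
      exact absurd (hyN.1 hyΩ) (not_lt.2 hρy)⟩ hD.isOpen hε
  refine ⟨N, hN, ?_⟩
  filter_upwards [hN'] with y hy hyN
  linarith [(le_max_left _ _).trans (hy hyN)]

/-- For each fixed error the exceptional set is locally null, hence null; continuity of `q` allows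
`q x` to be traded for `q y` at half the error. The errors `1/(n+1)` are then sent to zero. -/
theorem ae_le_of_locally {ν : Measure Plane} {T : Set Plane} {q : Plane → ℝ} (hq : Continuous q)
    (h : ∀ x ∈ T, ∀ ε > 0, ∃ N ∈ 𝓝 x, ∀ᵐ y ∂ν, y ∈ N → u y ≤ q x + ε) :
    ∀ᵐ y ∂ν, y ∈ T → u y ≤ q y := by
  have key : ∀ n : ℕ, ∀ᵐ y ∂ν, y ∈ T → u y ≤ q y + 1 / ((n : ℝ) + 1) := by
    intro n
    have hpos : (0 : ℝ) < 1 / ((n : ℝ) + 1) := Nat.one_div_pos_of_nat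
    rw [ae_iff]
    refine measure_null_of_locally_null _ fun x hx => ?_
    have hxT : x ∈ T := by
      by_contra hcon
      exact hx fun h' => absurd h' hcon
    obtain ⟨N, hN, hN'⟩ := h x hxT _ (half_pos hpos)
    have hqc : Continuous fun y => q y + 1 / ((n : ℝ) + 1) / 2 := hq.add continuous_const
    have hN2 : {y | q x < q y + 1 / ((n : ℝ) + 1) / 2} ∈ 𝓝 x :=
      hqc.continuousAt.eventually (lt_mem_nhds (by linarith))
    refine ⟨_, inter_mem (mem_nhdsWithin_of_mem_nhds (inter_mem hN hN2)) self_mem_nhdsWithin, ?_⟩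
    refine measure_mono_null ?_ (ae_iff.1 hN')
    rintro y ⟨⟨hy1, hy2⟩, hy3⟩ hcon
    have h1 := hcon hy1
    have hy2 : q x < q y + 1 / ((n : ℝ) + 1) / 2 := hy2
    exact hy3 fun _ => by linarith
  filter_upwards [ae_all_iff.2 key] with y hy hyT
  have := (tendsto_const_nhds (x := q y)).add tendsto_inv_succ
  rw [add_zero] at this
  exact ge_of_tendsto this (Eventually.of_forall fun n => hy n hyT)

open scoped Manifold in
/-- A smooth function between the solution and the obstacle. -/
theorem IsObstacleSolution.exists_smooth_between (hD : Geometry Ω S₁ a) (hlam : 0 < lam)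
    (h : IsObstacleSolution Ω S₁ a lam u U) {ε : ℝ} (hε : 0 < ε) :
    ∃ q : Plane → ℝ, ContDiff ℝ ∞ q ∧ (∀ x, 0 ≤ q x) ∧
      (∀ x, q x ≤ pinning S₁ a x / (2 * lam) + ε) ∧
      ∀ᵐ x ∂(volume.restrict Ω), u x ≤ q x := by
  -- `t x` collects the admissible values at `x`: nonnegative, at most the relaxed obstacle, and
  -- bounding `u` almost everywhere near `x`. These sets are convex. The constant `p(x)/(2λ) + ε/2`
  -- is admissible around `x`, by `locally_le` and the lower semicontinuity of `p`, so a smooth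
  -- partition of unity glues these constants.
  let t : Plane → Set ℝ := fun x => {r | 0 ≤ r ∧ (∃ N ∈ 𝓝 x, ∀ᵐ y ∂(volume.restrict Ω),
    y ∈ N → u y ≤ r) ∧ r ≤ pinning S₁ a x / (2 * lam) + ε}
  have ht : ∀ x, Convex ℝ (t x) := by
    intro x
    refine OrdConnected.convex ⟨fun r hr s hs z hz => ⟨hr.1.trans hz.1, ?_, hz.2.trans hs.2.2⟩⟩
    obtain ⟨N, hN, hN'⟩ := hr.2.1
    exact ⟨N, hN, hN'.mono fun y hy hyN => (hy hyN).trans hz.1⟩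
  have hloc : ∀ x : Plane, ∃ c : ℝ, ∀ᶠ y in 𝓝 x, c ∈ t y := by
    intro x
    obtain ⟨N, hN, hN'⟩ := h.locally_le hD hlam x (half_pos hε)
    refine ⟨pinning S₁ a x / (2 * lam) + ε / 2, ?_⟩
    filter_upwards [eventually_mem_nhds_iff.2 hN, eventually_pinning_le (a := a) hD.isOpen_sub x]
      with y hy hy'
    refine ⟨?_, ⟨N, hy, hN'⟩, ?_⟩
    · have := div_nonneg (pinning_pos (S₁ := S₁) hD.pos x).le (by linarith : 0 ≤ 2 * lam)
      linarith
    · have := div_le_div_of_nonneg_right hy' (by linarith : 0 ≤ 2 * lam)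
      linarith
  obtain ⟨g, hg⟩ := exists_contMDiffMap_forall_mem_convex_of_local_const (n := (⊤ : ℕ∞))
    (I := 𝓘(ℝ, Plane)) ht hloc
  have hgs : ContDiff ℝ ∞ g := g.contMDiff.contDiff
  refine ⟨g, hgs, fun x => (hg x).1, fun x => (hg x).2.2, ?_⟩
  have := ae_le_of_locally (u := u) (ν := volume.restrict Ω) (T := univ) hgs.continuous
    fun x _ ε hε => by
      obtain ⟨N, hN, hN'⟩ := (hg x).2.1
      exact ⟨N, hN, hN'.mono fun y hy hyN => (hy hyN).trans (by linarith)⟩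
  exact this.mono fun x hx => hx (mem_univ _)

end ObstacleProblem

/-! ### Pairing the measure with the obstacle solution; identification of the minimizer. -/

section Pairing

variable {Ω S₁ : Set Plane} {a lam : ℝ} {u : Plane → ℝ} {U : Plane → Plane}

theorem ramp_mono {δ : ℝ} (hδ : 0 < δ) : Monotone (ramp δ) := by
  intro s t hst
  rcases le_total s 0 with h | h
  · rw [ramp_of_nonpos hδ h]
    exact ramp_nonneg hδ t
  · exact mul_le_mul hst (Real.smoothTransition.monotone (div_le_div_of_nonneg_right hst hδ.le))
      (Real.smoothTransition.nonneg _) (h.trans hst)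

/-- Smooth truncations of a nonnegative function of `H¹₀(Ω)` converge to it. -/
theorem MemH10.tendsto_ramp (hΩo : IsOpen Ω) (hΩ : Bornology.IsBounded Ω) (hu : MemH10 Ω u U)
    (h0 : ∀ᵐ x ∂(volume.restrict Ω), 0 ≤ u x) {d : ℕ → ℝ} (hd : ∀ n, 0 < d n)
    (hlim : Tendsto d atTop (𝓝 0)) :
    Tendsto (fun n => eLpNorm (fun x => u x - ramp (d n) (u x)) 2 (volume.restrict Ω))
      atTop (𝓝 0) ∧
    Tendsto (fun n => eLpNorm (fun x => U x - deriv (ramp (d n)) (u x) • U x) 2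
      (volume.restrict Ω)) atTop (𝓝 0) := by
  obtain ⟨C, hC1, hC⟩ := exists_abs_deriv_ramp_le
  have hm : ∀ n, AEStronglyMeasurable (fun x => ramp (d n) (u x)) (volume.restrict Ω) := fun n =>
    (ramp_contDiff _).continuous.comp_aestronglyMeasurable hu.memLp.1
  have hm' : ∀ n, AEStronglyMeasurable (fun x => deriv (ramp (d n)) (u x) • U x)
      (volume.restrict Ω) := fun n =>
    ((continuous_deriv_ramp _).comp_aestronglyMeasurable hu.memLp.1).smul hu.grad_memLp.1
  constructor
  · refine tendsto_eLpNorm_two_of_dominated (g := fun x => ‖u x‖ + ‖u x‖)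
      (fun n => hu.memLp.1.sub (hm n)) (hu.memLp.norm.add hu.memLp.norm)
      (fun n => ae_of_all _ fun x => ?_) ?_
    · refine (norm_sub_le _ _).trans (add_le_add le_rfl ?_)
      rw [Real.norm_of_nonneg (ramp_nonneg (hd n) _)]
      exact (ramp_le (hd n) _).trans (max_le (le_abs_self _) (abs_nonneg _))
    · filter_upwards [h0] with x hx
      have := (tendsto_const_nhds (x := u x)).sub (VortexObstacle.tendsto_ramp hd hlim (u x))
      rwa [max_eq_left hx, sub_self] at this
  · refine tendsto_eLpNorm_two_of_dominated (g := fun x => ‖U x‖ + C * ‖U x‖)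
      (fun n => hu.grad_memLp.1.sub (hm' n)) (hu.grad_memLp.norm.add (hu.grad_memLp.norm.const_mul C))
      (fun n => ae_of_all _ fun x => ?_) ?_
    · refine (norm_sub_le _ _).trans (add_le_add le_rfl ?_)
      rw [norm_smul]
      exact mul_le_mul_of_nonneg_right (hC _ (hd n) _) (norm_nonneg _)
    · filter_upwards [h0, hu.grad_eq_zero_of_eq_zero hΩo hΩ] with x hx hx0
      have := (tendsto_const_nhds (x := U x)).sub
        ((tendsto_deriv_ramp hd hlim (u x)).smul_const (U x))
      rcases hx.lt_or_eq with h | h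
      · rwa [if_pos h, one_smul, sub_self] at this
      · rw [hx0 h.symm]
        simp

theorem signedIntegral_le_of_between {μ : SignedMeasure Plane}
    {φ g : Plane → ℝ} (hφ : IsTest Ω φ) (hg : Measurable g) {C : ℝ} (hgC : ∀ x, |g x| ≤ C)
    (h0 : ∀ x, 0 ≤ φ x) (hφg : ∀ x, φ x ≤ g x) :
    signedIntegral μ φ ≤ ∫ x in Ω, g x ∂μ.totalVariation := by
  have hint : ∀ m : Measure Plane, IsFiniteMeasure m → Integrable g m := fun m _ =>
    Integrable.of_bound hg.aestronglyMeasurable C (ae_of_all _ hgC)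
  have h1 : 0 ≤ ∫ x, φ x ∂μ.toJordanDecomposition.negPart := integral_nonneg h0
  have h2 : ∫ x, φ x ∂μ.toJordanDecomposition.posPart
      = ∫ x in Ω, φ x ∂μ.toJordanDecomposition.posPart :=
    (setIntegral_eq_integral_of_forall_compl_eq_zero fun x hx => hφ.eq_zero hx).symm
  have h3 : ∫ x in Ω, φ x ∂μ.toJordanDecomposition.posPart
      ≤ ∫ x in Ω, g x ∂μ.toJordanDecomposition.posPart :=
    integral_mono (integrable_test _ hφ) (hint _ inferInstance) hφg
  have h4 : ∫ x in Ω, g x ∂μ.toJordanDecomposition.posPart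
      ≤ ∫ x in Ω, g x ∂μ.totalVariation := by
    refine integral_mono_measure (Measure.restrict_mono le_rfl ?_)
      (ae_of_all _ fun x => (h0 x).trans (hφg x)) ?_
    · rw [SignedMeasure.totalVariation]
      exact Measure.le_add_right le_rfl
    · rw [SignedMeasure.totalVariation, Measure.restrict_add]
      exact hint _ inferInstance
  rw [signedIntegral]
  linarith

/-- The pairing of the measure with the solution of the obstacle problem is bounded by the integral
of the obstacle. -/
theorem IsObstacleSolution.form_le_integral_obstacle (hD : Geometry Ω S₁ a) (hlam : 0 < lam)
    (h : IsObstacleSolution Ω S₁ a lam u U) {μ : SignedMeasure Plane} {k : Plane → ℝ}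
    {K : Plane → Plane} (hp : IsPotential Ω S₁ a μ k K) :
    form (volume.restrict Ω) (coef S₁ a) k K u U
      ≤ ∫ x in Ω, pinning S₁ a x / (2 * lam) ∂μ.totalVariation := by
  have hfin := hD.isFiniteMeasure
  have hA := measurable_coef (a := a) hD.isOpen_sub
  have hC := abs_coef_le (S₁ := S₁) hD.pos
  have hk := hp.memLp hD
  have hK := hp.boundary.grad_memLp
  have hu0 := h.nonneg hD hlam
  have hfinT : IsFiniteMeasure μ.totalVariation := by
    rw [SignedMeasure.totalVariation]; infer_instance
  set I := ∫ x in Ω, pinning S₁ a x / (2 * lam) ∂μ.totalVariation with hI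
  set m := (μ.totalVariation.restrict Ω).real univ with hm
  have key : ∀ δ : ℝ, 0 < δ → form (volume.restrict Ω) (coef S₁ a) k K
      (fun x => ramp δ (u x)) (fun x => deriv (ramp δ) (u x) • U x) ≤ I + (δ + δ) * m := by
    intro δ hδ
    -- The test functions `ramp δ φₙ - ramp δ (φₙ - q)` lie between `0` and `q + δ`, hence below
    -- `p/(2λ) + 2δ` everywhere, so `μ` can be paired with them. They converge in `H¹` to `ramp δ
    -- u`, since the second term vanishes in the limit by `u ≤ q`.
    obtain ⟨q, hq, hq0, hqp, huq⟩ := h.exists_smooth_between hD hlam hδ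
    obtain ⟨φ, h1, h2, h3, h4⟩ := h.mem.exists_approx_ae
    have hz : ContDiff ℝ ∞ (fun _ : Plane => (0 : ℝ)) := contDiff_const
    obtain ⟨a1, a2, a3, a4⟩ := tendsto_ramp_sub hD.bounded h.mem h1 h2 h3 h4 hz hδ
    obtain ⟨b1, b2, b3, b4⟩ := tendsto_ramp_sub hD.bounded h.mem h1 h2 h3 h4 hq hδ
    have t1 : ∀ n, IsTest Ω fun x => ramp δ (φ n x - 0) := fun n =>
      (h1 n).ramp_sub hδ hz fun _ => le_rfl
    have t2 : ∀ n, IsTest Ω fun x => ramp δ (φ n x - q x) := fun n => (h1 n).ramp_sub hδ hq hq0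
    have c1 := tendsto_form hA hC hk hK a1 a2 (fun n => (t1 n).memLp)
      (fun n => (t1 n).memLp_gradient) a3 a4
    have c2 := tendsto_form hA hC hk hK b1 b2 (fun n => (t2 n).memLp)
      (fun n => (t2 n).memLp_gradient) b3 b4
    have e2 : form (volume.restrict Ω) (coef S₁ a) k K (fun x => ramp δ (u x - q x))
        (fun x => deriv (ramp δ) (u x - q x) • (U x - gradient q x)) = 0 := by
      have hz1 : (fun x => ramp δ (u x - q x)) =ᵐ[volume.restrict Ω] fun _ => 0 := by
        filter_upwards [huq] with x hx
        exact ramp_of_nonpos hδ (by linarith)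
      have hz2 : (fun x => deriv (ramp δ) (u x - q x) • (U x - gradient q x))
          =ᵐ[volume.restrict Ω] fun _ => 0 := by
        filter_upwards [huq] with x hx
        rw [deriv_ramp_of_nonpos hδ (by linarith), zero_smul]
      rw [form_congr ae_eq_rfl ae_eq_rfl hz1 hz2]
      simp [form]
    have c3 := c1.sub c2
    rw [e2, sub_zero] at c3
    simp only [sub_zero, gradient_fun_const] at c3
    refine le_of_tendsto c3 (Eventually.of_forall fun n => ?_)
    have t3 := (t1 n).sub (t2 n)
    simp only [sub_zero] at t3
    have t1' := t1 n
    simp only [sub_zero] at t1'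
    have e3 : form (volume.restrict Ω) (coef S₁ a) k K (fun x => ramp δ (φ n x))
          (gradient fun x => ramp δ (φ n x))
        - form (volume.restrict Ω) (coef S₁ a) k K (fun x => ramp δ (φ n x - q x))
          (gradient fun x => ramp δ (φ n x - q x))
        = signedIntegral μ (fun x => ramp δ (φ n x) - ramp δ (φ n x - q x)) := by
      rw [← hp.form_eq t3, ← form_sub_right hA hC hk hK t1'.memLp t1'.memLp_gradient
        (t2 n).memLp (t2 n).memLp_gradient]
      congr 1
      ext1 x
      rw [gradient_fun_sub (t1'.differentiable x) ((t2 n).differentiable x)]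
    rw [e3]
    have hpm := measurable_pinning (a := a) hD.isOpen_sub
    have l1 := signedIntegral_le_of_between (μ := μ) t3
      (g := fun x => pinning S₁ a x / (2 * lam) + (δ + δ))
      ((hpm.div_const _).add measurable_const) (C := max 1 a / (2 * lam) + (δ + δ))
      (fun x => by
        have e1 := div_nonneg (pinning_pos (S₁ := S₁) hD.pos x).le (by linarith : 0 ≤ 2 * lam)
        have e2 := div_le_div_of_nonneg_right (pinning_le_max (S₁ := S₁) (a := a) x)
          (by linarith : 0 ≤ 2 * lam)
        rw [abs_of_nonneg (by linarith)]
        linarith)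
      (fun x => sub_nonneg.2 (ramp_mono hδ (by linarith [hq0 x])))
      (fun x => by
        have e1 := ramp_le hδ (φ n x)
        have e2 := lt_ramp_add hδ (φ n x - q x)
        have e3 : max (φ n x) 0 ≤ max (φ n x - q x) 0 + q x :=
          max_le (by linarith [le_max_left (φ n x - q x) 0])
            (by linarith [le_max_right (φ n x - q x) 0, hq0 x])
        have e4 := hqp x
        linarith)
    refine l1.trans (le_of_eq ?_)
    rw [integral_add ((integrable_pinning hD.isOpen_sub hD.pos _).div_const _)
      (integrable_const _), integral_const, smul_eq_mul, mul_comm m]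
  have hpos : ∀ n : ℕ, 0 < 1 / ((n : ℝ) + 1) := fun n => Nat.one_div_pos_of_nat
  obtain ⟨r1, r2⟩ := h.mem.tendsto_ramp hD.isOpen hD.bounded hu0 hpos tendsto_inv_succ
  have hr : ∀ n : ℕ, MemH10 Ω (fun x => ramp (1 / ((n : ℝ) + 1)) (u x))
      (fun x => deriv (ramp (1 / ((n : ℝ) + 1))) (u x) • U x) := fun n => by
    have := h.mem.ramp_sub hD.bounded (β := fun _ => 0) contDiff_const (fun _ => le_rfl) (hpos n)
    simpa only [sub_zero, gradient_fun_const] using this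
  have c1 := tendsto_form hA hC hk hK h.mem.memLp h.mem.grad_memLp (fun n => (hr n).memLp)
    (fun n => (hr n).grad_memLp) r1 r2
  have c2 : Tendsto (fun n : ℕ => I + (1 / ((n : ℝ) + 1) + 1 / ((n : ℝ) + 1)) * m) atTop (𝓝 I) := by
    have := ((tendsto_inv_succ.add tendsto_inv_succ).mul_const m).const_add I
    simpa using this
  exact le_of_tendsto_of_tendsto c1 c2 (Eventually.of_forall fun n => key _ (hpos n))

/-- The potential of a minimizer solves the obstacle problem. -/
theorem isObstacleSolution_of_minimizer (hD : Geometry Ω S₁ a) (hlam : 0 < lam)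
    {μ : SignedMeasure Plane} {h h₀ : Plane → ℝ} {G₀ : Plane → Plane}
    (hp₀ : IsPotential Ω S₁ a 0 h₀ G₀) (hmin : IsEnergyMinimizer Ω S₁ a lam μ h) :
    ∃ G, IsPotential Ω S₁ a μ h G ∧
      IsObstacleSolution Ω S₁ a lam (fun x => 1 - h x) (fun x => - G x) := by
  obtain ⟨hμ, G, hp, hmin⟩ := hmin
  refine ⟨G, hp, ?_⟩
  have hfin := hD.isFiniteMeasure
  have hA := measurable_coef (a := a) hD.isOpen_sub
  have hC := abs_coef_le (S₁ := S₁) hD.pos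
  have hk := hp.memLp hD
  have hK := hp.boundary.grad_memLp
  obtain ⟨v, V, hv⟩ := exists_obstacleSolution (a := a) hD hlam
  have hu : MemH10 Ω (fun x => 1 - h x) (fun x => - G x) :=
    hp.boundary.neg.congr (ae_of_all _ fun x => by simp) ae_eq_rfl
  have hup := le_obstacle_of_minimizer hD hlam hμ hp hmin
  -- With `u = 1 - h`, `l2` and `l3` say that the form of `h` against `u - v` is nonnegative. Hence
  -- the form of `u` against `u - v` is at most `∫ (u - v)`, which by `l1` is at most the form of
  -- `v` against `u - v`; the difference is the energy of `u - v`.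
  have l1 := hv.variational _ _ hu hup
  have l2 := hv.form_le_integral_obstacle hD hlam hp
  have l3 := obstacle_integral_le_of_minimizer hD hlam hμ hp hp₀ hmin
  have hd := hu.sub hv.mem
  have l4 : - form (volume.restrict Ω) (coef S₁ a) h G (fun x => h x - 1) G
      = form (volume.restrict Ω) (coef S₁ a) h G (fun x => 1 - h x) (fun x => - G x) := by
    have := form_smul_right (ν := volume.restrict Ω) (A := coef S₁ a) (f := h) (F := G)
      (g := fun x => h x - 1) (G := G) (-1)
    rw [neg_eq_neg_one_mul, ← this]
    congr 1
    · ext x; ring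
    · ext1 x; simp
  have l5 := form_sub_right hA hC hk hK hu.memLp hu.grad_memLp hv.mem.memLp hv.mem.grad_memLp
  have hz : MemLp (fun _ : Plane => (0 : Plane)) 2 (volume.restrict Ω) := MemLp.zero
  have l6 := form_sub_left hA hC (memLp_const (1 : ℝ)) hz hk hK hd.memLp hd.grad_memLp
  rw [form_one_eq] at l6
  have l7 := form_sub_left hA hC hu.memLp hu.grad_memLp hv.mem.memLp hv.mem.grad_memLp hd.memLp
    hd.grad_memLp
  have e : (fun x => 0 - G x) = fun x => - G x := by ext1 x; simp
  rw [e] at l6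
  obtain ⟨z1, z2⟩ := ae_eq_zero_of_form_self_le (one_div_max_pos a) hA hC (le_coef hD.pos)
    hd.memLp hd.grad_memLp (by linarith)
  refine hv.congr ?_ ?_
  · filter_upwards [z1] with x hx
    exact (sub_eq_zero.1 hx).symm
  · filter_upwards [z2] with x hx
    exact (sub_eq_zero.1 hx).symm

end Pairing

/-! ### Comparison principles and the unconstrained solution. -/

section Comparison

variable {Ω S₁ : Set Plane} {a lam : ℝ} {u f : Plane → ℝ} {U F : Plane → Plane}

/-- Weak maximum principle: pairing `f` with `f⁺` gives the energy of `f⁺`. -/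
theorem MemH10.nonpos_of_form_posPart_le (hD : Geometry Ω S₁ a) (hf : MemH10 Ω f F)
    (h : form (volume.restrict Ω) (coef S₁ a) f F (fun x => max (f x) 0)
      (fun x => if 0 < f x then F x else 0) ≤ 0) : ∀ᵐ x ∂(volume.restrict Ω), f x ≤ 0 := by
  have hp := hf.posPart hD.bounded
  have e : form (volume.restrict Ω) (coef S₁ a) f F (fun x => max (f x) 0)
      (fun x => if 0 < f x then F x else 0)
      = form (volume.restrict Ω) (coef S₁ a) (fun x => max (f x) 0)
      (fun x => if 0 < f x then F x else 0) (fun x => max (f x) 0)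
      (fun x => if 0 < f x then F x else 0) := by
    unfold form
    congr 1
    ext x
    by_cases h' : 0 < f x
    · simp [h', h'.le]
    · simp [h', not_lt.1 h']
  rw [e] at h
  obtain ⟨h1, -⟩ := ae_eq_zero_of_form_self_le (one_div_max_pos a)
    (measurable_coef (a := a) hD.isOpen_sub) (abs_coef_le (S₁ := S₁) hD.pos) (le_coef hD.pos)
    hp.memLp hp.grad_memLp h
  filter_upwards [h1] with x hx
  have : max (f x) 0 = 0 := hx
  exact (le_max_left _ _).trans_eq this

/-- Comparison of the solution of the obstacle problem with subsolutions below the obstacle. -/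
theorem IsObstacleSolution.le_of_subsolution (hD : Geometry Ω S₁ a)
    (h : IsObstacleSolution Ω S₁ a lam u U) {z : Plane → ℝ} {Z : Plane → Plane}
    (hz : MemH10 Ω z Z) (hzp : ∀ᵐ x ∂(volume.restrict Ω), z x ≤ pinning S₁ a x / (2 * lam))
    (hsub : form (volume.restrict Ω) (coef S₁ a) z Z (fun x => max (z x - u x) 0)
      (fun x => if 0 < z x - u x then Z x - U x else 0)
        ≤ ∫ x in Ω, max (z x - u x) 0) : ∀ᵐ x ∂(volume.restrict Ω), z x ≤ u x := by
  have hd := hz.sub h.mem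
  have hψ := hd.posPart hD.bounded
  have h1 := h.variational _ _ (h.mem.add hψ) (by
    filter_upwards [h.le_obstacle, hzp] with x h1 h2
    rcases le_total (z x) (u x) with h' | h'
    · rw [max_eq_right (by linarith)]; linarith
    · rw [max_eq_left (by linarith)]; linarith)
  simp only [add_sub_cancel_left] at h1
  have h2 := hd.nonpos_of_form_posPart_le hD (by
    rw [form_sub_left (measurable_coef (a := a) hD.isOpen_sub) (abs_coef_le (S₁ := S₁) hD.pos)
      hz.memLp hz.grad_memLp h.mem.memLp h.mem.grad_memLp hψ.memLp hψ.grad_memLp]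
    linarith)
  filter_upwards [h2] with x hx
  linarith

/-- The rescaled function `(λ/λ') u` lies below the obstacle `p/(2λ')` and is a subsolution with
source `λ/λ' ≤ 1`, so it lies below `u'`. -/
theorem IsObstacleSolution.mono (hD : Geometry Ω S₁ a) {lam' : ℝ} (hlam : 0 < lam)
    (hle : lam ≤ lam') (h : IsObstacleSolution Ω S₁ a lam u U) {u' : Plane → ℝ}
    {U' : Plane → Plane} (h' : IsObstacleSolution Ω S₁ a lam' u' U') :
    ∀ᵐ x ∂(volume.restrict Ω), lam * u x ≤ lam' * u' x := by
  have hlam' := hlam.trans_le hle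
  have hc1 : lam / lam' ≤ 1 := (div_le_one hlam').2 hle
  have hc0 : 0 ≤ lam / lam' := (div_pos hlam hlam').le
  have hz := h.mem.const_mul (lam / lam')
  have hψ := (hz.sub h'.mem).posPart hD.bounded
  have key := h'.le_of_subsolution hD hz (by
    filter_upwards [h.le_obstacle] with x hx
    have := mul_le_mul_of_nonneg_left hx hc0
    refine this.trans (le_of_eq ?_)
    field_simp) (by
    rw [form_smul_left]
    have h1 := h.subsolution hψ (ae_of_all _ fun x => le_max_right _ _)
    have h2 : 0 ≤ ∫ x in Ω, max (lam / lam' * u x - u' x) 0 :=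
      integral_nonneg fun x => le_max_right _ _
    calc _ ≤ lam / lam' * ∫ x in Ω, max (lam / lam' * u x - u' x) 0 :=
          mul_le_mul_of_nonneg_left h1 hc0
      _ ≤ 1 * ∫ x in Ω, max (lam / lam' * u x - u' x) 0 := mul_le_mul_of_nonneg_right hc1 h2
      _ = _ := one_mul _)
  filter_upwards [key] with x hx
  have := mul_le_mul_of_nonneg_left hx hlam'.le
  rwa [← mul_assoc, mul_div_cancel₀ _ hlam'.ne'] at this

theorem IsObstacleSolution.unique (hD : Geometry Ω S₁ a) (hlam : 0 < lam)
    (h : IsObstacleSolution Ω S₁ a lam u U) {u' : Plane → ℝ}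
    {U' : Plane → Plane} (h' : IsObstacleSolution Ω S₁ a lam u' U') :
    u =ᵐ[volume.restrict Ω] u' := by
  filter_upwards [h.mono hD hlam le_rfl h', h'.mono hD hlam le_rfl h] with x h1 h2
  exact le_antisymm (le_of_mul_le_mul_left h1 hlam) (le_of_mul_le_mul_left h2 hlam)

/-- `u`, with gradient `U`, is the solution of `-div (p⁻¹ ∇u) + u = 1` in `H¹₀(Ω)`. -/
structure IsFreeSolution (Ω S₁ : Set Plane) (a : ℝ) (u : Plane → ℝ) (U : Plane → Plane) :
    Prop where
  mem : MemH10 Ω u U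
  form_eq : ∀ ψ Ψ, MemH10 Ω ψ Ψ → form (volume.restrict Ω) (coef S₁ a) u U ψ Ψ = ∫ x in Ω, ψ x

theorem isFreeSolution_of_potential (hD : Geometry Ω S₁ a) {h : Plane → ℝ} {G : Plane → Plane}
    (hp : IsPotential Ω S₁ a 0 h G) :
    IsFreeSolution Ω S₁ a (fun x => 1 - h x) (fun x => - G x) := by
  have hfin := hD.isFiniteMeasure
  have hA := measurable_coef (a := a) hD.isOpen_sub
  have hC := abs_coef_le (S₁ := S₁) hD.pos
  have hz : MemLp (fun _ : Plane => (0 : Plane)) 2 (volume.restrict Ω) := MemLp.zero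
  refine ⟨hp.boundary.neg.congr (ae_of_all _ fun x => by simp) ae_eq_rfl, fun ψ Ψ hψ => ?_⟩
  have h0 : form (volume.restrict Ω) (coef S₁ a) h G ψ Ψ = 0 := by
    rw [hψ.form_eq_of_forall_test hA hC (hp.memLp hD) hp.boundary.grad_memLp
      (l := fun _ => 0) (L := fun _ => 0) MemLp.zero MemLp.zero fun φ hφ => by
        rw [hp.form_eq hφ, signedIntegral, SignedMeasure.toJordanDecomposition_zero]
        simp [form]]
    simp [form]
  have h1 := form_sub_left hA hC (memLp_const (1 : ℝ)) hz (hp.memLp hD) hp.boundary.grad_memLp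
    hψ.memLp hψ.grad_memLp
  have e : (fun x => 0 - G x) = fun x => - G x := by ext1 x; simp
  rw [form_one_eq, h0, e, sub_zero] at h1
  exact h1

theorem IsFreeSolution.unique (hD : Geometry Ω S₁ a) (h : IsFreeSolution Ω S₁ a u U)
    {u' : Plane → ℝ} {U' : Plane → Plane} (h' : IsFreeSolution Ω S₁ a u' U') :
    u =ᵐ[volume.restrict Ω] u' ∧ U =ᵐ[volume.restrict Ω] U' := by
  have hA := measurable_coef (a := a) hD.isOpen_sub
  have hC := abs_coef_le (S₁ := S₁) hD.pos
  have hd := h.mem.sub h'.mem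
  obtain ⟨h1, h2⟩ := ae_eq_zero_of_form_self_le (one_div_max_pos a) hA hC (le_coef hD.pos)
    hd.memLp hd.grad_memLp (by
      rw [form_sub_left hA hC h.mem.memLp h.mem.grad_memLp h'.mem.memLp h'.mem.grad_memLp
        hd.memLp hd.grad_memLp, h.form_eq _ _ hd, h'.form_eq _ _ hd, sub_self])
  exact ⟨h1.mono fun x hx => sub_eq_zero.1 hx, h2.mono fun x hx => sub_eq_zero.1 hx⟩

theorem IsFreeSolution.nonneg (hD : Geometry Ω S₁ a) (h : IsFreeSolution Ω S₁ a u U) :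
    ∀ᵐ x ∂(volume.restrict Ω), 0 ≤ u x := by
  have hn := h.mem.neg
  have hψ := hn.posPart hD.bounded
  have h1 := hn.nonpos_of_form_posPart_le hD (by
    have e := form_smul_left (ν := volume.restrict Ω) (A := coef S₁ a) (f := u) (F := U)
      (g := fun x => max (-u x) 0) (G := fun x => if 0 < -u x then -U x else 0) (-1)
    simp only [neg_one_mul, neg_one_smul] at e
    rw [e, h.form_eq _ _ hψ]
    have : 0 ≤ ∫ x in Ω, max (-u x) 0 := integral_nonneg fun x => le_max_right _ _
    linarith)
  filter_upwards [h1] with x hx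
  linarith

/-- The constant `1` solves the same equation, so `u - 1` pairs to zero with `(u - 1)⁺`, and the
maximum principle applies. -/
theorem IsFreeSolution.le_one (hD : Geometry Ω S₁ a) (h : IsFreeSolution Ω S₁ a u U) :
    ∀ᵐ x ∂(volume.restrict Ω), u x ≤ 1 := by
  have hfin := hD.isFiniteMeasure
  have hA := measurable_coef (a := a) hD.isOpen_sub
  have hC := abs_coef_le (S₁ := S₁) hD.pos
  have hψ := h.mem.posPart_sub_const hD.bounded zero_le_one
  have hz : MemLp (fun _ : Plane => (0 : Plane)) 2 (volume.restrict Ω) := MemLp.zero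
  have h1 := h.form_eq _ _ hψ
  have e : form (volume.restrict Ω) (coef S₁ a) (fun x => max (u x - 1) 0)
      (fun x => if 1 < u x then U x else 0) (fun x => max (u x - 1) 0)
      (fun x => if 1 < u x then U x else 0)
      = form (volume.restrict Ω) (coef S₁ a) (fun x => u x - 1) (fun x => U x - 0)
        (fun x => max (u x - 1) 0) (fun x => if 1 < u x then U x else 0) := by
    unfold form
    congr 1
    ext x
    by_cases h' : 1 < u x
    · simp [h', h'.le]
    · simp [h', not_lt.1 h']
  rw [form_sub_left hA hC h.mem.memLp h.mem.grad_memLp (memLp_const (1 : ℝ)) hz hψ.memLp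
    hψ.grad_memLp, h1, form_one_eq, sub_self] at e
  obtain ⟨h2, -⟩ := ae_eq_zero_of_form_self_le (one_div_max_pos a) hA hC (le_coef hD.pos)
    hψ.memLp hψ.grad_memLp e.le
  filter_upwards [h2] with x hx
  have : max (u x - 1) 0 = 0 := hx
  have := (le_max_left _ _).trans_eq this
  linarith

theorem IsObstacleSolution.le_free (hD : Geometry Ω S₁ a)
    (h : IsObstacleSolution Ω S₁ a lam u U) {u₀ : Plane → ℝ} {U₀ : Plane → Plane}
    (h₀ : IsFreeSolution Ω S₁ a u₀ U₀) : ∀ᵐ x ∂(volume.restrict Ω), u x ≤ u₀ x := by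
  have hd := h.mem.sub h₀.mem
  have hψ := hd.posPart hD.bounded
  have h1 := hd.nonpos_of_form_posPart_le hD (by
    rw [form_sub_left (measurable_coef (a := a) hD.isOpen_sub) (abs_coef_le (S₁ := S₁) hD.pos)
      h.mem.memLp h.mem.grad_memLp h₀.mem.memLp h₀.mem.grad_memLp hψ.memLp hψ.grad_memLp,
      h₀.form_eq _ _ hψ]
    linarith [h.subsolution hψ (ae_of_all _ fun x => le_max_right _ _)])
  filter_upwards [h1] with x hx
  linarith

theorem IsFreeSolution.isObstacleSolution (h : IsFreeSolution Ω S₁ a u U)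
    (hle : ∀ᵐ x ∂(volume.restrict Ω), u x ≤ pinning S₁ a x / (2 * lam)) :
    IsObstacleSolution Ω S₁ a lam u U :=
  ⟨h.mem, hle, fun _ _ hy _ => (h.form_eq _ _ (hy.sub h.mem)).ge⟩

/-- The free solution does not vanish on a nonempty open set. -/
theorem IsFreeSolution.not_ae_nonpos (hD : Geometry Ω S₁ a) (h : IsFreeSolution Ω S₁ a u U)
    {O : Set Plane} (hO : IsOpen O) (hne : O.Nonempty) (hOΩ : O ⊆ Ω) :
    ¬ ∀ᵐ x ∂(volume.restrict Ω), x ∈ O → u x ≤ 0 := by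
  intro hle
  obtain ⟨x, hx⟩ := hne
  obtain ⟨r, hr, hrO⟩ := Metric.isOpen_iff.1 hO x hx
  let χ : ContDiffBump x := ⟨r / 4, r / 2, by linarith, by linarith⟩
  have hts : tsupport χ ⊆ O := by
    rw [χ.tsupport_eq]
    exact (Metric.closedBall_subset_ball (by change r / 2 < r; linarith)).trans hrO
  have hχ : IsTest Ω χ := ⟨χ.contDiff, χ.hasCompactSupport, hts.trans hOΩ⟩
  have h1 := h.form_eq _ _ hχ.memH10
  -- If `u ≤ 0` on `O`, then `u = 0` there by nonnegativity and its gradient vanishes as well. The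
  -- equation tested with a bump would give the bump integral zero.
  have h2 : form (volume.restrict Ω) (coef S₁ a) u U χ (gradient χ) = 0 := by
    unfold form
    refine integral_eq_zero_of_ae ?_
    filter_upwards [hle, h.nonneg hD, h.mem.grad_eq_zero_of_eq_zero hD.isOpen hD.bounded]
      with y h3 h4 h5
    by_cases hy : y ∈ O
    · have : u y = 0 := le_antisymm (h3 hy) h4
      simp [this, h5 this]
    · have hy' : y ∉ tsupport χ := fun h' => hy (hts h')
      rw [gradient_eq_zero_of_notMem_tsupport hy', image_eq_zero_of_notMem_tsupport hy']
      simp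
  rw [h2, setIntegral_eq_integral_of_forall_compl_eq_zero fun y hy => hχ.eq_zero hy] at h1
  exact χ.integral_pos.ne h1

end Comparison

/-! ### Subsolutions touching `p` from below. -/

section LowerBarrier

variable {Ω S₁ : Set Plane} {a lam : ℝ}

theorem exists_bound_lap {φ : Plane → ℝ} (hφ : IsTest Ω φ) : ∃ C, 0 ≤ C ∧ ∀ x, |lap φ x| ≤ C := by
  have hc : HasCompactSupport (lap φ) := by
    refine HasCompactSupport.intro hφ.2.1 fun x hx => ?_
    have h : φ =ᶠ[𝓝 x] fun _ => 0 := notMem_tsupport_iff_eventuallyEq.1 hx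
    rw [Filter.EventuallyEq.lap_eq h, lap_const]
  obtain ⟨C, hC⟩ := hc.exists_bound_of_continuous (contDiff_lap hφ.1).continuous
  exact ⟨C, (norm_nonneg _).trans (hC 0), hC⟩

/-- A first-order Taylor estimate for smooth functions, based at the moving point. -/
theorem exists_taylor_bound {σ : Plane → ℝ} (hσ : ContDiff ℝ ∞ σ) {x₀ : Plane} (h0 : σ x₀ = 0) :
    ∃ L r : ℝ, 0 ≤ L ∧ 0 < r ∧ ∀ y ∈ Metric.ball x₀ r,
      σ y - L * ‖y - x₀‖ ^ 2 ≤ inner ℝ (gradient σ y) (y - x₀) := by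
  have h1 : ContDiffAt ℝ 1 (fderiv ℝ σ) x₀ :=
    ((contDiff_infty_iff_fderiv.1 hσ).2.of_le (by simp)).contDiffAt
  obtain ⟨K, t, ht, hK⟩ := h1.exists_lipschitzOnWith
  obtain ⟨r, hr, hrt⟩ := Metric.mem_nhds_iff.1 ht
  refine ⟨K * 2, r, by positivity, hr, fun y hy => ?_⟩
  have hsub : Metric.closedBall x₀ ‖y - x₀‖ ⊆ t := by
    refine (Metric.closedBall_subset_ball ?_).trans hrt
    rw [← dist_eq_norm]; exact hy
  have hyB : y ∈ Metric.closedBall x₀ ‖y - x₀‖ := by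
    rw [Metric.mem_closedBall, dist_eq_norm]
  have hxB : x₀ ∈ Metric.closedBall x₀ ‖y - x₀‖ := Metric.mem_closedBall_self (norm_nonneg _)
  have key := (convex_closedBall x₀ ‖y - x₀‖).norm_image_sub_le_of_norm_hasFDerivWithin_le'
    (f := σ) (f' := fderiv ℝ σ) (φ := fderiv ℝ σ y) (C := K * (2 * ‖y - x₀‖))
    (fun z _ => (hσ.differentiable (by simp) z).hasFDerivAt.hasFDerivWithinAt)
    (fun z hz => by
      have h2 := hK.dist_le_mul z (hsub hz) y (hsub hyB)
      rw [dist_eq_norm, dist_eq_norm] at h2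
      refine h2.trans (mul_le_mul_of_nonneg_left ?_ K.2)
      rw [Metric.mem_closedBall, dist_eq_norm] at hz
      calc ‖z - y‖ = ‖(z - x₀) - (y - x₀)‖ := by congr 1; abel
        _ ≤ ‖z - x₀‖ + ‖y - x₀‖ := norm_sub_le _ _
        _ ≤ _ := by linarith) hyB hxB
  rw [h0, norm_sub_rev x₀ y, ← inner_gradient_left] at key
  have e : inner ℝ (gradient σ y) (x₀ - y) = - inner ℝ (gradient σ y) (y - x₀) := by
    rw [← inner_neg_right, neg_sub]
  rw [e, Real.norm_eq_abs] at key
  have := (abs_le.1 key).1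
  nlinarith

theorem deriv_smoothTransition_of_nonpos {t : ℝ} (ht : t ≤ 0) :
    deriv Real.smoothTransition t = 0 := by
  refine IsLocalMin.deriv_eq_zero (Eventually.of_forall fun s => ?_)
  rw [Real.smoothTransition.zero_of_nonpos ht]
  exact Real.smoothTransition.nonneg s

/-- A test function whose conormal derivative has a favourable jump across `σ = 0` is a
subsolution up to a bounded error. -/
theorem integral_le_of_jump (hD : Geometry Ω S₁ a) {σ φ : Plane → ℝ} (hσ : ContDiff ℝ ∞ σ)
    (hφ : IsTest Ω φ)
    (hpos : ∀ y, 0 < φ y → (0 < σ y → pinning S₁ a y = max 1 a) ∧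
      (σ y ≤ 0 → pinning S₁ a y = min 1 a))
    (hjump : ∀ y, 0 < φ y → 0 < σ y → inner ℝ (gradient σ y) (gradient φ y) ≤ 0) :
    ∃ C, 0 ≤ C ∧ ∀ ψ Ψ, MemH10 Ω ψ Ψ → (∀ᵐ x ∂(volume.restrict Ω), 0 ≤ ψ x) →
      (∀ᵐ x ∂(volume.restrict Ω), φ x ≤ 0 → ψ x = 0 ∧ Ψ x = 0) →
      (∫ x in Ω, coef S₁ a x * inner ℝ (gradient φ x) (Ψ x)) ≤ C * ∫ x in Ω, ψ x := by
  obtain ⟨L, hL0, hL⟩ := exists_bound_lap hφ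
  set m := min 1 a with hm
  set M := max 1 a with hM
  have hmpos : 0 < m := lt_min one_pos hD.pos
  have hmM : m ≤ M := min_le_max
  -- Where `φ > 0` the coefficient is `1/m - d` times the indicator of `σ > 0`. The constant part is
  -- bounded above using `|Δφ| ≤ L`; the jump part enters with a minus sign and needs a lower bound
  -- on the integral over `σ > 0`.
  set d := 1 / m - 1 / M with hd
  have hd0 : 0 ≤ d := sub_nonneg.2 (one_div_le_one_div_of_le hmpos hmM)
  refine ⟨1 / m * L + d * L, by positivity, fun ψ Ψ hψ hψ0 hsupp => ?_⟩
  have hfin := hD.isFiniteMeasure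
  have hψi : Integrable ψ (volume.restrict Ω) := hψ.memLp.integrable (by norm_num)
  have hone : ∀ x : Plane, |(1 : ℝ)| ≤ 1 := fun _ => by simp
  have i1 : Integrable (fun x => (1 : ℝ) * inner ℝ (gradient φ x) (Ψ x)) (volume.restrict Ω) :=
    integrable_mul_inner measurable_const hone hφ.memLp_gradient hψ.grad_memLp
  have ilap : Integrable (fun x => lap φ x * ψ x) (volume.restrict Ω) :=
    MemLp.integrable_mul (memLp_restrict_of_continuous hD.bounded (contDiff_lap hφ.1).continuous)
      hψ.memLp
  -- the smooth part
  have b1 : ∫ x in Ω, (1 : ℝ) * inner ℝ (gradient φ x) (Ψ x) ≤ L * ∫ x in Ω, ψ x := by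
    have ibp := hψ.integral_by_parts_gradient hD.bounded hφ.1
    unfold form at ibp
    rw [integral_add i1 ilap] at ibp
    have : ∫ x in Ω, -L * ψ x ≤ ∫ x in Ω, lap φ x * ψ x := by
      refine integral_mono_ae (hψi.const_mul _) ilap ?_
      filter_upwards [hψ0] with x hx
      exact mul_le_mul_of_nonneg_right (abs_le.1 (hL x)).1 hx
    rw [integral_const_mul] at this
    linarith
  -- the smoothed jump part
  set θ : ℕ → Plane → ℝ := fun n y => Real.smoothTransition (((n : ℝ) + 1) * σ y) with hθdef
  have hθ : ∀ n, ContDiff ℝ ∞ (θ n) := fun n =>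
    Real.smoothTransition.contDiff.comp (contDiff_const.mul hσ)
  have hθ0 : ∀ n y, 0 ≤ θ n y := fun n y => Real.smoothTransition.nonneg _
  have hθ1 : ∀ n y, θ n y ≤ 1 := fun n y => Real.smoothTransition.le_one _
  have hgθ : ∀ n y, gradient (θ n) y = deriv Real.smoothTransition (((n : ℝ) + 1) * σ y) •
      (((n : ℝ) + 1) • gradient σ y) := fun n y => by
    have h1 := hσ.differentiable (by simp) y
    rw [hθdef, gradient_comp_real (f := fun y => ((n : ℝ) + 1) * σ y)
      ((Real.smoothTransition.contDiff (n := 1)).differentiable (by simp) _)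
      (h1.const_mul _), gradient_fun_const_mul _ h1]
  have iθ : ∀ n, Integrable (fun x => (1 : ℝ) * inner ℝ (θ n x • gradient φ x) (Ψ x))
      (volume.restrict Ω) := fun n =>
    integrable_mul_inner measurable_const hone (memLp_restrict_of_continuous hD.bounded
      ((hθ n).continuous.smul (continuous_gradient hφ.1))) hψ.grad_memLp
  have b2 : ∀ n, -(L * ∫ x in Ω, ψ x)
      ≤ ∫ x in Ω, (1 : ℝ) * inner ℝ (θ n x • gradient φ x) (Ψ x) := by
    intro n
    have hcont : Continuous fun x => θ n x * lap φ x + inner ℝ (gradient (θ n) x) (gradient φ x) :=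
      ((hθ n).continuous.mul (contDiff_lap hφ.1).continuous).add
        ((continuous_gradient (hθ n)).inner (continuous_gradient hφ.1))
    have i2 : Integrable (fun x => (θ n x * lap φ x + inner ℝ (gradient (θ n) x) (gradient φ x))
        * ψ x) (volume.restrict Ω) :=
      MemLp.integrable_mul (memLp_restrict_of_continuous hD.bounded hcont) hψ.memLp
    have ibp := hψ.integral_by_parts_weighted hD.bounded hφ.1 (hθ n)
    unfold form at ibp
    rw [integral_add (iθ n) i2] at ibp
    have : ∫ x in Ω, (θ n x * lap φ x + inner ℝ (gradient (θ n) x) (gradient φ x)) * ψ x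
        ≤ ∫ x in Ω, L * ψ x := by
      refine integral_mono_ae i2 (hψi.const_mul _) ?_
      filter_upwards [hψ0, hsupp] with x hx hs
      rcases le_or_gt (φ x) 0 with h' | h'
      · simp [(hs h').1]
      · refine mul_le_mul_of_nonneg_right ?_ hx
        have e1 : θ n x * lap φ x ≤ L := by
          calc θ n x * lap φ x ≤ θ n x * |lap φ x| :=
                mul_le_mul_of_nonneg_left (le_abs_self _) (hθ0 n x)
            _ ≤ 1 * L := mul_le_mul (hθ1 n x) (hL x) (abs_nonneg _) zero_le_one
            _ = L := one_mul _
        -- The only place where the jump hypothesis enters: `∇θₙ` is a nonnegative multiple of `∇σ`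
        -- and vanishes where `σ ≤ 0`. This makes the bound uniform in `n`, although `∇θₙ` blows up.
        have e2 : inner ℝ (gradient (θ n) x) (gradient φ x) ≤ 0 := by
          rw [hgθ, inner_smul_left, inner_smul_left]
          simp only [conj_trivial]
          rcases le_or_gt (σ x) 0 with hσx | hσx
          · rw [deriv_smoothTransition_of_nonpos
              (mul_nonpos_of_nonneg_of_nonpos (by positivity) hσx), zero_mul]
          · have h3 : 0 ≤ deriv Real.smoothTransition (((n : ℝ) + 1) * σ x) :=
              Real.smoothTransition.monotone.deriv_nonneg
            exact mul_nonpos_of_nonneg_of_nonpos h3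
              (mul_nonpos_of_nonneg_of_nonpos (by positivity) (hjump x h' hσx))
        linarith
    rw [integral_const_mul] at this
    linarith
  have lim : Tendsto (fun n => ∫ x in Ω, (1 : ℝ) * inner ℝ (θ n x • gradient φ x) (Ψ x)) atTop
      (𝓝 (∫ x in Ω, if 0 < σ x then (1 : ℝ) * inner ℝ (gradient φ x) (Ψ x) else 0)) := by
    refine tendsto_integral_of_dominated_convergence
      (fun x => ‖(1 : ℝ) * inner ℝ (gradient φ x) (Ψ x)‖) (fun n => (iθ n).1) i1.norm
      (fun n => ae_of_all _ fun x => ?_) (ae_of_all _ fun x => ?_)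
    · rw [inner_smul_left, one_mul, one_mul, norm_mul]
      simp only [conj_trivial]
      rw [Real.norm_of_nonneg (hθ0 n x)]
      exact mul_le_of_le_one_left (norm_nonneg _) (hθ1 n x)
    · by_cases hσx : 0 < σ x
      · simp only [if_pos hσx]
        refine tendsto_const_nhds.congr' ?_
        obtain ⟨n₀, hn₀⟩ := exists_nat_gt (1 / σ x)
        filter_upwards [eventually_ge_atTop n₀] with n hn
        have h1 : 1 ≤ ((n : ℝ) + 1) * σ x := by
          have : (n₀ : ℝ) ≤ n := by exact_mod_cast hn
          have := (div_le_iff₀ hσx).1 (by linarith : 1 / σ x ≤ (n : ℝ) + 1)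
          exact this
        have : θ n x = 1 := Real.smoothTransition.one_of_one_le h1
        rw [this, one_smul]
      · simp only [if_neg hσx]
        refine tendsto_const_nhds.congr fun n => ?_
        have : θ n x = 0 := Real.smoothTransition.zero_of_nonpos
          (mul_nonpos_of_nonneg_of_nonpos (by positivity) (not_lt.1 hσx))
        rw [this, zero_smul, inner_zero_left, mul_zero]
  have b3 := ge_of_tendsto lim (Eventually.of_forall b2)
  have i3 : Integrable (fun x => if 0 < σ x then (1 : ℝ) * inner ℝ (gradient φ x) (Ψ x) else 0)
      (volume.restrict Ω) := by
    have hms : MeasurableSet {x | 0 < σ x} :=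
      (isOpen_lt continuous_const hσ.continuous).measurableSet
    exact (i1.indicator hms).congr (ae_of_all _ fun x => by
      by_cases hσx : 0 < σ x <;> simp [hσx])
  have e : ∫ x in Ω, coef S₁ a x * inner ℝ (gradient φ x) (Ψ x)
      = 1 / m * (∫ x in Ω, (1 : ℝ) * inner ℝ (gradient φ x) (Ψ x))
        - d * ∫ x in Ω, if 0 < σ x then (1 : ℝ) * inner ℝ (gradient φ x) (Ψ x) else 0 := by
    rw [← integral_const_mul, ← integral_const_mul,
      ← integral_sub (i1.const_mul _) (i3.const_mul _)]
    refine integral_congr_ae ?_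
    filter_upwards [hsupp] with x hs
    rcases le_or_gt (φ x) 0 with h' | h'
    · simp [(hs h').2]
    · by_cases hσx : 0 < σ x
      · rw [coef, (hpos x h').1 hσx, if_pos hσx, hd]
        ring
      · rw [coef, (hpos x h').2 (not_lt.1 hσx), if_neg hσx]
        ring
  rw [e]
  have := mul_le_mul_of_nonneg_left b1 (one_div_pos.2 hmpos).le
  have := mul_le_mul_of_nonneg_left b3 hd0
  linarith

theorem gradient_fun_mul {f g : Plane → ℝ} {x : Plane} (hf : DifferentiableAt ℝ f x)
    (hg : DifferentiableAt ℝ g x) :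
    gradient (fun y => f y * g y) x = f x • gradient g x + g x • gradient f x := by
  simp only [gradient, fderiv_fun_mul hf hg, map_add, map_smul]

/-- Multiply `v` by a bump equal to `1` on the ball of radius `R / 2`. Outside that ball `v ≤ 0`, so
wherever the product is positive it coincides with `v` nearby, and the jump condition carries over.
-/
theorem exists_touching_of_local (hD : Geometry Ω S₁ a) {x₀ : Plane} {σ v : Plane → ℝ}
    (hσ : ContDiff ℝ ∞ σ) (hv : ContDiff ℝ ∞ v) {R : ℝ} (hR : 0 < R)
    (hRΩ : Metric.closedBall x₀ R ⊆ Ω)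
    (hpin : ∀ y ∈ Metric.ball x₀ R, (0 < σ y → pinning S₁ a y = max 1 a) ∧
      (σ y ≤ 0 → pinning S₁ a y = min 1 a))
    (hv₀ : v x₀ = pinning S₁ a x₀) (hvp : ∀ y ∈ Metric.ball x₀ R, v y ≤ pinning S₁ a y)
    (hv0 : ∀ y ∈ Metric.ball x₀ R, R / 2 ≤ ‖y - x₀‖ → v y ≤ 0)
    (hjump : ∀ y ∈ Metric.ball x₀ R, 0 < σ y → inner ℝ (gradient σ y) (gradient v y) ≤ 0) :
    ∃ φ : Plane → ℝ, IsTest Ω φ ∧ φ x₀ = pinning S₁ a x₀ ∧ (∀ y, φ y ≤ pinning S₁ a y) ∧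
      ∃ C, 0 ≤ C ∧ ∀ ψ Ψ, MemH10 Ω ψ Ψ → (∀ᵐ x ∂(volume.restrict Ω), 0 ≤ ψ x) →
      (∀ᵐ x ∂(volume.restrict Ω), φ x ≤ 0 → ψ x = 0 ∧ Ψ x = 0) →
      (∫ x in Ω, coef S₁ a x * inner ℝ (gradient φ x) (Ψ x)) ≤ C * ∫ x in Ω, ψ x := by
  let χ : ContDiffBump x₀ := ⟨R / 2, R, by linarith, by linarith⟩
  have hts : tsupport χ ⊆ Ω := by
    rw [χ.tsupport_eq]
    exact hRΩ
  have hφ : IsTest Ω fun y => χ y * v y :=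
    ⟨χ.contDiff.mul hv, χ.hasCompactSupport.mul_right, (tsupport_mul_subset_left).trans hts⟩
  have hball : ∀ y, 0 < χ y * v y → y ∈ Metric.ball x₀ R ∧ y ∈ Metric.ball x₀ (R / 2) := by
    intro y hy
    have h1 : y ∈ Metric.ball x₀ R := by
      by_contra h'
      rw [Metric.mem_ball, not_lt] at h'
      rw [χ.zero_of_le_dist h', zero_mul] at hy
      exact hy.false
    refine ⟨h1, ?_⟩
    rw [Metric.mem_ball, dist_eq_norm]
    by_contra h'
    exact (mul_nonpos_of_nonneg_of_nonpos χ.nonneg (hv0 y h1 (not_lt.1 h'))).not_gt hy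
  refine ⟨fun y => χ y * v y, hφ, ?_, fun y => ?_, integral_le_of_jump hD hσ hφ
    (fun y hy => hpin y (hball y hy).1) fun y hy hσy => ?_⟩
  · beta_reduce
    rw [χ.one_of_mem_closedBall (Metric.mem_closedBall_self (by change 0 ≤ R / 2; linarith)),
      one_mul, hv₀]
  · beta_reduce
    have hp := (pinning_pos (S₁ := S₁) hD.pos y).le
    by_cases hy : y ∈ Metric.ball x₀ R
    · rcases le_total (v y) 0 with h | h
      · exact (mul_nonpos_of_nonneg_of_nonpos χ.nonneg h).trans hp
      · exact (mul_le_of_le_one_left h χ.le_one).trans (hvp y hy)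
    · rw [Metric.mem_ball, not_lt] at hy
      rw [χ.zero_of_le_dist hy, zero_mul]
      exact hp
  · have he : (fun y => χ y * v y) =ᶠ[𝓝 y] v := by
      filter_upwards [χ.eventuallyEq_one_of_mem_ball (hball y hy).2] with z hz
      rw [hz, Pi.one_apply, one_mul]
    rw [he.gradient_eq]
    exact hjump y (hball y hy).1 hσy

/-- At every point of `Ω` there is a subsolution that touches `p` there. -/
theorem exists_touching (hD : Geometry Ω S₁ a) {x₀ : Plane} (hx₀ : x₀ ∈ Ω) :
    ∃ φ : Plane → ℝ, IsTest Ω φ ∧ φ x₀ = pinning S₁ a x₀ ∧ (∀ y, φ y ≤ pinning S₁ a y) ∧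
      ∃ C, 0 ≤ C ∧ ∀ ψ Ψ, MemH10 Ω ψ Ψ → (∀ᵐ x ∂(volume.restrict Ω), 0 ≤ ψ x) →
      (∀ᵐ x ∂(volume.restrict Ω), φ x ≤ 0 → ψ x = 0 ∧ Ψ x = 0) →
      (∫ x in Ω, coef S₁ a x * inner ℝ (gradient φ x) (Ψ x)) ≤ C * ∫ x in Ω, ψ x := by
  set m := pinning S₁ a x₀ with hm
  have hm0 : 0 < m := pinning_pos hD.pos x₀
  -- A common normal form for the three positions of `x₀`. Off the interface, `σ` is a constant of
  -- the right sign and `κ = L = 0`. On it, `L` is the Taylor constant and `κ` is chosen so that `κ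
  -- |∇σ|² ≥ 3L` near `x₀`.
  obtain ⟨σ, κ, L, g, hσ, hκ0, hL0, hκL, hσ0, hev⟩ : ∃ (σ : Plane → ℝ) (κ L g : ℝ),
      ContDiff ℝ ∞ σ ∧ 0 ≤ κ ∧ 0 ≤ L ∧ κ * g = 3 * L ∧ κ * σ x₀ = 0 ∧ ∀ᶠ y in 𝓝 x₀,
        ((0 < σ y → pinning S₁ a y = max 1 a) ∧ (σ y ≤ 0 → pinning S₁ a y = min 1 a)) ∧
        (0 < σ y → -(L * ‖y - x₀‖ ^ 2) ≤ inner ℝ (gradient σ y) (y - x₀)) ∧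
        g ≤ ‖gradient σ y‖ ^ 2 := by
    rcases mem_or_notMem_or_frontier hD.isOpen_sub x₀ with hx | hx | hx
    · obtain ⟨s, h1, h2⟩ : ∃ s : ℝ, (0 < s → (1 : ℝ) = max 1 a) ∧ (s ≤ 0 → (1 : ℝ) = min 1 a) := by
        rcases le_total a 1 with h | h
        · exact ⟨1, fun _ => (max_eq_left h).symm, fun h' => absurd h' (by norm_num)⟩
        · exact ⟨-1, fun h' => absurd h' (by norm_num), fun _ => (min_eq_left h).symm⟩
      refine ⟨fun _ => s, 0, 0, 0, contDiff_const, le_rfl, le_rfl, by simp, by simp, ?_⟩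
      filter_upwards [hD.isOpen_sub.mem_nhds hx] with y hy
      rw [pinning_of_mem hy]
      exact ⟨⟨h1, h2⟩, by simp [gradient_fun_const], by positivity⟩
    · obtain ⟨s, h1, h2⟩ : ∃ s : ℝ, (0 < s → a = max 1 a) ∧ (s ≤ 0 → a = min 1 a) := by
        rcases le_total a 1 with h | h
        · exact ⟨-1, fun h' => absurd h' (by norm_num), fun _ => (min_eq_right h).symm⟩
        · exact ⟨1, fun _ => (max_eq_right h).symm, fun h' => absurd h' (by norm_num)⟩
      refine ⟨fun _ => s, 0, 0, 0, contDiff_const, le_rfl, le_rfl, by simp, by simp, ?_⟩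
      filter_upwards [isClosed_closure.isOpen_compl.mem_nhds hx] with y hy
      rw [pinning_of_notMem_closure hy]
      exact ⟨⟨h1, h2⟩, by simp [gradient_fun_const], by positivity⟩
    · obtain ⟨σ, hσ, h0, hd, hev⟩ :=
        exists_interface_function (a := a) hD.isOpen_sub hD.smooth_sub hx
      obtain ⟨L, r, hL, hr, hT⟩ := exists_taylor_bound hσ h0
      have hg0 : gradient σ x₀ ≠ 0 := fun h' => hd (by simpa [gradient] using h')
      have hg : 0 < ‖gradient σ x₀‖ ^ 2 := by positivity
      refine ⟨σ, 3 * L / (‖gradient σ x₀‖ ^ 2 / 2), L, ‖gradient σ x₀‖ ^ 2 / 2, hσ,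
        by positivity, hL, by field_simp, by simp [h0], ?_⟩
      have hgc : ContinuousAt (fun y => ‖gradient σ y‖ ^ 2) x₀ :=
        ((continuous_gradient hσ).norm.pow 2).continuousAt
      filter_upwards [hev, Metric.ball_mem_nhds x₀ hr, hgc.eventually (lt_mem_nhds
        (by linarith : ‖gradient σ x₀‖ ^ 2 / 2 < ‖gradient σ x₀‖ ^ 2))] with y h1 h2 h3
      exact ⟨h1, fun h4 => by linarith [hT y h2], h3.le⟩
  have hp := eventually_pinning_le (a := a) hD.isOpen_sub x₀
  have hc : ∀ᶠ y in 𝓝 x₀, |κ * σ y| < 1 / 2 := by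
    have hcont : Continuous fun y => |κ * σ y| := (continuous_const.mul hσ.continuous).abs
    refine hcont.continuousAt.eventually (gt_mem_nhds ?_)
    beta_reduce
    rw [hσ0]
    norm_num
  obtain ⟨ε, hε, hball⟩ := Metric.eventually_nhds_iff_ball.1
    (((hev.and hp).and hc).and (hD.isOpen.mem_nhds hx₀))
  set R := ε / 2 with hR
  have hR0 : 0 < R := by positivity
  have hsub : ∀ y ∈ Metric.ball x₀ R, y ∈ Metric.ball x₀ ε := fun y hy =>
    Metric.ball_subset_ball (by linarith) hy
  -- The touching function is `v = m - c |y - x₀|² (1 + κσ)`. Since `1 + κσ ≥ 1/2`, this `c` makes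
  -- `v ≤ 0` from distance `R / 2` on.
  set c := 8 * m / R ^ 2 with hc
  have hc0 : 0 ≤ c := by positivity
  have hin : ContDiff ℝ ∞ fun y => ‖y - x₀‖ ^ 2 * (1 + κ * σ y) :=
    (contDiff_normSq x₀).mul (contDiff_const.add (contDiff_const.mul hσ))
  have hbd : ∀ y ∈ Metric.ball x₀ R, 1 / 2 ≤ 1 + κ * σ y ∧ 1 + κ * σ y ≤ 3 / 2 := by
    intro y hy
    have := abs_lt.1 (hball y (hsub y hy)).1.2
    constructor <;> linarith
  refine exists_touching_of_local hD (v := fun y => m - c * (‖y - x₀‖ ^ 2 * (1 + κ * σ y))) hσ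
    (contDiff_const.sub (contDiff_const.mul hin)) hR0
    (fun y hy => (hball y (Metric.closedBall_subset_ball (by linarith) hy)).2)
    (fun y hy => (hball y (hsub y hy)).1.1.1.1) (by simp [hm]) (fun y hy => ?_)
    (fun y hy hyR => ?_) (fun y hy hσy => ?_)
  · have h1 := (hball y (hsub y hy)).1.1.2
    have h2 : 0 ≤ c * (‖y - x₀‖ ^ 2 * (1 + κ * σ y)) :=
      mul_nonneg hc0 (mul_nonneg (sq_nonneg _) (by linarith [(hbd y hy).1]))
    linarith
  · have h1 : (R / 2) ^ 2 ≤ ‖y - x₀‖ ^ 2 := by gcongr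
    have h2 : (R / 2) ^ 2 * (1 / 2) ≤ ‖y - x₀‖ ^ 2 * (1 + κ * σ y) :=
      mul_le_mul h1 (hbd y hy).1 (by norm_num) (by positivity)
    have h3 := mul_le_mul_of_nonneg_left h2 hc0
    have h4 : c * ((R / 2) ^ 2 * (1 / 2)) = m := by
      rw [hc]
      field_simp
      norm_num
    linarith
  · obtain ⟨⟨⟨-, h1, h2⟩, -⟩, -⟩ := (hball y (hsub y hy)).1
    obtain ⟨b1, b2⟩ := hbd y hy
    have hd := hσ.differentiable (by simp) y
    have hd1 : DifferentiableAt ℝ (fun z => 1 + κ * σ z) y := (hd.const_mul κ).const_add 1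
    have hdn : DifferentiableAt ℝ (fun z : Plane => ‖z - x₀‖ ^ 2) y :=
      (contDiff_normSq x₀).differentiable (by simp) y
    have hdm : DifferentiableAt ℝ (fun z => ‖z - x₀‖ ^ 2 * (1 + κ * σ z)) y := hdn.mul hd1
    have e1 : gradient (fun z => 1 + κ * σ z) y = κ • gradient σ y := by
      rw [gradient_fun_add (differentiableAt_const _) (hd.const_mul κ),
        gradient_fun_const_mul _ hd, gradient_fun_const, zero_add]
    have e : gradient (fun z => m - c * (‖z - x₀‖ ^ 2 * (1 + κ * σ z))) y
        = -(c • (‖y - x₀‖ ^ 2 • κ • gradient σ y + (1 + κ * σ y) • (2 : ℝ) • (y - x₀))) := by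
      rw [gradient_fun_sub (differentiableAt_const _) (hdm.const_mul c),
        gradient_fun_const, gradient_fun_const_mul _ hdm, gradient_fun_mul hdn hd1, e1,
        gradient_normSq, zero_sub]
    rw [e, inner_neg_right, inner_smul_right, inner_add_right, inner_smul_right, inner_smul_right,
      inner_smul_right, inner_smul_right, real_inner_self_eq_norm_sq]
    -- A plain paraboloid may have a conormal jump of the wrong sign, by at most `2L |y - x₀|²`
    -- before the factor `1 + κσ ≤ 3/2`. The tilt `κσ` contributes `κ |∇σ|² |y - x₀|² ≥ 3L |y -
    -- x₀|²` and compensates exactly.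
    refine neg_nonpos.2 (mul_nonneg hc0 ?_)
    have h3 := h1 hσy
    have h4 : ‖y - x₀‖ ^ 2 * (3 * L) ≤ ‖y - x₀‖ ^ 2 * (κ * ‖gradient σ y‖ ^ 2) := by
      rw [← hκL]
      gcongr
    have h5 : (1 + κ * σ y) * (2 * -(L * ‖y - x₀‖ ^ 2))
        ≤ (1 + κ * σ y) * (2 * inner ℝ (gradient σ y) (y - x₀)) := by gcongr
    have h6 : (1 + κ * σ y) * (L * ‖y - x₀‖ ^ 2) ≤ 3 / 2 * (L * ‖y - x₀‖ ^ 2) := by gcongr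
    nlinarith

end LowerBarrier

/-! ### From almost everywhere bounds to values at points. -/

section Values

variable {Ω : Set Plane} {h h' z : Plane → ℝ} {x : Plane} {B c : ℝ}

theorem neBot_ae_inf_nhds (hΩ : IsOpen Ω) (hx : x ∈ closure Ω) :
    (ae (volume.restrict Ω) ⊓ 𝓝 x).NeBot := by
  rw [inf_neBot_iff]
  intro s hs t ht
  obtain ⟨u, hut, huo, hxu⟩ := mem_nhds_iff.1 ht
  by_contra hcon
  have hsub : u ∩ Ω ⊆ sᶜ ∩ Ω := fun y hy => ⟨fun hys => hcon ⟨y, hys, hut hy.1⟩, hy.2⟩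
  have h0 : volume (sᶜ ∩ Ω) = 0 := by
    have := mem_ae_iff.1 hs
    rwa [Measure.restrict_apply' hΩ.measurableSet] at this
  have h1 : volume (u ∩ Ω) = 0 := measure_mono_null hsub h0
  exact ((huo.inter hΩ).measure_pos volume (mem_closure_iff.1 hx u huo hxu)).ne' h1

theorem eventually_ae_inf_nhds_iff {ν : Measure Plane} {P : Plane → Prop} :
    (∀ᶠ y in ae ν ⊓ 𝓝 x, P y) ↔ ∃ N ∈ 𝓝 x, ∀ᵐ y ∂ν, y ∈ N → P y := by
  rw [eventually_inf]
  constructor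
  · rintro ⟨s, hs, N, hN, h⟩
    exact ⟨N, hN, mem_of_superset hs fun y hy hyN => h y ⟨hy, hyN⟩⟩
  · rintro ⟨N, hN, h⟩
    exact ⟨_, h, N, hN, fun y hy => hy.1 hy.2⟩

theorem isBoundedUnder_ge_of_abs_le (hB : ∀ᵐ y ∂(volume.restrict Ω), |1 - h y| ≤ B) :
    IsBoundedUnder (· ≥ ·) (ae (volume.restrict Ω) ⊓ 𝓝 x) h := by
  refine isBoundedUnder_of_eventually_ge (a := 1 - B) ?_
  filter_upwards [hB.filter_mono inf_le_left] with y hy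
  linarith [(abs_le.1 hy).2]

theorem one_sub_value_le (hΩ : IsOpen Ω) (hx : x ∈ closure Ω)
    (hB : ∀ᵐ y ∂(volume.restrict Ω), |1 - h y| ≤ B)
    (hc : ∀ ε > 0, ∃ N ∈ 𝓝 x, ∀ᵐ y ∂(volume.restrict Ω), y ∈ N → 1 - h y ≤ c + ε) :
    1 - value Ω h x ≤ c := by
  have hne := neBot_ae_inf_nhds hΩ hx
  refine le_of_forall_pos_le_add fun ε hε => ?_
  have hb : IsBoundedUnder (· ≤ ·) (ae (volume.restrict Ω) ⊓ 𝓝 x) h := by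
    refine isBoundedUnder_of_eventually_le (a := 1 + B) ?_
    filter_upwards [hB.filter_mono inf_le_left] with y hy
    linarith [(abs_le.1 hy).1]
  have h1 : 1 - c - ε ≤ value Ω h x := by
    refine le_liminf_of_le hb.isCoboundedUnder_ge ?_
    filter_upwards [eventually_ae_inf_nhds_iff.2 (hc ε hε)] with y hy
    linarith
  linarith

/-- Every neighbourhood of a point of `closure Ω` meets `Ω` in positive measure, so the continuous
minorant is seen by the essential limit. The bound `hB` keeps the real-valued lower limit from
taking a default value. -/
theorem le_one_sub_value (hΩ : IsOpen Ω) (hx : x ∈ closure Ω)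
    (hB : ∀ᵐ y ∂(volume.restrict Ω), |1 - h y| ≤ B) (hz : Continuous z)
    (hzh : ∀ᵐ y ∂(volume.restrict Ω), z y ≤ 1 - h y) : z x ≤ 1 - value Ω h x := by
  have hne := neBot_ae_inf_nhds hΩ hx
  have h1 : value Ω h x ≤ 1 - z x := by
    refine liminf_le_of_le (isBoundedUnder_ge_of_abs_le hB) fun b hb => ?_
    refine le_of_forall_pos_le_add fun ε hε => ?_
    have h2 : ∀ᶠ y in ae (volume.restrict Ω) ⊓ 𝓝 x, z x - ε < z y :=
      (hz.continuousAt.eventually (lt_mem_nhds (by linarith))).filter_mono inf_le_right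
    obtain ⟨y, h3, h4, h5⟩ := (hb.and (h2.and (hzh.filter_mono inf_le_left))).exists
    linarith
  linarith

theorem exists_nhds_le_of_one_sub_value_le
    (hB : ∀ᵐ y ∂(volume.restrict Ω), |1 - h y| ≤ B) (hc : 1 - value Ω h x ≤ c)
    {ε : ℝ} (hε : 0 < ε) :
    ∃ N ∈ 𝓝 x, ∀ᵐ y ∂(volume.restrict Ω), y ∈ N → 1 - h y ≤ c + ε := by
  rw [← eventually_ae_inf_nhds_iff]
  have h1 : 1 - c - ε < liminf h (ae (volume.restrict Ω) ⊓ 𝓝 x) := by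
    change _ < value Ω h x
    linarith
  filter_upwards [eventually_lt_of_lt_liminf h1 (isBoundedUnder_ge_of_abs_le hB)] with y hy
  linarith

theorem mul_one_sub_value_le (hΩ : IsOpen Ω) (hx : x ∈ closure Ω)
    (hB : ∀ᵐ y ∂(volume.restrict Ω), |1 - h y| ≤ B) {B' : ℝ}
    (hB' : ∀ᵐ y ∂(volume.restrict Ω), |1 - h' y| ≤ B') {s s' : ℝ} (hs : 0 < s) (hs' : 0 < s')
    (hle : ∀ᵐ y ∂(volume.restrict Ω), s * (1 - h y) ≤ s' * (1 - h' y)) :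
    s * (1 - value Ω h x) ≤ s' * (1 - value Ω h' x) := by
  have key : 1 - value Ω h x ≤ s' / s * (1 - value Ω h' x) := by
    refine one_sub_value_le hΩ hx hB fun ε hε => ?_
    obtain ⟨N, hN, h1⟩ := exists_nhds_le_of_one_sub_value_le (x := x) hB' le_rfl
      (show 0 < ε * s / s' by positivity)
    refine ⟨N, hN, ?_⟩
    filter_upwards [h1, hle] with y h1 h2 hy
    have h3 := mul_le_mul_of_nonneg_left (h1 hy) (div_pos hs' hs).le
    have h4 : 1 - h y ≤ s' / s * (1 - h' y) := by
      rw [div_mul_eq_mul_div, le_div_iff₀ hs]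
      linarith
    have h5 : s' / s * (1 - value Ω h' x + ε * s / s') = s' / s * (1 - value Ω h' x) + ε := by
      field_simp
    linarith
  rw [div_mul_eq_mul_div, le_div_iff₀ hs] at key
  linarith

theorem value_congr (hh : h =ᵐ[volume.restrict Ω] h') : value Ω h x = value Ω h' x :=
  liminf_congr (hh.filter_mono inf_le_left)

end Values

/-! ### Pointwise description of the coincidence set, and contact at a given point. -/

section Coincidence

variable {Ω S₁ : Set Plane} {a lam : ℝ} {h : Plane → ℝ} {U : Plane → Plane} {x : Plane}

theorem IsObstacleSolution.abs_le (hD : Geometry Ω S₁ a) (hlam : 0 < lam)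
    (hu : IsObstacleSolution Ω S₁ a lam (fun x => 1 - h x) U) :
    ∀ᵐ y ∂(volume.restrict Ω), |1 - h y| ≤ max 1 a / (2 * lam) := by
  filter_upwards [hu.le_obstacle, hu.nonneg hD hlam] with y h1 h2
  rw [abs_of_nonneg h2]
  exact h1.trans (div_le_div_of_nonneg_right (pinning_le_max y) (by linarith))

theorem IsObstacleSolution.one_sub_value_le (hD : Geometry Ω S₁ a) (hlam : 0 < lam)
    (hu : IsObstacleSolution Ω S₁ a lam (fun x => 1 - h x) U) (hx : x ∈ closure Ω) :
    1 - value Ω h x ≤ pinning S₁ a x / (2 * lam) :=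
  VortexObstacle.one_sub_value_le hD.isOpen hx (hu.abs_le hD hlam)
    fun _ hε => hu.locally_le hD hlam x hε

theorem IsObstacleSolution.one_sub_value_nonpos (hD : Geometry Ω S₁ a) (hlam : 0 < lam)
    (hu : IsObstacleSolution Ω S₁ a lam (fun x => 1 - h x) U) (hx : x ∈ frontier Ω) :
    1 - value Ω h x ≤ 0 :=
  VortexObstacle.one_sub_value_le hD.isOpen hx.1 (hu.abs_le hD hlam) fun ε hε => by
    simpa only [zero_add] using hu.locally_le_of_frontier hD hlam hx hε

theorem pinning_le_one_of_mem_closure (hS : IsOpen S₁) (hx : x ∈ closure S₁) :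
    pinning S₁ a x ≤ 1 := by
  rcases mem_or_notMem_or_frontier hS x with h | h | h
  · exact (pinning_of_mem h).le
  · exact absurd hx h
  · rw [pinning_of_mem_frontier hS h]
    exact min_le_left _ _

theorem pinning_le_of_mem_closure_outerRegion (hS : IsOpen S₁)
    (hx : x ∈ closure (outerRegion Ω S₁)) : pinning S₁ a x ≤ a := by
  rcases mem_or_notMem_or_frontier hS x with h | h | h
  · obtain ⟨y, h1, h2⟩ := mem_closure_iff.1 hx S₁ hS h
    exact absurd (subset_closure h1) h2.2
  · exact (pinning_of_notMem_closure h).le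
  · rw [pinning_of_mem_frontier hS h]
    exact min_le_right _ _

theorem Geometry.frontier_subset_closure_outerRegion (hD : Geometry Ω S₁ a) :
    frontier S₁ ⊆ closure (outerRegion Ω S₁) := by
  intro x hx
  obtain ⟨ρ, hρ, hd, hiff⟩ := hD.smooth_sub x hx
  have h0 := eq_zero_of_mem_frontier hD.isOpen_sub hx hρ.continuous hiff
  have hf : ∃ᶠ y in 𝓝 x, 0 < -ρ y := by
    refine frequently_pos (by rw [h0, neg_zero]) ?_
    rw [fderiv_fun_neg]
    exact neg_ne_zero.2 hd
  rw [mem_closure_iff_frequently]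
  refine (hf.and_eventually (hiff.eventually_nhds.and
    (hD.isOpen.mem_nhds (hD.closure_sub hx.1)))).mono fun y hy => ⟨hy.2.2, fun hc => ?_⟩
  have h1 : ∀ᶠ z in 𝓝 y, ρ z < 0 :=
    hρ.continuous.continuousAt.eventually (gt_mem_nhds (by linarith [hy.1]))
  obtain ⟨z, hz1, hz2, hz3⟩ := ((mem_closure_iff_frequently.1 hc).and_eventually
    (hy.2.1.and h1)).exists
  exact lt_asymm hz3 (hz2.1 hz1)

theorem Geometry.isOpen_outerRegion (hD : Geometry Ω S₁ a) : IsOpen (outerRegion Ω S₁) :=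
  hD.isOpen.sdiff isClosed_closure

theorem Geometry.nonempty_outerRegion (hD : Geometry Ω S₁ a) : (outerRegion Ω S₁).Nonempty := by
  have h : (frontier S₁).Nonempty := by
    refine nonempty_frontier_iff.2 ⟨hD.nonempty_sub, fun h => ?_⟩
    have h1 : Bornology.IsBounded (univ : Set Plane) :=
      hD.bounded.subset (h ▸ subset_closure.trans hD.closure_sub)
    exact NormedSpace.unbounded_univ ℝ Plane h1
  obtain ⟨x, hx⟩ := h
  exact closure_nonempty_iff.1 ⟨x, hD.frontier_subset_closure_outerRegion hx⟩

theorem closure_outerRegion_subset : closure (outerRegion Ω S₁) ⊆ closure Ω :=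
  closure_mono sdiff_subset

/-- The coincidence set is the set of points of `Ω` at which the obstacle is attained. -/
theorem IsObstacleSolution.mem_w_iff (hD : Geometry Ω S₁ a) (hlam : 0 < lam)
    (hu : IsObstacleSolution Ω S₁ a lam (fun x => 1 - h x) U) :
    x ∈ w Ω S₁ a lam h ↔ x ∈ Ω ∧ 1 - value Ω h x = pinning S₁ a x / (2 * lam) := by
  have hl : 0 < 2 * lam := by linarith
  constructor
  · rintro (⟨h1, h2⟩ | ⟨h1, h2⟩)
    -- On `closure S₁` the obstacle is at most `1/(2λ)`, so a point with value `1/(2λ)` attains both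
    -- bounds; on the interface with `a < 1` the contact equation therefore fails.
    · have hx := hD.closure_sub h1
      refine ⟨hx, le_antisymm (hu.one_sub_value_le hD hlam (subset_closure hx)) ?_⟩
      rw [div_one] at h2
      rw [h2]
      exact div_le_div_of_nonneg_right (pinning_le_one_of_mem_closure hD.isOpen_sub h1) hl.le
    · have hx := closure_outerRegion_subset h1
      have h3 : 1 - value Ω h x = a / (2 * lam) := by
        rw [div_eq_iff hD.pos.ne'] at h2
        rw [h2]
        ring
      refine ⟨?_, le_antisymm (hu.one_sub_value_le hD hlam hx) ?_⟩
      · by_contra hxΩ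
        have h4 := hu.one_sub_value_nonpos hD hlam ⟨hx, by rwa [hD.isOpen.interior_eq]⟩
        rw [h3] at h4
        exact h4.not_gt (div_pos hD.pos hl)
      · rw [h3]
        exact div_le_div_of_nonneg_right
          (pinning_le_of_mem_closure_outerRegion hD.isOpen_sub h1) hl.le
  · rintro ⟨hx, h1⟩
    have key1 : x ∈ closure S₁ → pinning S₁ a x = 1 → x ∈ w Ω S₁ a lam h := fun h2 h3 =>
      Or.inl ⟨h2, by rw [h1, h3, div_one]⟩
    have key2 : x ∈ closure (outerRegion Ω S₁) → pinning S₁ a x = a → x ∈ w Ω S₁ a lam h :=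
      fun h2 h3 => Or.inr ⟨h2, by rw [h1, h3, div_right_comm, div_self hD.pos.ne']⟩
    rcases mem_or_notMem_or_frontier hD.isOpen_sub x with h | h | h
    · exact key1 (subset_closure h) (pinning_of_mem h)
    · exact key2 (subset_closure ⟨hx, h⟩) (pinning_of_notMem_closure h)
    · have hp := pinning_of_mem_frontier (a := a) hD.isOpen_sub h
      -- The interface lies in both closures, and `p = min 1 a` there selects the region whose
      -- contact equation holds.
      rcases le_total a 1 with h' | h'
      · exact key2 (hD.frontier_subset_closure_outerRegion h) (hp.trans (min_eq_right h'))
      · exact key1 h.1 (hp.trans (min_eq_left h'))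

/-- For large `lam`, the solutions of the obstacle problem attain the obstacle at a given point. -/
theorem exists_one_sub_value_eq (hD : Geometry Ω S₁ a) (hx : x ∈ Ω) : ∃ lam : ℝ, 0 < lam ∧
    ∀ (h : Plane → ℝ) (U : Plane → Plane),
      IsObstacleSolution Ω S₁ a lam (fun x => 1 - h x) U →
        1 - value Ω h x = pinning S₁ a x / (2 * lam) := by
  obtain ⟨φ, hφ, hφx, hφp, C, hC0, hC⟩ := exists_touching hD hx
  have hM : 0 < max 1 a := lt_max_of_lt_left one_pos
  -- The function `φ` is a subsolution with source `C` from the second-order part plus `max 1 a`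
  -- from `φ ≤ p`; dividing by `2λ = C + max 1 a` normalizes the source to `1`.
  set lam := (C + max 1 a) / 2 with hlamdef
  have hlam : 0 < lam := by positivity
  have hl : 0 < 2 * lam := by linarith
  refine ⟨lam, hlam, fun h U hu => le_antisymm
    (hu.one_sub_value_le hD hlam (subset_closure hx)) ?_⟩
  have hz := hφ.memH10.const_mul (1 / (2 * lam))
  have hnn := hu.nonneg hD hlam
  have hd := hz.sub hu.mem
  have hψ := hd.posPart hD.bounded
  have key := hu.le_of_subsolution hD hz (ae_of_all _ fun y => by
    rw [one_div_mul_eq_div]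
    exact div_le_div_of_nonneg_right (hφp y) hl.le) (by
    rw [form_smul_left]
    set ψ : Plane → ℝ := fun x => max (1 / (2 * lam) * φ x - (1 - h x)) 0 with hψdef
    set Ψ : Plane → Plane := fun x => if 0 < 1 / (2 * lam) * φ x - (1 - h x) then
      (1 / (2 * lam)) • gradient φ x - U x else 0 with hΨdef
    have hψ0 : ∀ y, 0 ≤ ψ y := fun y => le_max_right _ _
    have h1 := hC ψ Ψ hψ (ae_of_all _ hψ0) (by
      filter_upwards [hnn] with y hy hφy
      have h2 : ¬ 0 < 1 / (2 * lam) * φ y - (1 - h y) := by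
        have := mul_nonpos_of_nonneg_of_nonpos (one_div_pos.2 hl).le hφy
        exact not_lt.2 (by linarith)
      exact ⟨max_eq_right (not_lt.1 h2), if_neg h2⟩)
    have hfin := hD.isFiniteMeasure
    have hψi : Integrable ψ (volume.restrict Ω) := hψ.memLp.integrable (by norm_num)
    have i1 : Integrable (fun y => φ y * ψ y) (volume.restrict Ω) :=
      MemLp.integrable_mul hφ.memLp hψ.memLp
    have h2 : ∫ y in Ω, φ y * ψ y ≤ ∫ y in Ω, max 1 a * ψ y :=
      integral_mono i1 (hψi.const_mul _) fun y =>
        mul_le_mul_of_nonneg_right ((hφp y).trans (pinning_le_max y)) (hψ0 y)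
    rw [integral_const_mul] at h2
    have h3 : form (volume.restrict Ω) (coef S₁ a) φ (gradient φ) ψ Ψ
        ≤ 2 * lam * ∫ y in Ω, ψ y := by
      unfold form
      rw [integral_add (integrable_mul_inner (measurable_coef (a := a) hD.isOpen_sub)
        (abs_coef_le (S₁ := S₁) hD.pos) hφ.memLp_gradient hψ.grad_memLp) i1]
      have : 2 * lam = C + max 1 a := by rw [hlamdef]; ring
      rw [this]
      linarith
    rw [one_div_mul_eq_div, div_le_iff₀ hl]
    linarith)
  have := le_one_sub_value (z := fun y => 1 / (2 * lam) * φ y) hD.isOpen (subset_closure hx)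
    (hu.abs_le hD hlam) (continuous_const.mul hφ.continuous) key
  rwa [hφx, one_div_mul_eq_div] at this

end Coincidence

/-! ### Critical constants and vanishing of the measure. -/

section Critical

variable {Ω S₁ S : Set Plane} {a lam c : ℝ} {h₀ : Plane → ℝ} {U : Plane → Plane}

theorem IsFreeSolution.abs_le (hD : Geometry Ω S₁ a)
    (hu : IsFreeSolution Ω S₁ a (fun x => 1 - h₀ x) U) :
    ∀ᵐ y ∂(volume.restrict Ω), |1 - h₀ y| ≤ 1 := by
  filter_upwards [hu.nonneg hD, hu.le_one hD] with y h1 h2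
  rwa [abs_of_nonneg h1]

theorem IsFreeSolution.bddAbove (hD : Geometry Ω S₁ a)
    (hu : IsFreeSolution Ω S₁ a (fun x => 1 - h₀ x) U) (hS : S ⊆ Ω) (hc : 0 < c) :
    BddAbove ((fun x => (1 - value Ω h₀ x) / c) '' closure S) := by
  refine ⟨1 / c, ?_⟩
  rintro _ ⟨x, hx, rfl⟩
  refine div_le_div_of_nonneg_right ?_ hc.le
  refine one_sub_value_le hD.isOpen (closure_mono hS hx) (hu.abs_le hD) fun ε hε => ?_
  refine ⟨univ, univ_mem, ?_⟩
  filter_upwards [hu.le_one hD] with y hy _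
  linarith

/-- Otherwise `u₀ ≤ 0` almost everywhere on the nonempty open set `S`, which `not_ae_nonpos`
excludes. Positivity is what makes the reciprocal in `critical` meaningful. -/
theorem IsFreeSolution.sSup_pos (hD : Geometry Ω S₁ a)
    (hu : IsFreeSolution Ω S₁ a (fun x => 1 - h₀ x) U) (hSo : IsOpen S) (hSn : S.Nonempty)
    (hS : S ⊆ Ω) (hc : 0 < c) :
    0 < sSup ((fun x => (1 - value Ω h₀ x) / c) '' closure S) := by
  by_contra hs
  refine hu.not_ae_nonpos hD hSo hSn hS (ae_le_of_locally continuous_const fun x hx ε hε => ?_)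
  refine exists_nhds_le_of_one_sub_value_le (hu.abs_le hD) ?_ hε
  have h1 := (le_csSup (hu.bddAbove hD hS hc)
    (mem_image_of_mem _ (subset_closure hx))).trans (not_lt.1 hs)
  have h2 := (div_le_iff₀ hc).1 h1
  linarith

theorem IsFreeSolution.le_critical_iff (hD : Geometry Ω S₁ a)
    (hu : IsFreeSolution Ω S₁ a (fun x => 1 - h₀ x) U) (hSo : IsOpen S) (hSn : S.Nonempty)
    (hS : S ⊆ Ω) (hc : 0 < c) (hlam : 0 < lam) :
    lam ≤ critical Ω S c h₀ ↔ ∀ x ∈ closure S, (1 - value Ω h₀ x) / c ≤ 1 / (2 * lam) := by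
  have hs := hu.sSup_pos hD hSo hSn hS hc
  have h1 : lam ≤ critical Ω S c h₀ ↔
      sSup ((fun x => (1 - value Ω h₀ x) / c) '' closure S) ≤ 1 / (2 * lam) := by
    rw [critical, le_div_iff₀ (by linarith), le_div_iff₀ (by linarith)]
    constructor <;> intro h <;> linarith
  rw [h1, csSup_le_iff (hu.bddAbove hD hS hc) (hSn.closure.image _), forall_mem_image]

/-- The strict inequality comes from an intermediate constant between `lam` and the critical one, so
attainment of the supremum is not needed. -/
theorem IsFreeSolution.lt_of_lt_critical (hD : Geometry Ω S₁ a)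
    (hu : IsFreeSolution Ω S₁ a (fun x => 1 - h₀ x) U) (hSo : IsOpen S) (hSn : S.Nonempty)
    (hS : S ⊆ Ω) (hc : 0 < c) (hlam : 0 < lam) (h : lam < critical Ω S c h₀) {x : Plane}
    (hx : x ∈ closure S) : (1 - value Ω h₀ x) / c < 1 / (2 * lam) := by
  obtain ⟨s, hs1, hs2⟩ := exists_between h
  refine ((hu.le_critical_iff hD hSo hSn hS hc (hlam.trans hs1)).1 hs2.le x hx).trans_lt ?_
  exact one_div_lt_one_div_of_lt (by linarith) (by linarith)

/-- Below the critical value of one region, there is no contact in this region. -/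
theorem IsObstacleSolution.contactSet_eq_empty (hD : Geometry Ω S₁ a)
    (hu₀ : IsFreeSolution Ω S₁ a (fun x => 1 - h₀ x) U) (hSo : IsOpen S) (hSn : S.Nonempty)
    (hS : S ⊆ Ω) (hc : 0 < c) (hlam : 0 < lam) (hlt : lam < critical Ω S c h₀)
    {h : Plane → ℝ} {V : Plane → Plane}
    (hu : IsObstacleSolution Ω S₁ a lam (fun x => 1 - h x) V) : contactSet Ω S c lam h = ∅ := by
  refine eq_empty_of_forall_notMem fun x hx => ?_
  have h1 := hu₀.lt_of_lt_critical hD hSo hSn hS hc hlam hlt hx.1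
  rw [← hx.2] at h1
  refine h1.not_ge (div_le_div_of_nonneg_right ?_ hc.le)
  have := mul_one_sub_value_le hD.isOpen (closure_mono hS hx.1) (hu.abs_le hD hlam)
    (hu₀.abs_le hD) one_pos one_pos (by
      filter_upwards [hu.le_free hD hu₀] with y hy
      rwa [one_mul, one_mul])
  rwa [one_mul, one_mul] at this

theorem IsFreeSolution.ae_le_obstacle (hD : Geometry Ω S₁ a)
    (hu : IsFreeSolution Ω S₁ a (fun x => 1 - h₀ x) U) (hlam : 0 < lam)
    (h1 : ∀ x ∈ closure S₁, (1 - value Ω h₀ x) / 1 ≤ 1 / (2 * lam))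
    (h2 : ∀ x ∈ closure (outerRegion Ω S₁), (1 - value Ω h₀ x) / a ≤ 1 / (2 * lam)) :
    ∀ᵐ x ∂(volume.restrict Ω), 1 - h₀ x ≤ pinning S₁ a x / (2 * lam) := by
  have h2' : ∀ x ∈ closure (outerRegion Ω S₁), 1 - value Ω h₀ x ≤ a / (2 * lam) := by
    intro x hx
    have := (div_le_iff₀ hD.pos).1 (h2 x hx)
    rwa [one_div_mul_eq_div] at this
  simp only [div_one] at h1
  have key : ∀ (T : Set Plane) (q : ℝ), (∀ x ∈ T, 1 - value Ω h₀ x ≤ q) →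
      ∀ᵐ x ∂(volume.restrict Ω), x ∈ T → 1 - h₀ x ≤ q := fun T q hT =>
    ae_le_of_locally continuous_const fun x hx ε hε =>
      exists_nhds_le_of_one_sub_value_le (hu.abs_le hD) (hT x hx) hε
  filter_upwards [key _ _ h1, key _ _ h2', ae_restrict_mem hD.isOpen.measurableSet]
    with x k1 k2 hx
  rcases mem_or_notMem_or_frontier hD.isOpen_sub x with h | h | h
  · rw [pinning_of_mem h]
    exact k1 (subset_closure h)
  · rw [pinning_of_notMem_closure h]
    exact k2 (subset_closure ⟨hx, h⟩)
  · rw [pinning_of_mem_frontier hD.isOpen_sub h, ← min_div_div_right (by linarith)]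
    exact le_min (k1 h.1) (k2 (hD.frontier_subset_closure_outerRegion h))

/-- A signed measure carried by an open set is determined by its integrals of test functions. -/
theorem eq_zero_of_signedIntegral_eq_zero (hΩ : IsOpen Ω) {μ : SignedMeasure Plane}
    (hμ : μ.totalVariation Ωᶜ = 0) (h : ∀ φ, IsTest Ω φ → signedIntegral μ φ = 0) : μ = 0 := by
  obtain ⟨S, hS, hP, hN⟩ := μ.toJordanDecomposition.mutuallySingular
  set P := μ.toJordanDecomposition.posPart with hPdef
  set N := μ.toJordanDecomposition.negPart with hNdef
  have hPS : ∀ᵐ x ∂P, x ∉ S := measure_eq_zero_iff_ae_notMem.1 hP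
  have hNS : ∀ᵐ x ∂N, x ∉ Sᶜ := measure_eq_zero_iff_ae_notMem.1 hN
  -- `f` is the polar density of `μ` with respect to `|μ| = P + N`: it is `1` on `Sᶜ`, which carries
  -- `P`, and `-1` on `S`, which carries `N`. As `|f| = 1`, its vanishing almost everywhere on `Ω`
  -- means `|μ|(Ω) = 0`.
  let f : Plane → ℝ := fun x => S.indicator (fun _ => -1) x + Sᶜ.indicator (fun _ => 1) x
  have hfm : Measurable f :=
    (measurable_const.indicator hS).add (measurable_const.indicator hS.compl)
  have hf : ∀ x, |f x| = 1 := by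
    intro x
    by_cases hx : x ∈ S <;> simp [f, hx]
  have hfi : Integrable f (P + N) :=
    Integrable.of_bound hfm.aestronglyMeasurable 1 (ae_of_all _ fun x => (hf x).le)
  have key := hΩ.ae_eq_zero_of_integral_contDiff_smul_eq_zero (f := f) (μ := P + N)
    (hfi.locallyIntegrable.locallyIntegrableOn Ω) fun g hg hgc hgs => by
      have hgi : ∀ m : Measure Plane, IsFiniteMeasure m → Integrable (fun x => g x • f x) m := by
        intro m _
        exact (hg.continuous.integrable_of_hasCompactSupport hgc).mul_bdd (c := 1)
          hfm.aestronglyMeasurable (ae_of_all _ fun x => (hf x).le)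
      rw [integral_add_measure (hgi _ inferInstance) (hgi _ inferInstance)]
      have e1 : ∫ x, g x • f x ∂P = ∫ x, g x ∂P := by
        refine integral_congr_ae ?_
        filter_upwards [hPS] with x hx
        simp [f, hx]
      have e2 : ∫ x, g x • f x ∂N = -∫ x, g x ∂N := by
        rw [← integral_neg]
        refine integral_congr_ae ?_
        filter_upwards [hNS] with x hx
        simp [f, not_not.1 hx]
      rw [e1, e2, ← sub_eq_add_neg]
      exact h g ⟨hg, hgc, hgs⟩
  have h1 : (P + N) Ω = 0 := by
    rw [measure_eq_zero_iff_ae_notMem]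
    filter_upwards [key] with x hx hxΩ
    have := hf x
    rw [hx hxΩ] at this
    norm_num at this
  have h2 : μ.totalVariation univ = 0 := by
    rw [← union_compl_self Ω]
    exact measure_union_null h1 hμ
  ext s hs
  exact μ.null_of_totalVariation_zero (measure_mono_null (subset_univ s) h2)

theorem signedIntegral_eq_of_ae_eq (hD : Geometry Ω S₁ a) {μ ν : SignedMeasure Plane}
    {h k : Plane → ℝ} {G K : Plane → Plane} (hp : IsPotential Ω S₁ a μ h G)
    (hq : IsPotential Ω S₁ a ν k K) (hhk : h =ᵐ[volume.restrict Ω] k) {φ : Plane → ℝ}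
    (hφ : IsTest Ω φ) : signedIntegral μ φ = signedIntegral ν φ := by
  have hG := hp.boundary.grad_ae_eq hD.isOpen hD.bounded hq.boundary
    (hhk.mono fun x hx => by simp only [hx])
  rw [← hp.weak_eq φ hφ, ← hq.weak_eq φ hφ]
  refine integral_congr_ae ?_
  filter_upwards [hG, hhk] with x h1 h2
  rw [h1, h2]

end Critical

end VortexObstacle

end

/-! ### Assembly of the six claims. -/

theorem mainTheorem4
    (Ω S₁ : Set VortexObstacle.Plane)
    (hΩ_open : IsOpen Ω) (hΩ_bounded : Bornology.IsBounded Ω)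
    (hΩ_smooth : VortexObstacle.HasSmoothBoundary Ω)
    (hS_open : IsOpen S₁) (hS_nonempty : S₁.Nonempty)
    (hS_smooth : VortexObstacle.HasSmoothBoundary S₁)
    (hS_sub : closure S₁ ⊆ Ω)
    (a : ℝ) (ha_pos : 0 < a) (ha_ne : a ≠ 1)
    -- the solution `h₀` of `-div (p⁻¹ ∇h₀) + h₀ = 0` in `Ω`, `h₀ = 1` on `∂Ω`
    (h₀ : VortexObstacle.Plane → ℝ) (G₀ : VortexObstacle.Plane → VortexObstacle.Plane)
    (hh₀ : VortexObstacle.IsPotential Ω S₁ a 0 h₀ G₀)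
    -- for each `λ > 0`, the minimizer `μ_*` of `E_λ` and its potential `h_*`
    (μ : ℝ → MeasureTheory.SignedMeasure VortexObstacle.Plane)
    (h : ℝ → VortexObstacle.Plane → ℝ)
    (hμ : ∀ lam : ℝ, 0 < lam → VortexObstacle.IsEnergyMinimizer Ω S₁ a lam (μ lam) (h lam)) :
    -- `w_λ` increases with `λ`, and exhausts `Ω`
    ((∀ lam lam' : ℝ, 0 < lam → lam ≤ lam' →
        VortexObstacle.w Ω S₁ a lam (h lam) ⊆ VortexObstacle.w Ω S₁ a lam' (h lam')) ∧
      (⋃ lam ∈ Set.Ioi (0 : ℝ), VortexObstacle.w Ω S₁ a lam (h lam)) = Ω) ∧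
    -- `w_λ¹` and `w_λ²` are disjoint
    (∀ lam : ℝ, 0 < lam →
      Disjoint (VortexObstacle.w1 Ω S₁ lam (h lam)) (VortexObstacle.w2 Ω S₁ a lam (h lam))) ∧
    -- `λ < λ₀(a)`
    (∀ lam : ℝ, 0 < lam → lam < VortexObstacle.lam0 Ω S₁ a h₀ →
      h lam =ᵐ[MeasureTheory.volume.restrict Ω] h₀ ∧ μ lam = 0 ∧
        VortexObstacle.w Ω S₁ a lam (h lam) = ∅) ∧
    -- `λ = λ₀(a)`
    (∀ lam : ℝ, 0 < lam → lam = VortexObstacle.lam0 Ω S₁ a h₀ →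
      h lam =ᵐ[MeasureTheory.volume.restrict Ω] h₀ ∧ μ lam = 0 ∧
        VortexObstacle.w Ω S₁ a lam (h lam) =
          VortexObstacle.w Ω S₁ a (VortexObstacle.lam0 Ω S₁ a h₀)
            (h (VortexObstacle.lam0 Ω S₁ a h₀))) ∧
    -- `λ > λ₀(a)`
    (∀ lam : ℝ, 0 < lam → VortexObstacle.lam0 Ω S₁ a h₀ < lam → μ lam ≠ 0) ∧
    -- `λ < λ_i(a)`
    (∀ lam : ℝ, 0 < lam → lam < VortexObstacle.lam1 Ω S₁ h₀ →
      VortexObstacle.w1 Ω S₁ lam (h lam) = ∅) ∧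
    (∀ lam : ℝ, 0 < lam → lam < VortexObstacle.lam2 Ω S₁ a h₀ →
      VortexObstacle.w2 Ω S₁ a lam (h lam) = ∅) := by
  have hD : VortexObstacle.Geometry Ω S₁ a :=
    ⟨hΩ_open, hΩ_bounded, hΩ_smooth, hS_open, hS_nonempty, hS_smooth, hS_sub, ha_pos⟩
  have hu₀ := VortexObstacle.isFreeSolution_of_potential hD hh₀
  have hu : ∀ lam, 0 < lam → ∃ G, VortexObstacle.IsPotential Ω S₁ a (μ lam) (h lam) G ∧
      VortexObstacle.IsObstacleSolution Ω S₁ a lam (fun x => 1 - h lam x) (fun x => - G x) :=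
    fun lam hlam => VortexObstacle.isObstacleSolution_of_minimizer hD hlam hh₀ (hμ lam hlam)
  have hS₁Ω : S₁ ⊆ Ω := subset_closure.trans hS_sub
  have hS₂Ω : VortexObstacle.outerRegion Ω S₁ ⊆ Ω := Set.sdiff_subset
  have crit1 : ∀ lam, 0 < lam → (lam ≤ VortexObstacle.lam1 Ω S₁ h₀ ↔ _) := fun lam hlam =>
    hu₀.le_critical_iff hD hS_open hS_nonempty hS₁Ω one_pos hlam
  have crit2 : ∀ lam, 0 < lam → (lam ≤ VortexObstacle.lam2 Ω S₁ a h₀ ↔ _) := fun lam hlam =>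
    hu₀.le_critical_iff hD hD.isOpen_outerRegion hD.nonempty_outerRegion hS₂Ω ha_pos hlam
  have empty1 : ∀ lam : ℝ, 0 < lam → lam < VortexObstacle.lam1 Ω S₁ h₀ →
      VortexObstacle.w1 Ω S₁ lam (h lam) = ∅ := by
    intro lam hlam hlt
    obtain ⟨G, -, hG⟩ := hu lam hlam
    exact hG.contactSet_eq_empty hD hu₀ hS_open hS_nonempty hS₁Ω one_pos hlam hlt
  have empty2 : ∀ lam : ℝ, 0 < lam → lam < VortexObstacle.lam2 Ω S₁ a h₀ →
      VortexObstacle.w2 Ω S₁ a lam (h lam) = ∅ := by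
    intro lam hlam hlt
    obtain ⟨G, -, hG⟩ := hu lam hlam
    exact hG.contactSet_eq_empty hD hu₀ hD.isOpen_outerRegion hD.nonempty_outerRegion hS₂Ω
      ha_pos hlam hlt
  have free : ∀ lam : ℝ, 0 < lam → lam ≤ VortexObstacle.lam0 Ω S₁ a h₀ →
      h lam =ᵐ[MeasureTheory.volume.restrict Ω] h₀ ∧ μ lam = 0 := by
    intro lam hlam hle
    obtain ⟨G, hp, hG⟩ := hu lam hlam
    -- Up to the critical constant the unconstrained solution respects the obstacle, so uniqueness
    -- identifies it with `1 - h lam`; the two measures then have the same potential.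
    have hv := hu₀.isObstacleSolution (hu₀.ae_le_obstacle hD hlam
      ((crit1 lam hlam).1 (hle.trans (min_le_left _ _)))
      ((crit2 lam hlam).1 (hle.trans (min_le_right _ _))))
    have hh : h lam =ᵐ[MeasureTheory.volume.restrict Ω] h₀ :=
      (hG.unique hD hlam hv).mono fun x hx => sub_right_injective hx
    refine ⟨hh, VortexObstacle.eq_zero_of_signedIntegral_eq_zero hΩ_open (hμ lam hlam).1.1
      fun φ hφ => ?_⟩
    rw [VortexObstacle.signedIntegral_eq_of_ae_eq hD hp hh₀ hh hφ, VortexObstacle.signedIntegral,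
      MeasureTheory.SignedMeasure.toJordanDecomposition_zero]
    simp
  refine ⟨⟨fun lam lam' hlam hle x hx => ?_, Set.Subset.antisymm ?_ fun x hx => ?_⟩,
    fun lam hlam => ?_, fun lam hlam hlt => ?_, fun lam hlam heq => ?_, fun lam hlam hlt h0 => ?_,
    empty1, empty2⟩
  · have hlam' := hlam.trans_le hle
    obtain ⟨G, -, hG⟩ := hu lam hlam
    obtain ⟨G', -, hG'⟩ := hu lam' hlam'
    rw [hG.mem_w_iff hD hlam] at hx
    obtain ⟨hxΩ, hx⟩ := hx
    have hxc := subset_closure hxΩ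
    refine (hG'.mem_w_iff hD hlam').2 ⟨hxΩ, le_antisymm (hG'.one_sub_value_le hD hlam' hxc) ?_⟩
    -- Contact means `λ (1 - h_*) = p / 2`. The left side is nondecreasing in `λ` and never exceeds
    -- `p / 2`, so contact persists.
    have h1 := VortexObstacle.mul_one_sub_value_le hΩ_open hxc (hG.abs_le hD hlam)
      (hG'.abs_le hD hlam') hlam hlam' (hG.mono hD hlam hle hG')
    rw [hx] at h1
    rw [div_le_iff₀ (by linarith)]
    have h2 : lam * (VortexObstacle.pinning S₁ a x / (2 * lam))
        = VortexObstacle.pinning S₁ a x / 2 := by field_simp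
    linarith
  · refine Set.iUnion₂_subset fun lam hlam x hx => ?_
    obtain ⟨G, -, hG⟩ := hu lam hlam
    exact ((hG.mem_w_iff hD hlam).1 hx).1
  · obtain ⟨lam, hlam, hval⟩ := VortexObstacle.exists_one_sub_value_eq hD hx
    obtain ⟨G, -, hG⟩ := hu lam hlam
    exact Set.mem_iUnion₂.2 ⟨lam, hlam, (hG.mem_w_iff hD hlam).2 ⟨hx, hval _ _ hG⟩⟩
  · refine Set.disjoint_left.2 fun x h1 h2 => ha_ne ?_
    have e := h1.2
    rw [div_one] at e
    have e2 := h2.2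
    rw [e, div_eq_iff ha_pos.ne'] at e2
    exact (mul_eq_left₀ (by positivity)).1 e2.symm
  · obtain ⟨h1, h2⟩ := free lam hlam hlt.le
    refine ⟨h1, h2, ?_⟩
    rw [VortexObstacle.w, empty1 lam hlam (hlt.trans_le (min_le_left _ _)),
      empty2 lam hlam (hlt.trans_le (min_le_right _ _)), Set.union_empty]
  · obtain ⟨h1, h2⟩ := free lam hlam heq.le
    exact ⟨h1, h2, by rw [← heq]⟩
  · obtain ⟨G, hp, hG⟩ := hu lam hlam
    rw [h0] at hp
    -- If `μ_* = 0`, then `h_*` has the values of `h₀`, so `h₀` obeys the pointwise obstacle bound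
    -- on both closures; this says `λ ≤ λ₀(a)`, a contradiction.
    have hv : ∀ x, VortexObstacle.value Ω (h lam) x = VortexObstacle.value Ω h₀ x := fun x =>
      VortexObstacle.value_congr (((VortexObstacle.isFreeSolution_of_potential hD hp).unique hD
        hu₀).1.mono fun y hy => sub_right_injective hy)
    refine hlt.not_ge (le_min ((crit1 lam hlam).2 fun x hx => ?_)
      ((crit2 lam hlam).2 fun x hx => ?_))
    · rw [← hv, div_one]
      exact (hG.one_sub_value_le hD hlam (subset_closure (hS_sub hx))).trans
        (div_le_div_of_nonneg_right
          (VortexObstacle.pinning_le_one_of_mem_closure hS_open hx) (by linarith))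
    · rw [← hv, div_le_iff₀ ha_pos, one_div_mul_eq_div]
      exact (hG.one_sub_value_le hD hlam (VortexObstacle.closure_outerRegion_subset hx)).trans
        (div_le_div_of_nonneg_right
          (VortexObstacle.pinning_le_of_mem_closure_outerRegion hS_open hx) (by linarith))
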